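/- For $f:\mathbb{F}_2^n\to\mathbb{F}_2$ let $|\psi_f\rangle=2^{-n/2}\sum_{x\in\mathbb{F}_2^n}(-1)^{f(x)}|x\rangle$. Let $0<\varepsilon<1$ be a constant. Then there are constants $\delta\in(0,1)$, $C$ and $\kappa>0$, and a single quantum algorithm (all depending only on $\varepsilon$), such that for all sufficiently large $n$ and every upper triangular $A\in\mathbb{F}_2^{n\times n}$ (diagonal included) the following holds with $f(x)=x^\top A x$. Given $n$ and $M=\lfloor 2n^{1+\delta}\rfloor$ copies of the globally depolarized phase state $$\psi_f=(1-\varepsilon)\,|\psi_f\rangle\langle\psi_f|+\varepsilon\,\frac{\mathbb{I}}{2^n},$$ the algorithm stops within $n\cdot 2^{Cn/\log\log n}$ steps and outputs $A$ with probability at least $1-2^{-\kappa n}$. Here an algorithm is a fixed program, independent of $n$ and $A$, for a random access machine (unit-cost addition, truncated subtraction, indirect addressing, tests and loops) that controls the $Mn$ qubits of the copies through Hadamard, $T$ and CNOT gates and computational-basis measurements; every instruction is one step, and $n$ and $M$ are its classical input. -/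

import Mathlib

open scoped Matrix

namespace PhaseLearning

noncomputable section

/-! ### Quantum registers, gates, measurements -/

/-- Computational basis strings of a register of `Q` qubits. -/
abbrev Bits (Q : ℕ) : Type := Fin Q → ZMod 2

/-- Operators (in particular density matrices) on a register of `Q` qubits, written in the
computational basis. -/
abbrev Op (Q : ℕ) : Type := Matrix (Bits Q) (Bits Q) ℂ

/-- The one-qubit Hadamard gate, with entries `(-1)^(ab) / √2`. -/
def gateH : Matrix (ZMod 2) (ZMod 2) ℂ :=
  Matrix.of fun a b => (-1 : ℂ) ^ (a.val * b.val) / ((Real.sqrt 2 : ℝ) : ℂ)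

/-- The one-qubit gate `T = diag(1, exp(iπ/4))`. -/
def gateT : Matrix (ZMod 2) (ZMod 2) ℂ :=
  Matrix.diagonal fun a => Complex.exp (Complex.I * (Real.pi : ℂ) / 4 * (a.val : ℂ))

/-- The projector `|b⟩⟨b|` on one qubit. -/
def proj (b : ZMod 2) : Matrix (ZMod 2) (ZMod 2) ℂ :=
  Matrix.diagonal fun a => if a = b then 1 else 0

/-- The one-qubit operator `U` acting on qubit `q`, tensored with the identity elsewhere. -/
def onQubit {Q : ℕ} (U : Matrix (ZMod 2) (ZMod 2) ℂ) (q : Fin Q) : Op Q :=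
  Matrix.of fun x y => if ∀ p, p ≠ q → x p = y p then U (x q) (y q) else 0

/-- The controlled-NOT gate `|y⟩ ↦ |y with y_t replaced by y_t + y_c⟩`, for `c ≠ t`. -/
def cnot {Q : ℕ} (c t : Fin Q) : Op Q :=
  Matrix.of fun x y => if x = Function.update y t (y t + y c) then 1 else 0

/-- Conjugation `ρ ↦ U ρ U†`. -/
def conj {Q : ℕ} (U ρ : Op Q) : Op Q := U * ρ * Uᴴ

/-- Apply the one-qubit gate `U` to the qubit with address `q`
(nothing happens when there is no such qubit). -/
def applyGate {Q : ℕ} (U : Matrix (ZMod 2) (ZMod 2) ℂ) (q : ℕ) (ρ : Op Q) : Op Q :=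
  if h : q < Q then conj (onQubit U ⟨q, h⟩) ρ else ρ

/-- Apply a controlled-NOT with control address `c` and target address `t`
(nothing happens unless these are the addresses of two different qubits). -/
def applyCnot {Q : ℕ} (c t : ℕ) (ρ : Op Q) : Op Q :=
  if h : c < Q ∧ t < Q ∧ c ≠ t then conj (cnot ⟨c, h.1⟩ ⟨t, h.2.1⟩) ρ else ρ

/-- The unnormalized state after the qubit with address `q` was measured in the computational
basis with outcome `b`; its trace is the probability of that outcome times the trace of `ρ`.
Measuring an address without a qubit gives `0` and changes nothing. -/
def postMeasure {Q : ℕ} (q : ℕ) (b : ZMod 2) (ρ : Op Q) : Op Q :=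
  if h : q < Q then conj (onQubit (proj b) ⟨q, h⟩) ρ else if b = 0 then ρ else 0

/-! ### A random access machine that controls a quantum register -/

/-- Programs. The classical memory consists of the cells `m 0, m 1, m 2, …`, each of which holds
a natural number. Qubits are addressed through cells. -/
inductive Prog : Type
  /-- `m i := k` -/
  | const (i k : ℕ)
  /-- `m i := m j + m k` -/
  | plus (i j k : ℕ)
  /-- `m i := m j - m k`, or `0` if `m j < m k` -/
  | minus (i j k : ℕ)
  /-- `m i := m (m j)` -/
  | load (i j : ℕ)
  /-- `m (m i) := m j` -/
  | store (i j : ℕ)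
  /-- Hadamard gate on qubit `m j` -/
  | hadamard (j : ℕ)
  /-- `T` gate on qubit `m j` -/
  | tgate (j : ℕ)
  /-- controlled-NOT with control `m j` and target `m k` -/
  | cnot (j k : ℕ)
  /-- measure qubit `m j` in the computational basis and store the outcome in `m i` -/
  | measure (i j : ℕ)
  /-- first `a`, then `b` -/
  | seq (a b : Prog)
  /-- if `m i ≠ 0` then `a` else `b` -/
  | ite (i : ℕ) (a b : Prog)
  /-- while `m i ≠ 0` do `a` -/
  | loop (i : ℕ) (a : Prog)

/-- Contents of the classical memory. -/
abbrev Mem : Type := ℕ → ℕ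

open Classical in
/-- `haltWeight post t ps m ρ` is the probability (scaled by the trace of `ρ`) that the machine,
started in classical memory `m` and quantum state `ρ` with the programs `ps` still to be executed
one after the other, stops within `t` steps in a memory that satisfies `post`. Every elementary
instruction, every test and every sequencing is one step; a measurement branches into its two
outcomes. -/
def haltWeight {Q : ℕ} (post : Mem → Prop) : ℕ → List Prog → Mem → Op Q → ℝ
  | _, [], m, ρ => if post m then (Matrix.trace ρ).re else 0
  | 0, _ :: _, _, _ => 0
  | t + 1, .const i k :: ps, m, ρ => haltWeight post t ps (Function.update m i k) ρ
  | t + 1, .plus i j k :: ps, m, ρ => haltWeight post t ps (Function.update m i (m j + m k)) ρ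
  | t + 1, .minus i j k :: ps, m, ρ => haltWeight post t ps (Function.update m i (m j - m k)) ρ
  | t + 1, .load i j :: ps, m, ρ => haltWeight post t ps (Function.update m i (m (m j))) ρ
  | t + 1, .store i j :: ps, m, ρ => haltWeight post t ps (Function.update m (m i) (m j)) ρ
  | t + 1, .hadamard j :: ps, m, ρ => haltWeight post t ps m (applyGate gateH (m j) ρ)
  | t + 1, .tgate j :: ps, m, ρ => haltWeight post t ps m (applyGate gateT (m j) ρ)
  | t + 1, .cnot j k :: ps, m, ρ => haltWeight post t ps m (applyCnot (m j) (m k) ρ)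
  | t + 1, .measure i j :: ps, m, ρ =>
      haltWeight post t ps (Function.update m i 0) (postMeasure (m j) 0 ρ)
        + haltWeight post t ps (Function.update m i 1) (postMeasure (m j) 1 ρ)
  | t + 1, .seq a b :: ps, m, ρ => haltWeight post t (a :: b :: ps) m ρ
  | t + 1, .ite i a b :: ps, m, ρ => haltWeight post t ((if m i ≠ 0 then a else b) :: ps) m ρ
  | t + 1, .loop i a :: ps, m, ρ =>
      haltWeight post t (if m i ≠ 0 then a :: .loop i a :: ps else ps) m ρ

/-! ### Noisy phase states -/

/-- The phase state `|ψ_f⟩ = 2^(-n/2) ∑ₓ (-1)^(f x) |x⟩`. -/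
def phaseState {n : ℕ} (f : Bits n → ZMod 2) : Bits n → ℂ :=
  fun x => (-1 : ℂ) ^ (f x).val / ((Real.sqrt (2 ^ n) : ℝ) : ℂ)

/-- Global depolarizing noise: `(1 - ε) |ψ_f⟩⟨ψ_f| + ε I / 2^n`. -/
def noisyPhaseState {n : ℕ} (ε : ℝ) (f : Bits n → ZMod 2) : Op n :=
  ((1 - ε : ℝ) : ℂ) • Matrix.vecMulVec (phaseState f) (star (phaseState f))
    + ((ε / 2 ^ n : ℝ) : ℂ) • (1 : Op n)

/-- The state `ρ ⊗ ⋯ ⊗ ρ` (`M` factors) of `M * n` qubits; qubit `i` of copy `k` has the address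
`i + n * k`. -/
def copies {n : ℕ} (M : ℕ) (ρ : Op n) : Op (M * n) :=
  Matrix.of fun x y => ∏ k : Fin M,
    ρ (fun i => x (finProdFinEquiv (k, i))) (fun i => y (finProdFinEquiv (k, i)))

/-- The quadratic polynomial `x ↦ xᵀ A x` over `𝔽₂`. -/
def quadPoly {n : ℕ} (A : Matrix (Fin n) (Fin n) (ZMod 2)) : Bits n → ZMod 2 :=
  fun x => x ⬝ᵥ (A *ᵥ x)

/-- Input convention: cell `0` holds `n`, cell `1` holds the number `M` of copies, and all other
cells are zero. -/
def inputMem (n M : ℕ) : Mem := fun c => if c = 0 then n else if c = 1 then M else 0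

/-- Output convention: cell `0` holds the address of an array in memory that lists the entries of
`A` (as numbers `0` and `1`) row by row. -/
def Outputs {n : ℕ} (A : Matrix (Fin n) (Fin n) (ZMod 2)) (m : Mem) : Prop :=
  ∀ i j : Fin n, m (m 0 + n * (i : ℕ) + (j : ℕ)) = (A i j).val

/-- The probability that the program `P`, run on `M` copies of the phase state of `xᵀ A x` with
global depolarizing noise `ε`, stops within `t` steps and outputs `A`. -/
def learnProb {n : ℕ} (P : Prog) (ε : ℝ) (A : Matrix (Fin n) (Fin n) (ZMod 2)) (M t : ℕ) : ℝ :=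
  haltWeight (Outputs A) t [P] (inputMem n M) (copies M (noisyPhaseState ε (quadPoly A)))

end

end PhaseLearning

set_option linter.unusedSimpArgs false

/-! ### Semantics: from the branching machine to single runs on pure states. -/

namespace PhaseLearning

/-! ### Pure states and runs along a fixed sequence of measurement outcomes -/

/-! Write B = A + Aᵀ. Depolarizing noise is classical noise on the function: averaging the phase
states of f(x) + b·x over all b gives the maximally mixed state. So a copy is a phase state of f(x)
+ b·x with a random b that is 0 with weight 1 - ε and uniform otherwise (`noisyPhaseState_apply`,
`copies_eq`).

The copies are used in groups of three, with noise b₀, b₁, b₂. CNOTs from the first copy onto the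
second, whose measured value is y, leave the phase f(u) + f(y + u) plus linear terms. Its quadratic
parts cancel, and a Hadamard measurement yields z = By + b₀ + b₁ with certainty, while y is uniform.
Hence (y, z) lies on the graph of B with at least a constant probability. Since B is symmetric, the
graph is isotropic for the symplectic form: a vector (u, Bu + w) has product w·y + u·(b₀ + b₁) with
a sample. For w ≠ 0 this is a fair bit; for w = 0 its mean is at most ε(1 - ε/2) < 1/2. Counting the
samples that are not orthogonal to a vector therefore decides whether the vector is on the graph
(`Good.onGraph`), and the spoiled samples can be discarded. Gaussian elimination on the remaining
ones recovers B (`Good.echelon`, `solvedRow_of_full`), hence A above the diagonal. Controlled phase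
flips strip these entries off the third copies. What is left is a linear phase with coefficients Aᵢᵢ
plus those of b₂, and a majority vote over the groups yields the diagonal, each noise bit being 1
with probability ε/2 < 1/2.

All requirements concern at most 4ⁿ vectors or pairs of vectors each, and each fails with
probability at most r^G for a constant r < 1, where G = ⌊M/3⌋ (`totalEx_tail`, `le_totalEx_good`).
As G/n tends to infinity, the union bound leaves at most 2⁻ⁿ. The running time is polynomial, far
below the permitted bound.

The link to the machine has two halves. The halting weight is linear in the state
(`haltWeight_sum`), and on a pure state it dominates the sum over distinct outcome sequences of the
weights of single runs (`sum_pathWeight_le`). A run with prescribed outcomes is deterministic, so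
the program is verified by an ordinary program logic (`learner_spec`), and the state stays a product
over the copies whose norm can be followed (`nrm_final`). Both halves meet in
`sum_good_le_learnProb`. -/

/-- Elementary quantum events: gates, and measurements together with their outcome. -/
inductive QOp : Type
  | H (q : ℕ)
  | T (q : ℕ)
  | C (c t : ℕ)
  | P (q : ℕ) (b : ZMod 2)

/-- The outcome recorded by an event. -/
def QOp.outcome : QOp → List (ZMod 2)
  | .P _ b => [b]
  | _ => []

/-- The outcomes recorded by a list of events. -/
def outcomes (o : List QOp) : List (ZMod 2) := o.flatMap QOp.outcome

noncomputable section

/-- Action of an event on an unnormalized state vector. -/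
def act {Q : ℕ} : QOp → (Bits Q → ℂ) → (Bits Q → ℂ)
  | .H q, φ => if h : q < Q then onQubit gateH ⟨q, h⟩ *ᵥ φ else φ
  | .T q, φ => if h : q < Q then onQubit gateT ⟨q, h⟩ *ᵥ φ else φ
  | .C c t, φ => if h : c < Q ∧ t < Q ∧ c ≠ t then cnot ⟨c, h.1⟩ ⟨t, h.2.1⟩ *ᵥ φ else φ
  | .P q b, φ =>
      if h : q < Q then onQubit (proj b) ⟨q, h⟩ *ᵥ φ else if b = 0 then φ else 0

/-- Action of a list of events, the head first. -/
def acts {Q : ℕ} (o : List QOp) (φ : Bits Q → ℂ) : Bits Q → ℂ := o.foldl (fun φ e => act e φ) φ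

@[simp] theorem acts_nil {Q : ℕ} (φ : Bits Q → ℂ) : acts [] φ = φ := rfl

@[simp] theorem acts_cons {Q : ℕ} (e : QOp) (o : List QOp) (φ : Bits Q → ℂ) :
    acts (e :: o) φ = acts o (act e φ) := rfl

theorem acts_append {Q : ℕ} (o o' : List QOp) (φ : Bits Q → ℂ) :
    acts (o ++ o') φ = acts o' (acts o φ) := by
  simp [acts]

@[simp] theorem outcomes_nil : outcomes [] = [] := rfl

theorem outcomes_append (o o' : List QOp) : outcomes (o ++ o') = outcomes o ++ outcomes o' := by
  simp [outcomes]

/-- The rank-one operator `|φ⟩⟨φ|`. -/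
def pureOp {Q : ℕ} (φ : Bits Q → ℂ) : Op Q := Matrix.vecMulVec φ (star φ)

/-- The squared norm of a state vector. -/
def nrm {Q : ℕ} (φ : Bits Q → ℂ) : ℝ := ∑ x, Complex.normSq (φ x)

theorem nrm_nonneg {Q : ℕ} (φ : Bits Q → ℂ) : 0 ≤ nrm φ :=
  Finset.sum_nonneg fun _ _ => Complex.normSq_nonneg _

theorem trace_pureOp {Q : ℕ} (φ : Bits Q → ℂ) : (Matrix.trace (pureOp φ)).re = nrm φ := by
  simp only [Matrix.trace, pureOp, Matrix.diag_apply, Matrix.vecMulVec_apply, nrm, Complex.re_sum,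
    Pi.star_apply, Complex.star_def, Complex.mul_conj, Complex.ofReal_re]

theorem conj_pureOp {Q : ℕ} (U : Op Q) (φ : Bits Q → ℂ) :
    conj U (pureOp φ) = pureOp (U *ᵥ φ) := by
  simp only [conj, pureOp, Matrix.mul_vecMulVec, Matrix.vecMulVec_mul, Matrix.star_mulVec]

theorem applyGate_H_pureOp {Q : ℕ} (q : ℕ) (φ : Bits Q → ℂ) :
    applyGate gateH q (pureOp φ) = pureOp (act (.H q) φ) := by
  unfold applyGate act; split_ifs with h <;> simp only [conj_pureOp, h, dite_true, dite_false]

theorem applyGate_T_pureOp {Q : ℕ} (q : ℕ) (φ : Bits Q → ℂ) :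
    applyGate gateT q (pureOp φ) = pureOp (act (.T q) φ) := by
  unfold applyGate act; split_ifs with h <;> simp only [conj_pureOp, h, dite_true, dite_false]

theorem applyCnot_pureOp {Q : ℕ} (c t : ℕ) (φ : Bits Q → ℂ) :
    applyCnot c t (pureOp φ) = pureOp (act (.C c t) φ) := by
  simp only [applyCnot, act]
  split_ifs
  · exact conj_pureOp _ _
  · rfl

theorem postMeasure_pureOp {Q : ℕ} (q : ℕ) (b : ZMod 2) (φ : Bits Q → ℂ) :
    postMeasure q b (pureOp φ) = pureOp (act (.P q b) φ) := by
  unfold postMeasure act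
  split_ifs with h hb
  · simp only [conj_pureOp, h, dite_true]
  · simp only [h, hb, dite_false, if_true]
  · ext; simp [h, hb, pureOp, Matrix.vecMulVec_apply]

open Classical in
/-- The weight of the run of the machine in which the outcomes of the measurements are those on the
given tape. -/
def pathWeight {Q : ℕ} (post : Mem → Prop) :
    ℕ → List Prog → Mem → (Bits Q → ℂ) → List (ZMod 2) → ℝ
  | _, [], m, φ, l => if post m ∧ l = [] then nrm φ else 0
  | 0, _ :: _, _, _, _ => 0
  | t + 1, .const i k :: ps, m, φ, l => pathWeight post t ps (Function.update m i k) φ l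
  | t + 1, .plus i j k :: ps, m, φ, l => pathWeight post t ps (Function.update m i (m j + m k)) φ l
  | t + 1, .minus i j k :: ps, m, φ, l => pathWeight post t ps (Function.update m i (m j - m k)) φ l
  | t + 1, .load i j :: ps, m, φ, l => pathWeight post t ps (Function.update m i (m (m j))) φ l
  | t + 1, .store i j :: ps, m, φ, l => pathWeight post t ps (Function.update m (m i) (m j)) φ l
  | t + 1, .hadamard j :: ps, m, φ, l => pathWeight post t ps m (act (.H (m j)) φ) l
  | t + 1, .tgate j :: ps, m, φ, l => pathWeight post t ps m (act (.T (m j)) φ) l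
  | t + 1, .cnot j k :: ps, m, φ, l => pathWeight post t ps m (act (.C (m j) (m k)) φ) l
  | _ + 1, .measure _ _ :: _, _, _, [] => 0
  | t + 1, .measure i j :: ps, m, φ, b :: l =>
      pathWeight post t ps (Function.update m i b.val) (act (.P (m j) b) φ) l
  | t + 1, .seq a b :: ps, m, φ, l => pathWeight post t (a :: b :: ps) m φ l
  | t + 1, .ite i a b :: ps, m, φ, l =>
      pathWeight post t ((if m i ≠ 0 then a else b) :: ps) m φ l
  | t + 1, .loop i a :: ps, m, φ, l =>
      pathWeight post t (if m i ≠ 0 then a :: .loop i a :: ps else ps) m φ l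

theorem pathWeight_nonneg {Q : ℕ} (post : Mem → Prop) (t : ℕ) (ps : List Prog) (m : Mem)
    (φ : Bits Q → ℂ) (l : List (ZMod 2)) : 0 ≤ pathWeight post t ps m φ l := by
  induction t generalizing ps m φ l with
  | zero =>
    cases ps with
    | nil => unfold pathWeight; split_ifs <;> simp [nrm_nonneg]
    | cons p ps => unfold pathWeight; exact le_rfl
  | succ t ih =>
    cases ps with
    | nil => unfold pathWeight; split_ifs <;> simp [nrm_nonneg]
    | cons p ps =>
      cases p with
      | measure i j =>
        cases l with
        | nil => unfold pathWeight; exact le_rfl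
        | cons b l => unfold pathWeight; exact ih _ _ _ _
      | _ => unfold pathWeight; exact ih _ _ _ _

/-- Distinct tapes follow distinct branches of the tree of measurements, so their weights are
disjoint parts of one total. Injectivity keeps a branch from being counted twice; branches outside
the family are dropped. -/
theorem sum_pathWeight_le {Q : ℕ} (post : Mem → Prop) {ι : Type} (t : ℕ) (ps : List Prog)
    (m : Mem) (φ : Bits Q → ℂ) (s : Finset ι) (l : ι → List (ZMod 2)) (hl : Set.InjOn l s) :
    ∑ i ∈ s, pathWeight post t ps m φ (l i) ≤ haltWeight post t ps m (pureOp φ) := by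
  classical
  have hnil : ∀ (t : ℕ) (m : Mem) (φ : Bits Q → ℂ) (s : Finset ι) (l : ι → List (ZMod 2)),
      Set.InjOn l s →
      ∑ i ∈ s, pathWeight post t [] m φ (l i) ≤ haltWeight post t [] m (pureOp φ) := by
    intro t m φ s l hl
    have e : ∀ x, pathWeight post t [] m φ x = if x = [] then (if post m then nrm φ else 0) else 0 := by
      intro x
      unfold pathWeight
      by_cases h1 : post m <;> by_cases h2 : x = [] <;> simp [h1, h2]
    have e2 : haltWeight post t [] m (pureOp φ) = if post m then nrm φ else 0 := by
      unfold haltWeight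
      rw [trace_pureOp]
    rw [e2, Finset.sum_congr rfl fun i _ => e (l i), ← Finset.sum_filter, Finset.sum_const]
    -- A finished program accepts only the empty tape, which injectivity allows for at most one
    -- index.
    have hc : (s.filter fun i => l i = []).card ≤ 1 := by
      rw [Finset.card_le_one]
      intro a ha b hb
      simp only [Finset.mem_filter] at ha hb
      exact hl ha.1 hb.1 (ha.2.trans hb.2.symm)
    have hn : 0 ≤ if post m then nrm φ else 0 := by split_ifs <;> simp [nrm_nonneg]
    rw [nsmul_eq_mul]
    have : ((s.filter fun i => l i = []).card : ℝ) ≤ 1 := by exact_mod_cast hc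
    nlinarith
  induction t generalizing ps m φ s l with
  | zero =>
    cases ps with
    | nil => exact hnil _ _ _ _ _ hl
    | cons p ps => simp [pathWeight, haltWeight]
  | succ t ih =>
    cases ps with
    | nil => exact hnil _ _ _ _ _ hl
    | cons p ps =>
      cases p with
      | measure i j =>
        -- The tapes are split by their first outcome; within each class the tails are still
        -- distinct.
        have key : ∀ x : List (ZMod 2), pathWeight post (t + 1) (.measure i j :: ps) m φ x ≤
            (if x.head? = some 0 then
              pathWeight post t ps (Function.update m i 0) (act (.P (m j) 0) φ) x.tail else 0) +
            (if x.head? = some 1 then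
              pathWeight post t ps (Function.update m i 1) (act (.P (m j) 1) φ) x.tail else 0) := by
          intro x
          cases x with
          | nil => simp [pathWeight]
          | cons b x =>
            have hb : b = 0 ∨ b = 1 := by revert b; decide
            rcases hb with rfl | rfl
            · simp [pathWeight]
            · simp [pathWeight, ZMod.val_one]
        have hinj : ∀ c : ZMod 2, Set.InjOn (fun k => (l k).tail)
            ((s.filter fun k => (l k).head? = some c : Finset ι) : Set ι) := by
          intro c a ha b hb hab
          simp only [Finset.coe_filter, Set.mem_ofPred_eq] at ha hb
          apply hl ha.1 hb.1
          rw [← List.cons_head?_tail ha.2, ← List.cons_head?_tail hb.2]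
          exact congrArg _ hab
        refine (Finset.sum_le_sum fun k _ => key (l k)).trans ?_
        rw [Finset.sum_add_distrib, ← Finset.sum_filter, ← Finset.sum_filter]
        have e : haltWeight post (t + 1) (.measure i j :: ps) m (pureOp φ) =
          haltWeight post t ps (Function.update m i 0) (pureOp (act (.P (m j) 0) φ))
          + haltWeight post t ps (Function.update m i 1) (pureOp (act (.P (m j) 1) φ)) := by
          rw [← postMeasure_pureOp, ← postMeasure_pureOp]; simp only [haltWeight]
        rw [e]
        exact add_le_add (ih _ _ _ _ _ (hinj 0)) (ih _ _ _ _ _ (hinj 1))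
      | hadamard j =>
        simp only [pathWeight, haltWeight, applyGate_H_pureOp]; exact ih _ _ _ _ _ hl
      | tgate j =>
        simp only [pathWeight, haltWeight, applyGate_T_pureOp]; exact ih _ _ _ _ _ hl
      | cnot j k =>
        simp only [pathWeight, haltWeight, applyCnot_pureOp]; exact ih _ _ _ _ _ hl
      | _ => simp only [pathWeight, haltWeight]; exact ih _ _ _ _ _ hl

/-! ### Linearity of the halting weight -/

theorem applyGate_sum {Q : ℕ} {ι : Type} (U : Matrix (ZMod 2) (ZMod 2) ℂ) (q : ℕ) (s : Finset ι)
    (c : ι → ℂ) (ρ : ι → Op Q) :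
    applyGate U q (∑ i ∈ s, c i • ρ i) = ∑ i ∈ s, c i • applyGate U q (ρ i) := by
  unfold applyGate conj
  split_ifs
  · simp [Finset.mul_sum, Finset.sum_mul]
  · rfl

theorem applyCnot_sum {Q : ℕ} {ι : Type} (a b : ℕ) (s : Finset ι) (c : ι → ℂ) (ρ : ι → Op Q) :
    applyCnot a b (∑ i ∈ s, c i • ρ i) = ∑ i ∈ s, c i • applyCnot a b (ρ i) := by
  unfold applyCnot conj
  split_ifs
  · simp [Finset.mul_sum, Finset.sum_mul]
  · rfl

theorem postMeasure_sum {Q : ℕ} {ι : Type} (q : ℕ) (b : ZMod 2) (s : Finset ι) (c : ι → ℂ)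
    (ρ : ι → Op Q) :
    postMeasure q b (∑ i ∈ s, c i • ρ i) = ∑ i ∈ s, c i • postMeasure q b (ρ i) := by
  unfold postMeasure conj
  split_ifs
  · simp [Finset.mul_sum, Finset.sum_mul]
  · rfl
  · simp

/-- Control flow depends only on the classical memory, and each instruction acts linearly on the
operator. This allows a mixed input to be replaced by the pure states of a mixture. -/
theorem haltWeight_sum {Q : ℕ} {ι : Type} (post : Mem → Prop) (t : ℕ) (ps : List Prog) (m : Mem)
    (s : Finset ι) (c : ι → ℝ) (ρ : ι → Op Q) :
    haltWeight post t ps m (∑ i ∈ s, (c i : ℂ) • ρ i) =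
      ∑ i ∈ s, c i * haltWeight post t ps m (ρ i) := by
  have hnil : ∀ (t : ℕ) (m : Mem) (ρ : ι → Op Q),
      haltWeight post t [] m (∑ i ∈ s, (c i : ℂ) • ρ i) =
      ∑ i ∈ s, c i * haltWeight post t [] m (ρ i) := by
    intro t m ρ
    unfold haltWeight
    split_ifs
    · simp [Matrix.trace_sum, Matrix.trace_smul]
    · simp
  induction t generalizing ps m ρ with
  | zero =>
    cases ps with
    | nil => exact hnil _ _ _
    | cons p ps => simp [haltWeight]
  | succ t ih =>
    cases ps with
    | nil => exact hnil _ _ _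
    | cons p ps =>
      cases p <;> simp only [haltWeight, applyGate_sum, applyCnot_sum, postMeasure_sum, ih,
        mul_add, Finset.sum_add_distrib]

end
end PhaseLearning

namespace PhaseLearning

/-! ### A calculus for terminating runs -/

/-- Program `a` started in memory `m` stops after exactly `t` steps in memory `m'`, provided that
the measurement outcomes are those of the events `o`, which are the quantum operations it does. -/
def Run (a : Prog) (m : Mem) (o : List QOp) (t : ℕ) (m' : Mem) : Prop :=
  ∀ (Q : ℕ) (post : Mem → Prop) (T : ℕ) (ps : List Prog) (φ : Bits Q → ℂ) (l : List (ZMod 2)),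
    pathWeight post (T + t) (a :: ps) m φ (outcomes o ++ l) = pathWeight post T ps m' (acts o φ) l

/-- Program `a` started in `m` with events `o` stops within `(X + 3) ^ d` steps in a memory that
satisfies `R`. -/
def Wp (X d : ℕ) (a : Prog) (m : Mem) (o : List QOp) (R : Mem → Prop) : Prop :=
  ∃ t m', t ≤ (X + 3) ^ d ∧ Run a m o t m' ∧ R m'

theorem Run.seq {a b : Prog} {m m1 m2 : Mem} {o1 o2 : List QOp} {t1 t2 : ℕ}
    (h1 : Run a m o1 t1 m1) (h2 : Run b m1 o2 t2 m2) :
    Run (.seq a b) m (o1 ++ o2) (t1 + t2 + 1) m2 := by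
  intro Q post T ps φ l
  rw [show T + (t1 + t2 + 1) = (T + t2) + t1 + 1 by ring, outcomes_append, List.append_assoc,
    acts_append, ← h2, ← h1]
  simp only [pathWeight]

theorem Run.ite_pos {a b : Prog} {i : ℕ} {m m1 : Mem} {o : List QOp} {t : ℕ} (hi : m i ≠ 0)
    (h1 : Run a m o t m1) : Run (.ite i a b) m o (t + 1) m1 := by
  intro Q post T ps φ l
  rw [← h1, ← add_assoc]
  simp only [pathWeight, if_pos hi]

theorem Run.ite_neg {a b : Prog} {i : ℕ} {m m1 : Mem} {o : List QOp} {t : ℕ} (hi : m i = 0)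
    (h1 : Run b m o t m1) : Run (.ite i a b) m o (t + 1) m1 := by
  intro Q post T ps φ l
  rw [← h1, ← add_assoc]
  simp only [pathWeight, hi, ne_eq, not_true, if_false]

theorem Run.loop_stop {a : Prog} {i : ℕ} {m : Mem} (hi : m i = 0) : Run (.loop i a) m [] 1 m := by
  intro Q post T ps φ l
  simp only [pathWeight, hi, ne_eq, not_true, if_false, outcomes_nil, List.nil_append, acts_nil]

theorem Run.loop_step {a : Prog} {i : ℕ} {m m1 m2 : Mem} {o1 o2 : List QOp} {t1 t2 : ℕ}
    (hi : m i ≠ 0) (h1 : Run a m o1 t1 m1) (h2 : Run (.loop i a) m1 o2 t2 m2) :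
    Run (.loop i a) m (o1 ++ o2) (t1 + t2 + 1) m2 := by
  intro Q post T ps φ l
  rw [show T + (t1 + t2 + 1) = (T + t2) + t1 + 1 by ring, outcomes_append, List.append_assoc,
    acts_append, ← h2, ← h1]
  simp only [pathWeight, if_pos hi]

theorem Wp.mono {X d d' : ℕ} {a : Prog} {m : Mem} {o : List QOp} {R R' : Mem → Prop}
    (h : Wp X d a m o R) (hd : d ≤ d') (hR : ∀ m, R m → R' m) : Wp X d' a m o R' := by
  obtain ⟨t, m', ht, hr, hm⟩ := h
  exact ⟨t, m', ht.trans (Nat.pow_le_pow_right (by omega) hd), hr, hR _ hm⟩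

theorem one_le_step (X d : ℕ) : 1 ≤ (X + 3) ^ d := Nat.one_le_pow _ _ (by omega)

section basic
variable {X d : ℕ} {m : Mem} {R : Mem → Prop}

theorem Wp.const {i k : ℕ} (h : R (Function.update m i k)) : Wp X d (.const i k) m [] R :=
  ⟨1, _, one_le_step X d, fun Q post T ps φ l => by simp [pathWeight], h⟩

theorem Wp.plus {i j k v : ℕ} (hv : m j + m k = v) (h : R (Function.update m i v)) :
    Wp X d (.plus i j k) m [] R :=
  ⟨1, _, one_le_step X d, fun Q post T ps φ l => by simp [pathWeight, hv], h⟩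

theorem Wp.minus {i j k v : ℕ} (hv : m j - m k = v) (h : R (Function.update m i v)) :
    Wp X d (.minus i j k) m [] R :=
  ⟨1, _, one_le_step X d, fun Q post T ps φ l => by simp [pathWeight, hv], h⟩

theorem Wp.load {i j v : ℕ} (hv : m (m j) = v) (h : R (Function.update m i v)) :
    Wp X d (.load i j) m [] R :=
  ⟨1, _, one_le_step X d, fun Q post T ps φ l => by simp [pathWeight, hv], h⟩

theorem Wp.store {i j a v : ℕ} (ha : m i = a) (hv : m j = v) (h : R (Function.update m a v)) :
    Wp X d (.store i j) m [] R :=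
  ⟨1, _, one_le_step X d, fun Q post T ps φ l => by simp [pathWeight, ha, hv], h⟩

theorem Wp.hadamard {j q : ℕ} (hq : m j = q) (h : R m) : Wp X d (.hadamard j) m [.H q] R :=
  ⟨1, _, one_le_step X d, fun Q post T ps φ l => by simp [pathWeight, outcomes, QOp.outcome, hq], h⟩

theorem Wp.tgate {j q : ℕ} (hq : m j = q) (h : R m) : Wp X d (.tgate j) m [.T q] R :=
  ⟨1, _, one_le_step X d, fun Q post T ps φ l => by simp [pathWeight, outcomes, QOp.outcome, hq], h⟩

theorem Wp.cnot {j k q r : ℕ} (hq : m j = q) (hr : m k = r) (h : R m) :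
    Wp X d (.cnot j k) m [.C q r] R :=
  ⟨1, _, one_le_step X d,
    fun Q post T ps φ l => by simp [pathWeight, outcomes, QOp.outcome, hq, hr], h⟩

theorem Wp.measure {i j q : ℕ} {b : ZMod 2} (hq : m j = q) (h : R (Function.update m i b.val)) :
    Wp X d (.measure i j) m [.P q b] R :=
  ⟨1, _, one_le_step X d, fun Q post T ps φ l => by simp [pathWeight, outcomes, QOp.outcome, hq], h⟩

/-- Two parts and the sequencing step cost at most 3 * (X + 3) ^ d. The summand 3 in the base of the
bound is there so that one more exponent absorbs this. -/
theorem Wp.seq {a b : Prog} {o1 o2 : List QOp}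
    (h : Wp X d a m o1 fun m1 => Wp X d b m1 o2 R) : Wp X (d + 1) (.seq a b) m (o1 ++ o2) R := by
  obtain ⟨t1, m1, ht1, hr1, t2, m2, ht2, hr2, h2⟩ := h
  refine ⟨_, m2, ?_, hr1.seq hr2, h2⟩
  have := one_le_step X d
  calc t1 + t2 + 1 ≤ (X + 3) ^ d * 3 := by omega
    _ ≤ (X + 3) ^ d * (X + 3) := Nat.mul_le_mul_left _ (by omega)
    _ = _ := (pow_succ _ _).symm

/-- Sequencing whose first part does no quantum operation. -/
theorem Wp.step {a b : Prog} {o : List QOp}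
    (h : Wp X d a m [] fun m1 => Wp X d b m1 o R) : Wp X (d + 1) (.seq a b) m o R :=
  Wp.seq (o1 := []) h

/-- Sequencing whose first part does one quantum operation. -/
theorem Wp.stepq {a b : Prog} {e : QOp} {o : List QOp}
    (h : Wp X d a m [e] fun m1 => Wp X d b m1 o R) : Wp X (d + 1) (.seq a b) m (e :: o) R :=
  Wp.seq (o1 := [e]) h

/-- Sequencing whose first part is a fragment with a known specification. -/
theorem Wp.call {a b : Prog} {o1 o2 o : List QOp} {d' : ℕ} {R1 : Mem → Prop}
    (h : Wp X d' a m o1 R1) (hd : d' ≤ d) (ho : o = o1 ++ o2)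
    (hk : ∀ m1, R1 m1 → Wp X d b m1 o2 R) : Wp X (d + 1) (.seq a b) m o R :=
  ho ▸ Wp.seq (h.mono hd hk)

theorem Wp.ite {i : ℕ} {a b : Prog} {o : List QOp} (h1 : m i ≠ 0 → Wp X d a m o R)
    (h0 : m i = 0 → Wp X d b m o R) : Wp X (d + 1) (.ite i a b) m o R := by
  have h3 : ∀ t, t ≤ (X + 3) ^ d → t + 1 ≤ (X + 3) ^ (d + 1) := by
    intro t ht
    have := one_le_step X d
    rw [pow_succ]
    nlinarith
  by_cases hi : m i = 0
  · obtain ⟨t, m', ht, hr, hm⟩ := h0 hi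
    exact ⟨_, m', h3 t ht, hr.ite_neg hi, hm⟩
  · obtain ⟨t, m', ht, hr, hm⟩ := h1 hi
    exact ⟨_, m', h3 t ht, hr.ite_pos hi, hm⟩

/-- The invariant is indexed by the number of completed rounds, which is known in advance. At most X
rounds, each with one test, fit into two more factors X + 3. -/
theorem Wp.loop {i N : ℕ} {a : Prog} (I : ℕ → Mem → Prop) (o : ℕ → List QOp) (hN : N ≤ X)
    (h0 : I 0 m) (hs : ∀ s < N, ∀ m, I s m → m i ≠ 0 ∧ Wp X d a m (o s) (I (s + 1)))
    (hend : ∀ m, I N m → m i = 0) :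
    Wp X (d + 2) (.loop i a) m ((List.range N).flatMap o) (I N) := by
  have key : ∀ k s m, s + k = N → I s m →
      ∃ t m', t ≤ k * ((X + 3) ^ d + 1) + 1 ∧
        Run (.loop i a) m ((List.range' s k).flatMap o) t m' ∧ I N m' := by
    intro k
    induction k with
    | zero =>
      intro s m hk hI
      obtain rfl : s = N := by omega
      exact ⟨1, m, by omega, Run.loop_stop (hend m hI), hI⟩
    | succ k ih =>
      intro s m hk hI
      obtain ⟨hi, t1, m1, ht1, hr1, hI1⟩ := hs s (by omega) m hI
      obtain ⟨t2, m2, ht2, hr2, hI2⟩ := ih (s + 1) m1 (by omega) hI1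
      refine ⟨_, m2, ?_, hr1.loop_step hi hr2, hI2⟩
      rw [add_mul]
      omega
  obtain ⟨t, m', ht, hr, hI⟩ := key N 0 m (by omega) h0
  refine ⟨t, m', ht.trans ?_, by rwa [List.range_eq_range'], hI⟩
  have := one_le_step X d
  calc N * ((X + 3) ^ d + 1) + 1 ≤ X * ((X + 3) ^ d + 1) + 1 := by gcongr
    _ ≤ (X + 3) ^ d * (X + 3) ^ 2 := by
      nlinarith [Nat.mul_le_mul_left X this, Nat.zero_le (X * X * (X + 3) ^ d)]
    _ = _ := (pow_add _ _ _).symm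

/-- Loops that do no quantum operation. -/
theorem Wp.loopc {i N : ℕ} {a : Prog} (I : ℕ → Mem → Prop) (hN : N ≤ X)
    (h0 : I 0 m) (hs : ∀ s < N, ∀ m, I s m → m i ≠ 0 ∧ Wp X d a m [] (I (s + 1)))
    (hend : ∀ m, I N m → m i = 0) : Wp X (d + 2) (.loop i a) m [] (I N) := by
  have := Wp.loop (m := m) I (fun _ => []) hN h0 hs hend
  rwa [List.flatMap_eq_nil_iff.2 fun _ _ => rfl] at this

end basic

/-- The instructions of a list one after the other. -/
def block : List Prog → Prog
  | [] => .const 63 0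
  | [a] => a
  | a :: b :: l => .seq a (block (b :: l))

end PhaseLearning

/-! ### The subroutines of the program and their specifications. -/

namespace PhaseLearning

/-! ### Operations on vectors of bits in memory -/

/-- Adds modulo two the `m 4` bits at address `m 51` to those at address `m 50`. -/
def xorVec : Prog :=
  block [.plus 52 4 3, .loop 52 (block [.load 53 50, .load 54 51, .minus 55 53 54, .minus 54 54 53,
    .plus 55 55 54, .store 50 55, .plus 50 50 2, .plus 51 51 2, .minus 52 52 2])]

/-- The sum of two bits, as the machine computes it. -/
def xr (a b : ℕ) : ℕ := (a - b) + (b - a)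

/-- One of the two truncated differences vanishes, so their sum is the distance, which for bits is
the exclusive or. -/
theorem xr_val (a b : ZMod 2) : xr a.val b.val = (a + b).val := by revert a b; decide

/-- The two regions may coincide because each position is read before it is written; this case
clears a vector. Only partial overlaps are excluded. -/
theorem xorVec_spec {X N P Q : ℕ} {m : Mem} (h2 : m 2 = 1) (h3 : m 3 = 0) (h4 : m 4 = N)
    (hN : N ≤ X) (hP : m 50 = P) (hQ : m 51 = Q) (hP64 : 64 ≤ P) (hQ64 : 64 ≤ Q)
    (hPQ : P = Q ∨ P + N ≤ Q ∨ Q + N ≤ P) :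
    Wp X 15 xorVec m [] fun m' => (∀ r < 50, m' r = m r) ∧
      ∀ a, 64 ≤ a → m' a = if P ≤ a ∧ a < P + N then xr (m a) (m (Q + (a - P))) else m a := by
  refine Wp.step (Wp.plus rfl ?_)
  refine (Wp.loopc (d := 10) (N := N) (fun s m' => m' 50 = P + s ∧ m' 51 = Q + s ∧ m' 52 = N - s ∧
    (∀ r < 50, m' r = m r) ∧
      ∀ a, 64 ≤ a → m' a = if P ≤ a ∧ a < P + s then xr (m a) (m (Q + (a - P))) else m a)
      hN ?_ ?_ ?_).mono (by norm_num) ?_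
  · simp (disch := omega) only [Function.update_of_ne, Function.update_self]
    refine ⟨by omega, by omega, by omega, fun r hr => ?_, fun a ha => ?_⟩
    · simp (disch := omega) only [Function.update_of_ne]
    · simp (disch := omega) only [Function.update_of_ne, if_neg]
  · rintro s hs m1 ⟨e50, e51, e52, er, ea⟩
    refine ⟨by omega, ?_⟩
    have e2 : m1 2 = 1 := by rw [er 2 (by omega), h2]
    iterate 9
      try apply Wp.step
      first
      | apply Wp.store
      | apply Wp.load
      | apply Wp.plus
      | apply Wp.minus
      iterate 2
        try (on_goal 1 => (simp (disch := first | decide | omega) only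
          [Function.update_of_ne, Function.update_self, e50, e51, e2, e52]; rfl))
    simp (disch := first | decide | omega) only [Function.update_of_ne, Function.update_self]
    refine ⟨by omega, by omega, by omega, fun r hr => ?_, fun a ha => ?_⟩
    · simp (disch := omega) only [Function.update_of_ne, er]
    · by_cases hsa : a = P + s
      · subst hsa
        simp (disch := omega) only [Function.update_of_ne, Function.update_self]
        rw [ea _ (by omega), ea _ (by omega), if_neg (by omega), if_neg (by omega), if_pos (by omega)]
        rw [show P + s - P = s by omega]
        rfl
      · simp (disch := omega) only [Function.update_of_ne]
        rw [ea a ha]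
        congr 1
        apply propext
        omega
  · rintro m1 ⟨-, -, e, -⟩
    omega
  · rintro m1 ⟨-, -, -, h⟩
    exact h

/-- Adds to the bit in cell `53` the inner product modulo two of the `m 0` bits at address `m 50`
with those at address `m 51`. -/
def dotVec : Prog :=
  block [.plus 52 0 3, .loop 52 (block [.load 54 50, .load 55 51, .plus 54 54 55, .minus 54 54 2,
    .minus 55 53 54, .minus 54 54 53, .plus 53 54 55, .plus 50 50 2, .plus 51 51 2, .minus 52 52 2])]

/-- For bits, the truncated value of a + b - 1 is the product; the rest is the exclusive or with c.
-/
theorem dot_val (c a b : ZMod 2) :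
    (a.val + b.val - 1 - c.val) + (c.val - (a.val + b.val - 1)) = (c + a * b).val := by
  revert a b c; decide

/-- The final value of cell `50` is recorded because a second call continues from there with the
other half of the same vector. -/
theorem dotVec_spec {X N P Q : ℕ} {m : Mem} {p q : ℕ → ZMod 2} {c : ZMod 2} (h0 : m 0 = N)
    (h2 : m 2 = 1) (h3 : m 3 = 0) (hN : N ≤ X) (hP : m 50 = P) (hQ : m 51 = Q) (hP64 : 64 ≤ P)
    (hQ64 : 64 ≤ Q) (hc : m 53 = c.val) (hp : ∀ i < N, m (P + i) = (p i).val)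
    (hq : ∀ i < N, m (Q + i) = (q i).val) :
    Wp X 15 dotVec m [] fun m' => (∀ r < 50, m' r = m r) ∧ (∀ a, 64 ≤ a → m' a = m a) ∧
      m' 50 = P + N ∧ m' 53 = (c + ∑ i ∈ Finset.range N, p i * q i).val := by
  refine Wp.step (Wp.plus rfl ?_)
  refine (Wp.loopc (d := 10) (N := N) (fun s m' => m' 50 = P + s ∧ m' 51 = Q + s ∧ m' 52 = N - s ∧
    (∀ r < 50, m' r = m r) ∧ (∀ a, 64 ≤ a → m' a = m a) ∧
      m' 53 = (c + ∑ i ∈ Finset.range s, p i * q i).val)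
      hN ?_ ?_ ?_).mono (by norm_num) ?_
  · simp (disch := omega) only [Function.update_of_ne, Function.update_self]
    refine ⟨by omega, by omega, by omega, fun r hr => ?_, fun a ha => ?_, by simpa using hc⟩
    · simp (disch := omega) only [Function.update_of_ne]
    · simp (disch := omega) only [Function.update_of_ne]
  · rintro s hs m1 ⟨e50, e51, e52, er, ea, e53⟩
    refine ⟨by omega, ?_⟩
    have e2 : m1 2 = 1 := by rw [er 2 (by omega), h2]
    have ep : m1 (P + s) = (p s).val := by rw [ea _ (by omega), hp s hs]
    have eq : m1 (Q + s) = (q s).val := by rw [ea _ (by omega), hq s hs]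
    iterate 10
      try apply Wp.step
      first
      | apply Wp.load
      | apply Wp.plus
      | apply Wp.minus
      on_goal 1 => simp (disch := first | decide | omega) only
          [Function.update_of_ne, Function.update_self, e50, e51, e2, e52, e53, ep, eq]; rfl
    simp (disch := first | decide | omega) only [Function.update_of_ne, Function.update_self]
    refine ⟨by omega, by omega, by omega, fun r hr => ?_, fun a ha => ?_, ?_⟩
    · simp (disch := omega) only [Function.update_of_ne, er]
    · simp (disch := omega) only [Function.update_of_ne, ea]
    · rw [dot_val, Finset.sum_range_succ, add_assoc]
  · rintro m1 ⟨-, -, e, -⟩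
    omega
  · rintro m1 ⟨h1, -, -, h2, h3, h4⟩
    exact ⟨h2, h3, h1, h4⟩

end PhaseLearning

namespace PhaseLearning

/-! ### Memory layout -/

/-- Address of the array of `n` pivot vectors. -/
def adT (n c : ℕ) : ℕ := 64 + 2 * n + 2 * n * c

/-- Address of the `n × n` array of the matrix. -/
def adU (n : ℕ) : ℕ := adT n n

/-- Address of the `n` counters. -/
def adC (n : ℕ) : ℕ := adU n + n * n

/-- Address of sample number `j`, a vector of `2 n` bits. -/
def adS (n j : ℕ) : ℕ := adC n + n + 2 * n * j

theorem adT_add_le {n c d : ℕ} (h : c < d) : adT n c + 2 * n ≤ adT n d := by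
  have := Nat.mul_le_mul_left (2 * n) h
  rw [Nat.mul_succ] at this
  unfold adT
  omega

theorem adT_add_le_adU {n c : ℕ} (h : c < n) : adT n c + 2 * n ≤ adU n := adT_add_le h

theorem base_le_adT (n c : ℕ) : 64 + 2 * n ≤ adT n c := Nat.le_add_right _ _

theorem base_le_adU (n : ℕ) : 64 + 2 * n ≤ adU n := base_le_adT n n

/-- The contents of the cells that the main part of the program never changes. -/
structure Consts (n G α β : ℕ) (m : Mem) : Prop where
  c0 : m 0 = n
  c2 : m 2 = 1
  c3 : m 3 = 0
  c4 : m 4 = 2 * n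
  c5 : m 5 = 64
  c6 : m 6 = adT n 0
  c7 : m 7 = adU n
  c8 : m 8 = adC n
  c9 : m 9 = adS n 0
  c10 : m 10 = G
  c11 : m 11 = α
  c12 : m 12 = β

theorem Consts.of_eq {n G α β : ℕ} {m m' : Mem} (h : Consts n G α β m)
    (e : ∀ r < 13, m' r = m r) : Consts n G α β m' := by
  constructor <;> rw [e _ (by norm_num)]
  exacts [h.c0, h.c2, h.c3, h.c4, h.c5, h.c6, h.c7, h.c8, h.c9, h.c10, h.c11, h.c12]

/-- The bits `v 0, …, v (N - 1)` are stored at address `P`. -/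
def HoldsV (m : Mem) (P N : ℕ) (v : ℕ → ZMod 2) : Prop := ∀ i < N, m (P + i) = (v i).val

/-- The pivot vectors `T 0, …, T (n - 1)` are stored in their place. -/
def HoldsT (m : Mem) (n : ℕ) (T : ℕ → ℕ → ZMod 2) : Prop :=
  ∀ c < n, HoldsV m (adT n c) (2 * n) (T c)

theorem HoldsV.of_eq {m m' : Mem} {P N : ℕ} {v : ℕ → ZMod 2} (h : HoldsV m P N v)
    (e : ∀ a, P ≤ a → a < P + N → m' a = m a) : HoldsV m' P N v :=
  fun i hi => (e _ (by omega) (by omega)).trans (h i hi)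

theorem xorVec_add {X N P Q : ℕ} {m : Mem} {v w : ℕ → ZMod 2} (h2 : m 2 = 1) (h3 : m 3 = 0)
    (h4 : m 4 = N) (hN : N ≤ X) (hP : m 50 = P) (hQ : m 51 = Q) (hP64 : 64 ≤ P) (hQ64 : 64 ≤ Q)
    (hPQ : P = Q ∨ P + N ≤ Q ∨ Q + N ≤ P) (hv : HoldsV m P N v) (hw : HoldsV m Q N w) :
    Wp X 15 xorVec m [] fun m' => (∀ r < 50, m' r = m r) ∧
      (∀ a, 64 ≤ a → (a < P ∨ P + N ≤ a) → m' a = m a) ∧ HoldsV m' P N (v + w) := by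
  refine (xorVec_spec h2 h3 h4 hN hP hQ hP64 hQ64 hPQ).mono le_rfl ?_
  rintro m' ⟨er, ea⟩
  refine ⟨er, fun a ha h => ?_, fun i hi => ?_⟩
  · rw [ea a ha, if_neg (by omega)]
  · rw [ea _ (by omega), if_pos (by omega), Nat.add_sub_cancel_left, hv i hi, hw i hi, xr_val]
    rfl

/-! ### Reduction of a vector by the pivot vectors -/

/-- One step of the reduction of the vector `s.2` by the pivot vectors `s.1`. If the pivot vector
that is needed is missing, then the vector becomes that pivot vector. -/
def redStep (c : ℕ) (s : (ℕ → ℕ → ZMod 2) × (ℕ → ZMod 2)) :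
    (ℕ → ℕ → ZMod 2) × (ℕ → ZMod 2) :=
  if s.2 c = 0 then s
  else if s.1 c c = 0 then
    (Function.update s.1 c (s.1 c + s.2), s.2 + (s.1 c + s.2))
  else (s.1, s.2 + s.1 c)

/-- The first `k` steps of the reduction. -/
def red : ℕ → (ℕ → ℕ → ZMod 2) × (ℕ → ZMod 2) → (ℕ → ℕ → ZMod 2) × (ℕ → ZMod 2)
  | 0, s => s
  | k + 1, s => redStep k (red k s)

/-- An instruction without effect outside of the scratch cells. -/
def skip : Prog := .const 63 0

/-- Body of the loop of `reduce`. -/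
def reduceBody : Prog :=
  block [.load 44 41, .ite 44
    (block [.load 45 43,
      .ite 45 skip (block [.plus 50 42 3, .plus 51 5 3, xorVec]),
      .plus 50 5 3, .plus 51 42 3, xorVec]) skip,
    .plus 41 41 2, .plus 42 42 4, .plus 43 43 4, .plus 43 43 2, .minus 40 40 2]

/-- Reduces the vector in the work space by the pivot vectors. -/
def reduce : Prog :=
  block [.plus 40 0 3, .plus 41 5 3, .plus 42 6 3, .plus 43 6 3, .loop 40 reduceBody]

/-- The cells from `lo` to `63` are the only ones below `64` that may have changed. -/
def SameRegs (lo : ℕ) (m m' : Mem) : Prop := ∀ r < lo, m' r = m r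

theorem val_ne_zero_iff (a : ZMod 2) : a.val ≠ 0 ↔ a ≠ 0 := by revert a; decide

/-- Both cases with a nonzero bit end in the same way: a missing pivot is first filled by adding the
vector to its slot, and then the slot is added to the vector. -/
theorem reduceAdd_spec {X n G α β c : ℕ} {m : Mem} {s : (ℕ → ℕ → ZMod 2) × (ℕ → ZMod 2)}
    (hX : 2 * n ≤ X) (hc : c < n) (hm : Consts n G α β m) (h42 : m 42 = adT n c)
    (h43 : m 43 = adT n c + c) (h44 : m 44 = (s.2 c).val) (hw : HoldsV m 64 (2 * n) s.2)
    (hT : HoldsT m n s.1) :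
    Wp X 30 (.ite 44 (block [.load 45 43,
      .ite 45 skip (block [.plus 50 42 3, .plus 51 5 3, xorVec]),
      .plus 50 5 3, .plus 51 42 3, xorVec]) skip) m [] fun m' => SameRegs 44 m m' ∧
      (∀ a, adU n ≤ a → m' a = m a) ∧ HoldsV m' 64 (2 * n) (redStep c s).2 ∧
      HoldsT m' n (redStep c s).1 := by
  have hTU := adT_add_le_adU hc
  have hb := base_le_adT n c
  refine Wp.ite ?_ ?_
  · intro h
    rw [h44, val_ne_zero_iff] at h
    have e45 : m (adT n c + c) = (s.1 c c).val := hT c hc c (by omega)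
    apply Wp.step
    apply Wp.load (v := (s.1 c c).val)
    · rw [h43, e45]
    -- The pivots after the optional insertion, so that the final addition is the same in both
    -- cases.
    let T' := if s.1 c c = 0 then Function.update s.1 c (s.1 c + s.2) else s.1
    have hred : redStep c s = (T', s.2 + T' c) := by
      unfold redStep
      rw [if_neg h]
      by_cases h1 : s.1 c c = 0 <;> simp [T', h1]
    refine Wp.call (d' := 25) (o1 := []) (o2 := []) (R1 := fun m' => SameRegs 44 m m' ∧
      (∀ a, adU n ≤ a → m' a = m a) ∧ HoldsV m' 64 (2 * n) s.2 ∧ HoldsT m' n T') ?_ (by norm_num) rfl ?_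
    · refine Wp.ite ?_ ?_
      · intro h1
        rw [Function.update_self, val_ne_zero_iff] at h1
        apply Wp.const
        simp only [T', if_neg h1]
        refine ⟨fun r hr => ?_, fun a ha => ?_, hw.of_eq fun a _ _ => ?_,
          fun d hd => (hT d hd).of_eq fun a h2 _ => ?_⟩
        iterate 3 simp (disch := omega) only [Function.update_of_ne]
        have := base_le_adT n d
        simp (disch := omega) only [Function.update_of_ne]
      · intro h1
        rw [Function.update_self] at h1
        replace h1 : s.1 c c = 0 := by
          by_contra h2
          exact (val_ne_zero_iff _).2 h2 h1
        apply Wp.step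
        apply Wp.plus (v := adT n c)
        · simp (disch := decide) only [Function.update_of_ne, h42, hm.c3]
          rfl
        apply Wp.step
        apply Wp.plus (v := 64)
        · simp (disch := decide) only [Function.update_of_ne, hm.c5, hm.c3]
        refine (xorVec_add (P := adT n c) (Q := 64) (N := 2 * n) (v := s.1 c) (w := s.2)
          ?_ ?_ ?_ hX ?_ ?_ (by omega) le_rfl (by omega) ?_ ?_).mono (by norm_num) ?_
        · simp (disch := decide) only [Function.update_of_ne, hm.c2]
        · simp (disch := decide) only [Function.update_of_ne, hm.c3]
        · simp (disch := decide) only [Function.update_of_ne, hm.c4]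
        · simp (disch := decide) only [Function.update_of_ne, Function.update_self]
        · simp (disch := decide) only [Function.update_self]
        · refine (hT c hc).of_eq fun a _ _ => ?_
          simp (disch := omega) only [Function.update_of_ne]
        · refine hw.of_eq fun a _ _ => ?_
          simp (disch := omega) only [Function.update_of_ne]
        rintro m' ⟨er, ea, ev⟩
        simp only [T', if_pos h1]
        refine ⟨fun r hr => ?_, fun a ha => ?_, hw.of_eq fun a _ _ => ?_, fun d hd => ?_⟩
        · rw [er r (by omega)]
          simp (disch := omega) only [Function.update_of_ne]
        · rw [ea a (by omega) (by omega)]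
          simp (disch := omega) only [Function.update_of_ne]
        · rw [ea a (by omega) (by omega)]
          simp (disch := omega) only [Function.update_of_ne]
        · by_cases hdc : d = c
          · subst hdc
            rw [Function.update_self]
            exact ev
          · rw [Function.update_of_ne hdc]
            refine (hT d hd).of_eq fun a h2 h3 => ?_
            have := base_le_adT n d
            have h4 : a < adT n c ∨ adT n c + 2 * n ≤ a := by
              rcases Nat.lt_or_gt_of_ne hdc with h5 | h5
              · have := adT_add_le (n := n) h5
                omega
              · have := adT_add_le (n := n) h5
                omega
            rw [ea a (by omega) h4]
            simp (disch := omega) only [Function.update_of_ne]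
    · rintro m1 ⟨er, ea, ew, eT⟩
      have hm1 : Consts n G α β m1 := hm.of_eq fun r hr => er r (by omega)
      apply Wp.step
      apply Wp.plus (v := 64)
      · simp (disch := decide) only [hm1.c5, hm1.c3]
      apply Wp.step
      apply Wp.plus (v := adT n c)
      · simp (disch := decide) only [Function.update_of_ne, (er 42 (by norm_num)).trans h42, hm1.c3]
        rfl
      refine (xorVec_add (P := 64) (Q := adT n c) (N := 2 * n) (v := s.2) (w := T' c)
        ?_ ?_ ?_ hX ?_ ?_ le_rfl (by omega) (by omega) ?_ ?_).mono (by norm_num) ?_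
      · simp (disch := decide) only [Function.update_of_ne, hm1.c2]
      · simp (disch := decide) only [Function.update_of_ne, hm1.c3]
      · simp (disch := decide) only [Function.update_of_ne, hm1.c4]
      · simp (disch := decide) only [Function.update_of_ne, Function.update_self]
      · simp (disch := decide) only [Function.update_self]
      · refine ew.of_eq fun a _ _ => ?_
        simp (disch := omega) only [Function.update_of_ne]
      · refine (eT c hc).of_eq fun a _ _ => ?_
        simp (disch := omega) only [Function.update_of_ne]
      rintro m' ⟨fr, fa, fv⟩
      rw [hred]
      refine ⟨fun r hr => ?_, fun a ha => ?_, fv, fun d hd => (eT d hd).of_eq fun a h1 _ => ?_⟩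
      · rw [fr r (by omega)]
        simp (disch := omega) only [Function.update_of_ne, er r hr]
      · rw [fa a (by omega) (by omega)]
        simp (disch := omega) only [Function.update_of_ne, ea a ha]
      · have := base_le_adT n d
        rw [fa a (by omega) (by omega)]
        simp (disch := omega) only [Function.update_of_ne]
  · intro h
    rw [h44] at h
    replace h : s.2 c = 0 := by
      by_contra h2
      exact (val_ne_zero_iff _).2 h2 h
    have hred : redStep c s = s := by unfold redStep; rw [if_pos h]
    rw [hred]
    apply Wp.const
    refine ⟨fun r hr => ?_, fun a ha => ?_, hw.of_eq fun a _ _ => ?_,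
      fun d hd => (hT d hd).of_eq fun a h2 _ => ?_⟩
    iterate 3 simp (disch := omega) only [Function.update_of_ne]
    have := base_le_adT n d
    simp (disch := omega) only [Function.update_of_ne]

theorem reduce_spec {X n G α β : ℕ} {m : Mem} {T : ℕ → ℕ → ZMod 2} {w : ℕ → ZMod 2}
    (hX : 2 * n ≤ X) (hm : Consts n G α β m) (hw : HoldsV m 64 (2 * n) w) (hT : HoldsT m n T) :
    Wp X 50 reduce m [] fun m' => SameRegs 40 m m' ∧
      (∀ a, adU n ≤ a → m' a = m a) ∧ HoldsV m' 64 (2 * n) (red n (T, w)).2 ∧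
      HoldsT m' n (red n (T, w)).1 := by
  have hb := base_le_adU n
  iterate 4
    apply Wp.step
    apply Wp.plus rfl
  -- Cell `43` runs along the diagonal of the pivot array, with stride 2 * n + 1.
  refine (Wp.loopc (d := 40) (N := n) (fun c m' => m' 40 = n - c ∧ m' 41 = 64 + c ∧
    m' 42 = adT n c ∧ m' 43 = adT n c + c ∧ SameRegs 40 m m' ∧
    (∀ a, adU n ≤ a → m' a = m a) ∧ HoldsV m' 64 (2 * n) (red c (T, w)).2 ∧
      HoldsT m' n (red c (T, w)).1) (by omega) ?_ ?_ ?_).mono (by norm_num) ?_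
  · simp (disch := decide) only [Function.update_of_ne, Function.update_self, hm.c0, hm.c3, hm.c5, hm.c6]
    refine ⟨by trivial, by trivial, by trivial, by trivial, fun r hr => ?_, fun a ha => ?_, hw.of_eq fun a _ _ => ?_,
      fun d hd => (hT d hd).of_eq fun a h2 _ => ?_⟩
    iterate 3 simp (disch := omega) only [Function.update_of_ne]
    have := base_le_adT n d
    simp (disch := omega) only [Function.update_of_ne]
  · rintro c hc m1 ⟨e40, e41, e42, e43, er, ea, ew, eT⟩
    refine ⟨by omega, ?_⟩
    have hm1 : Consts n G α β m1 := hm.of_eq fun r hr => er r (by omega)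
    apply Wp.step
    apply Wp.load (v := ((red c (T, w)).2 c).val)
    · rw [e41, ew c (by omega)]
    refine Wp.call (reduceAdd_spec (s := red c (T, w)) (G := G) (α := α) (β := β) hX hc
      (hm1.of_eq fun r hr => ?_) ?_ ?_ ?_ (ew.of_eq fun a _ _ => ?_)
      fun d hd => (eT d hd).of_eq fun a h2 _ => ?_) (by norm_num) rfl ?_
    · simp (disch := omega) only [Function.update_of_ne]
    · simp (disch := decide) only [Function.update_of_ne, e42]
    · simp (disch := decide) only [Function.update_of_ne, e43]
    · simp only [Function.update_self]
    · simp (disch := omega) only [Function.update_of_ne]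
    · have := base_le_adT n d
      simp (disch := omega) only [Function.update_of_ne]
    rintro m2 ⟨fr, fa, fw, fT⟩
    have gr : ∀ r < 44, m2 r = m1 r := fun r hr => by
      rw [fr r hr]
      simp (disch := omega) only [Function.update_of_ne]
    have g2 : m2 2 = 1 := (gr 2 (by norm_num)).trans hm1.c2
    have g4 : m2 4 = 2 * n := (gr 4 (by norm_num)).trans hm1.c4
    have g40 := (gr 40 (by norm_num)).trans e40
    have g41 := (gr 41 (by norm_num)).trans e41
    have g42 := (gr 42 (by norm_num)).trans e42
    have g43 := (gr 43 (by norm_num)).trans e43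
    iterate 5
      try apply Wp.step
      first
      | apply Wp.plus
      | apply Wp.minus
      on_goal 1 => simp (disch := decide) only
        [Function.update_of_ne, Function.update_self, g2, g4, g40, g41, g42, g43]; rfl
    simp (disch := decide) only [Function.update_of_ne, Function.update_self]
    have hs : adT n (c + 1) = adT n c + 2 * n := by unfold adT; ring
    refine ⟨by omega, by omega, by omega, by omega, fun r hr => ?_, fun a ha => ?_,
      fw.of_eq fun a _ _ => ?_, fun d hd => (fT d hd).of_eq fun a h2 _ => ?_⟩
    · simp (disch := omega) only [Function.update_of_ne]
      rw [gr r (by omega), er r hr]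
    · simp (disch := omega) only [Function.update_of_ne]
      rw [fa a ha]
      simp (disch := omega) only [Function.update_of_ne]
      exact ea a ha
    · simp (disch := omega) only [Function.update_of_ne]
    · have := base_le_adT n d
      simp (disch := omega) only [Function.update_of_ne]
  · rintro m1 ⟨e, -⟩
    omega
  · rintro m1 ⟨-, -, -, -, h⟩
    exact h

end PhaseLearning

namespace PhaseLearning

/-! ### Selection of samples -/

/-- The symplectic product of two vectors of `2 n` bits. -/
def symp (n : ℕ) (v q : ℕ → ZMod 2) : ZMod 2 :=
  ∑ i ∈ Finset.range n, v i * q (n + i) + ∑ i ∈ Finset.range n, v (n + i) * q i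

/-- The number of the first `G` samples that are not orthogonal to `v`. -/
def conflicts (n G : ℕ) (smp : ℕ → ℕ → ZMod 2) (v : ℕ → ZMod 2) : ℕ :=
  ∑ j ∈ Finset.range G, (symp n v (smp j)).val

/-- The samples are stored in their place. -/
def HoldsS (m : Mem) (n G : ℕ) (smp : ℕ → ℕ → ZMod 2) : Prop :=
  ∀ j < G, HoldsV m (adS n j) (2 * n) (smp j)

theorem HoldsV.fst {m : Mem} {P n : ℕ} {v : ℕ → ZMod 2} (h : HoldsV m P (2 * n) v) :
    ∀ i < n, m (P + i) = (v i).val := fun i hi => h i (by omega)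

theorem HoldsV.snd {m : Mem} {P n : ℕ} {v : ℕ → ZMod 2} (h : HoldsV m P (2 * n) v) :
    ∀ i < n, m (P + n + i) = (v (n + i)).val := fun i hi => by rw [add_assoc]; exact h _ (by omega)

/-- Body of the loop of `conflictTest`. -/
def conflictBody : Prog :=
  block [.const 53 0, .plus 50 30 3, .plus 51 33 0, dotVec, .plus 51 33 3, dotVec,
    .ite 53 (.plus 31 31 11) skip, .plus 32 32 12, .plus 33 33 4, .minus 34 34 2]

/-- Makes cell `35` nonzero if the vector at address `m 30` conflicts with few samples. -/
def conflictTest : Prog :=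
  block [.const 31 0, .const 32 0, .plus 33 9 3, .plus 34 10 3, .loop 34 conflictBody,
    .minus 35 32 31]

/-- The symplectic product pairs opposite halves: the pointer into v simply runs on, while the
second half of q is visited before the first. Adding α per conflict and β per sample prepares a
comparison without multiplication. -/
theorem conflictBody_spec {X n G α β P Q A B : ℕ} {m : Mem} {v q : ℕ → ZMod 2}
    (hX : n ≤ X) (hm : Consts n G α β m) (h30 : m 30 = P) (h31 : m 31 = A) (h32 : m 32 = B)
    (h33 : m 33 = Q) (hP : 64 ≤ P) (hQ : 64 ≤ Q)
    (hv : HoldsV m P (2 * n) v) (hq : HoldsV m Q (2 * n) q) :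
    Wp X 30 conflictBody m [] fun m' => SameRegs 31 m m' ∧ (∀ a, 64 ≤ a → m' a = m a) ∧
      m' 31 = A + α * (symp n v q).val ∧ m' 32 = B + β ∧ m' 33 = Q + 2 * n ∧
      m' 34 = m 34 - 1 := by
  apply Wp.step
  apply Wp.const
  apply Wp.step
  apply Wp.plus (v := P)
  · simp (disch := decide) only [Function.update_of_ne, h30, hm.c3]
    rfl
  apply Wp.step
  apply Wp.plus (v := Q + n)
  · simp (disch := decide) only [Function.update_of_ne, h33, hm.c0]
  refine Wp.call (dotVec_spec (P := P) (Q := Q + n) (N := n) (p := v) (q := fun i => q (n + i))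
    (c := 0) ?_ ?_ ?_ hX ?_ ?_ hP (by omega) ?_ (fun i hi => ?_) fun i hi => ?_)
    (by norm_num) rfl ?_
  · simp (disch := decide) only [Function.update_of_ne, hm.c0]
  · simp (disch := decide) only [Function.update_of_ne, hm.c2]
  · simp (disch := decide) only [Function.update_of_ne, hm.c3]
  · simp (disch := decide) only [Function.update_of_ne, Function.update_self]
  · simp (disch := decide) only [Function.update_self]
  · simp (disch := decide) only [Function.update_of_ne, Function.update_self]
    rfl
  · simp (disch := omega) only [Function.update_of_ne]
    exact hv.fst i hi
  · simp (disch := omega) only [Function.update_of_ne]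
    exact hq.snd i hi
  rintro m1 ⟨er, ea, e50, e53⟩
  have fr : ∀ r < 50, m1 r = m r := fun r hr => by
    rw [er r hr]
    simp (disch := omega) only [Function.update_of_ne]
  have fa : ∀ a, 64 ≤ a → m1 a = m a := fun a ha => by
    rw [ea a ha]
    simp (disch := omega) only [Function.update_of_ne]
  have hm1 : Consts n G α β m1 := hm.of_eq fun r hr => fr r (by omega)
  apply Wp.step
  apply Wp.plus (v := Q)
  · simp (disch := decide) only [fr, h33, hm.c3]
    rfl
  refine Wp.call (dotVec_spec (P := P + n) (Q := Q) (N := n) (p := fun i => v (n + i)) (q := q)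
    (c := 0 + ∑ i ∈ Finset.range n, v i * q (n + i)) ?_ ?_ ?_ hX ?_ ?_ (by omega) hQ ?_
    (fun i hi => ?_) fun i hi => ?_)
    (by norm_num) rfl ?_
  · simp (disch := decide) only [Function.update_of_ne, hm1.c0]
  · simp (disch := decide) only [Function.update_of_ne, hm1.c2]
  · simp (disch := decide) only [Function.update_of_ne, hm1.c3]
  · simp (disch := decide) only [Function.update_of_ne, e50]
  · simp (disch := decide) only [Function.update_self]
  · simp (disch := decide) only [Function.update_of_ne, e53]
  · simp (disch := omega) only [Function.update_of_ne]
    rw [fa _ (by omega)]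
    exact hv.snd i hi
  · simp (disch := omega) only [Function.update_of_ne]
    rw [fa _ (by omega)]
    exact hq.fst i hi
  rintro m2 ⟨er2, ea2, -, e53'⟩
  rw [zero_add] at e53'
  have gr : ∀ r < 50, m2 r = m r := fun r hr => by
    rw [er2 r hr]
    simp (disch := omega) only [Function.update_of_ne, fr]
  have ga : ∀ a, 64 ≤ a → m2 a = m a := fun a ha => by
    rw [ea2 a ha]
    simp (disch := omega) only [Function.update_of_ne, fa]
  refine Wp.call (d' := 20) (o1 := []) (o2 := []) (R1 := fun m' => SameRegs 31 m m' ∧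
    (∀ a, 64 ≤ a → m' a = m a) ∧ m' 31 = A + α * (symp n v q).val ∧ m' 32 = B ∧ m' 33 = Q ∧
      m' 34 = m 34) ?_ (by norm_num) rfl ?_
  · refine Wp.ite ?_ ?_
    · intro h
      apply Wp.plus (v := A + α)
      · simp (disch := decide) only [gr, h31, hm.c11]
      have h1 : (symp n v q).val = 1 := by
        rw [e53', val_ne_zero_iff] at h
        change symp n v q ≠ 0 at h
        revert h
        generalize symp n v q = z
        revert z
        decide
      rw [h1]
      refine ⟨fun r hr => ?_, fun a ha => ?_, ?_, ?_, ?_, ?_⟩ <;>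
        simp (disch := omega) only [Function.update_of_ne, Function.update_self, gr, ga, h32, h33,
          mul_one]
    · intro h
      rw [e53'] at h
      change (symp n v q).val = 0 at h
      apply Wp.const
      rw [h]
      refine ⟨fun r hr => ?_, fun a ha => ?_, ?_, ?_, ?_, ?_⟩ <;>
        simp (disch := omega) only [Function.update_of_ne, gr, ga, h31, h32, h33, mul_zero, add_zero]
  rintro m3 ⟨kr, ka, k31, k32, k33, k34⟩
  have k2 : m3 2 = 1 := (kr 2 (by norm_num)).trans hm.c2
  have k4 : m3 4 = 2 * n := (kr 4 (by norm_num)).trans hm.c4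
  have k12 : m3 12 = β := (kr 12 (by norm_num)).trans hm.c12
  iterate 3
    try apply Wp.step
    first
    | apply Wp.plus
    | apply Wp.minus
    on_goal 1 => simp (disch := decide) only
      [Function.update_of_ne, k2, k4, k12, k32, k33, k34]; rfl
  refine ⟨fun r hr => ?_, fun a ha => ?_, ?_, ?_, ?_, ?_⟩
  · simp (disch := omega) only [Function.update_of_ne]
    exact kr r hr
  all_goals simp (disch := omega) only [Function.update_of_ne, Function.update_self, ka, k31]

/-- The truncated difference of the two totals is nonzero exactly when the conflicts stay strictly
below the fraction β / α of the samples. -/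
theorem conflictTest_spec {X n G α β P : ℕ} {m : Mem} {v : ℕ → ZMod 2} {smp : ℕ → ℕ → ZMod 2}
    (hX : n ≤ X) (hG : G ≤ X) (hm : Consts n G α β m) (h30 : m 30 = P) (hP : 64 ≤ P)
    (hv : HoldsV m P (2 * n) v) (hs : HoldsS m n G smp) :
    Wp X 50 conflictTest m [] fun m' => SameRegs 31 m m' ∧ (∀ a, 64 ≤ a → m' a = m a) ∧
      (m' 35 ≠ 0 ↔ α * conflicts n G smp v < β * G) := by
  have hb := base_le_adU n
  have hS : ∀ j, 64 ≤ adS n j := fun j => by unfold adS adC; omega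
  apply Wp.step
  apply Wp.const
  apply Wp.step
  apply Wp.const
  iterate 2
    apply Wp.step
    apply Wp.plus
    on_goal 1 => simp (disch := decide) only [Function.update_of_ne, hm.c9, hm.c10, hm.c3]; rfl
  refine Wp.call (Wp.loopc (d := 30) (N := G) (fun s m' => m' 34 = G - s ∧ m' 33 = adS n s ∧
    SameRegs 31 m m' ∧ (∀ a, 64 ≤ a → m' a = m a) ∧ m' 31 = α * conflicts n s smp v ∧
    m' 32 = β * s) hG ?_ ?_ ?_) (by norm_num) rfl ?_
  · refine ⟨?_, ?_, fun r hr => ?_, fun a ha => ?_, ?_, ?_⟩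
    all_goals simp (disch := omega) only [Function.update_of_ne, Function.update_self]
    all_goals rfl
  · rintro s hsG m1 ⟨e34, e33, er, ea, e31, e32⟩
    refine ⟨by omega, ?_⟩
    refine (conflictBody_spec (P := P) (Q := adS n s) (v := v) (q := smp s) hX
      (hm.of_eq fun r hr => er r (by omega))
      ((er 30 (by norm_num)).trans h30) e31 e32 e33 hP (hS s) (hv.of_eq fun a _ _ => ea a (by omega))
      ((hs s hsG).of_eq fun a h _ => ea a ((hS s).trans h))).mono le_rfl ?_
    rintro m2 ⟨fr, fa, f31, f32, f33, f34⟩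
    refine ⟨by omega, ?_, fun r hr => (fr r hr).trans (er r hr),
      fun a ha => (fa a ha).trans (ea a ha), ?_, ?_⟩
    · rw [f33]; unfold adS; ring
    · rw [f31, conflicts, conflicts, Finset.sum_range_succ, mul_add]
    · rw [f32]; ring
  · rintro m1 ⟨e, -⟩
    omega
  · rintro m1 ⟨-, -, er, ea, e31, e32⟩
    apply Wp.minus rfl
    refine ⟨fun r hr => ?_, fun a ha => ?_, ?_⟩
    · simp (disch := omega) only [Function.update_of_ne]
      exact er r hr
    · simp (disch := omega) only [Function.update_of_ne, ea]
    · rw [Function.update_self, e31, e32]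
      omega

/-- Clears the work space. -/
def clearVec : Prog := block [.plus 50 5 3, .plus 51 5 3, xorVec]

/-- Body of the loop of `filter`. -/
def filterBody : Prog :=
  block [.plus 30 21 3, conflictTest,
    .ite 35 (block [clearVec, .plus 50 5 3, .plus 51 21 3, xorVec,
      reduce]) skip,
    .plus 21 21 4, .minus 20 20 2]

/-- Inserts all samples with few conflicts into the array of pivot vectors. -/
def filter : Prog := block [.plus 20 10 3, .plus 21 9 3, .loop 20 filterBody]

/-- The pivot vectors after the first `j` samples were treated. -/
def pivots (n G α β : ℕ) (smp : ℕ → ℕ → ZMod 2) : ℕ → ℕ → ℕ → ZMod 2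
  | 0 => 0
  | j + 1 =>
    if α * conflicts n G smp (smp j) < β * G then (red n (pivots n G α β smp j, smp j)).1
    else pivots n G α β smp j

/-- A vector added to itself vanishes in characteristic two. The vector w is arbitrary: all that
matters is that the work space holds bits. -/
theorem clearVec_spec {X n G α β : ℕ} {m : Mem} {w : ℕ → ZMod 2} (hX : 2 * n ≤ X)
    (hm : Consts n G α β m) (hw : HoldsV m 64 (2 * n) w) :
    Wp X 20 clearVec m [] fun m' => (∀ r < 50, m' r = m r) ∧
      (∀ a, 64 + 2 * n ≤ a → m' a = m a) ∧ HoldsV m' 64 (2 * n) 0 := by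
  iterate 2
    apply Wp.step
    apply Wp.plus (v := 64)
    on_goal 1 => simp (disch := decide) only [Function.update_of_ne, hm.c5, hm.c3]
  refine (xorVec_add (P := 64) (Q := 64) (N := 2 * n) (v := w) (w := w)
    ?_ ?_ ?_ hX ?_ ?_ le_rfl le_rfl (by omega) (hw.of_eq fun a _ _ => ?_)
    (hw.of_eq fun a _ _ => ?_)).mono (by norm_num) ?_
  · simp (disch := decide) only [Function.update_of_ne, hm.c2]
  · simp (disch := decide) only [Function.update_of_ne, hm.c3]
  · simp (disch := decide) only [Function.update_of_ne, hm.c4]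
  · simp (disch := decide) only [Function.update_of_ne, Function.update_self]
  · simp (disch := decide) only [Function.update_self]
  · simp (disch := omega) only [Function.update_of_ne]
  · simp (disch := omega) only [Function.update_of_ne]
  rintro m' ⟨er, ea, ev⟩
  refine ⟨fun r hr => ?_, fun a ha => ?_, ?_⟩
  · rw [er r hr]
    simp (disch := omega) only [Function.update_of_ne]
  · rw [ea a (by omega) (by omega)]
    simp (disch := omega) only [Function.update_of_ne]
  · rwa [CharTwo.add_self_eq_zero] at ev

theorem adS_pos (n j : ℕ) : adU n ≤ adS n j := by unfold adS adC; omega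

theorem insert_spec {X n G α β P : ℕ} {m : Mem} {T : ℕ → ℕ → ZMod 2} {w v : ℕ → ZMod 2}
    (hX : 2 * n ≤ X) (hm : Consts n G α β m) (h21 : m 21 = P) (hP : adU n ≤ P)
    (hw : HoldsV m 64 (2 * n) w) (hv : HoldsV m P (2 * n) v) (hT : HoldsT m n T) :
    Wp X 60 (block [clearVec, .plus 50 5 3, .plus 51 21 3, xorVec, reduce]) m [] fun m' =>
      SameRegs 40 m m' ∧ (∀ a, adU n ≤ a → m' a = m a) ∧ HoldsV m' 64 (2 * n) (red n (T, v)).2 ∧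
      HoldsT m' n (red n (T, v)).1 := by
  have hb := base_le_adU n
  refine Wp.call (clearVec_spec hX hm hw) (by norm_num) rfl ?_
  rintro m1 ⟨er, ea, ew⟩
  have hm1 : Consts n G α β m1 := hm.of_eq fun r hr => er r (by omega)
  apply Wp.step
  apply Wp.plus (v := 64)
  · simp (disch := decide) only [hm1.c5, hm1.c3]
  apply Wp.step
  apply Wp.plus (v := P)
  · simp (disch := decide) only [Function.update_of_ne, er, h21, hm.c3]
    rfl
  refine Wp.call (xorVec_add (P := 64) (Q := P) (N := 2 * n) (v := 0) (w := v)
    ?_ ?_ ?_ hX ?_ ?_ le_rfl (by omega) (by omega) (ew.of_eq fun a _ _ => ?_)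
    (hv.of_eq fun a _ _ => ?_)) (by norm_num) rfl ?_
  · simp (disch := decide) only [Function.update_of_ne, hm1.c2]
  · simp (disch := decide) only [Function.update_of_ne, hm1.c3]
  · simp (disch := decide) only [Function.update_of_ne, hm1.c4]
  · simp (disch := decide) only [Function.update_of_ne, Function.update_self]
  · simp (disch := decide) only [Function.update_self]
  · simp (disch := omega) only [Function.update_of_ne]
  · simp (disch := omega) only [Function.update_of_ne, ea]
  rintro m2 ⟨fr, fa, fv⟩
  rw [zero_add] at fv
  have gr : ∀ r < 50, m2 r = m r := fun r hr => by
    rw [fr r hr]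
    simp (disch := omega) only [Function.update_of_ne, er]
  have ga : ∀ a, 64 + 2 * n ≤ a → m2 a = m a := fun a ha => by
    rw [fa a (by omega) (by omega)]
    simp (disch := omega) only [Function.update_of_ne, ea]
  refine (reduce_spec hX (hm.of_eq fun r hr => gr r (by omega)) fv fun c hc => (hT c hc).of_eq
    fun a h _ => ga a ((base_le_adT n c).trans h)).mono (by norm_num) ?_
  rintro m3 ⟨kr, ka, kv, kT⟩
  exact ⟨fun r hr => (kr r hr).trans (gr r (by omega)), fun a ha => (ka a ha).trans (ga a (by omega)),
    kv, kT⟩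

/-- What the work space holds afterwards is irrelevant, except that the next clearing needs it to
consist of bits; hence the existential. -/
theorem filter_spec {X n G α β : ℕ} {m : Mem} {smp : ℕ → ℕ → ZMod 2} {w : ℕ → ZMod 2}
    (hX : 2 * n ≤ X) (hG : G ≤ X) (hm : Consts n G α β m) (hw : HoldsV m 64 (2 * n) w)
    (hT : HoldsT m n 0) (hs : HoldsS m n G smp) :
    Wp X 80 filter m [] fun m' => SameRegs 20 m m' ∧ (∀ a, adU n ≤ a → m' a = m a) ∧
      (∃ w', HoldsV m' 64 (2 * n) w') ∧ HoldsT m' n (pivots n G α β smp G) := by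
  have hb := base_le_adU n
  iterate 2
    apply Wp.step
    apply Wp.plus
    on_goal 1 => simp (disch := decide) only [Function.update_of_ne, hm.c9, hm.c10, hm.c3]; rfl
  refine (Wp.loopc (d := 70) (N := G) (fun s m' => m' 20 = G - s ∧ m' 21 = adS n s ∧
    SameRegs 20 m m' ∧ (∀ a, adU n ≤ a → m' a = m a) ∧
      (∃ w', HoldsV m' 64 (2 * n) w') ∧ HoldsT m' n (pivots n G α β smp s))
      hG ?_ ?_ ?_).mono (by norm_num) ?_
  · refine ⟨?_, ?_, fun r hr => ?_, fun a ha => ?_, ⟨w, hw.of_eq fun a _ _ => ?_⟩,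
      fun d hd => (hT d hd).of_eq fun a h _ => ?_⟩
    on_goal 6 => have := base_le_adT n d
    all_goals simp (disch := omega) only [Function.update_of_ne, Function.update_self]
    all_goals rfl
  · rintro j hj m1 ⟨e20, e21, er, ea, ⟨w1, ew⟩, eT⟩
    refine ⟨by omega, ?_⟩
    have hm1 : Consts n G α β m1 := hm.of_eq fun r hr => er r (by omega)
    have hs1 : HoldsS m1 n G smp := fun k hk => (hs k hk).of_eq fun a h _ =>
      ea a ((adS_pos n k).trans h)
    have hjS := adS_pos n j
    apply Wp.step
    apply Wp.plus (v := adS n j)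
    · rw [e21, hm1.c3]
      rfl
    refine Wp.call (conflictTest_spec (P := adS n j) (v := smp j) (smp := smp) (G := G) (α := α)
      (β := β) (n := n) (by omega) hG (hm1.of_eq fun r hr => ?_) ?_ (by omega)
      ((hs1 j hj).of_eq fun a _ _ => ?_) fun k hk => (hs1 k hk).of_eq fun a h _ => ?_)
      (by norm_num) rfl ?_
    · simp (disch := omega) only [Function.update_of_ne]
    · simp (disch := omega) only [Function.update_self]
    · simp (disch := omega) only [Function.update_of_ne]
    · have := adS_pos n k
      simp (disch := omega) only [Function.update_of_ne]
    rintro m2 ⟨fr, fa, f35⟩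
    have gr : ∀ r < 30, m2 r = m1 r := fun r hr => by
      rw [fr r (by omega)]
      simp (disch := omega) only [Function.update_of_ne]
    have ga : ∀ a, 64 ≤ a → m2 a = m1 a := fun a ha => by
      rw [fa a ha]
      simp (disch := omega) only [Function.update_of_ne]
    refine Wp.call (d' := 61) (o1 := []) (o2 := []) (R1 := fun m' => SameRegs 30 m1 m' ∧
      (∀ a, adU n ≤ a → m' a = m1 a) ∧ (∃ w', HoldsV m' 64 (2 * n) w') ∧
        HoldsT m' n (pivots n G α β smp (j + 1))) ?_ (by norm_num) rfl ?_
    · have gw : HoldsV m2 64 (2 * n) w1 := ew.of_eq fun a h _ => ga a h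
      have gT : HoldsT m2 n (pivots n G α β smp j) := fun d hd => (eT d hd).of_eq fun a h _ => by
        have := base_le_adT n d
        exact ga a (by omega)
      refine Wp.ite ?_ ?_
      · intro h
        refine (insert_spec hX (hm1.of_eq fun r hr => gr r (by omega))
          ((gr 21 (by norm_num)).trans e21) hjS gw
          ((hs1 j hj).of_eq fun a _ _ => ga a (by omega)) gT).mono le_rfl ?_
        rintro m3 ⟨kr, ka, kv, kT⟩
        refine ⟨fun r hr => (kr r (by omega)).trans (gr r hr),
          fun a ha => (ka a ha).trans (ga a (by omega)), ⟨_, kv⟩, ?_⟩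
        rw [pivots, if_pos (f35.1 h)]
        exact kT
      · intro h
        apply Wp.const
        rw [pivots, if_neg fun h1 => f35.2 h1 h]
        refine ⟨fun r hr => ?_, fun a ha => ?_, ⟨w1, gw.of_eq fun a _ _ => ?_⟩,
          fun d hd => (gT d hd).of_eq fun a h _ => ?_⟩
        on_goal 4 => have := base_le_adT n d
        all_goals simp (disch := omega) only [Function.update_of_ne, gr, ga]
    rintro m3 ⟨kr, ka, ⟨w3, kw⟩, kT⟩
    have k2 : m3 2 = 1 := (kr 2 (by norm_num)).trans hm1.c2
    have k4 : m3 4 = 2 * n := (kr 4 (by norm_num)).trans hm1.c4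
    have k20 := (kr 20 (by norm_num)).trans e20
    have k21 := (kr 21 (by norm_num)).trans e21
    apply Wp.step
    apply Wp.plus
    · simp (disch := decide) only [k4, k21]
      rfl
    apply Wp.minus
    · simp (disch := decide) only [Function.update_of_ne, k2, k20]
      rfl
    refine ⟨?_, ?_, fun r hr => ?_, fun a ha => ?_, ⟨w3, kw.of_eq fun a _ _ => ?_⟩,
      fun d hd => (kT d hd).of_eq fun a h _ => ?_⟩
    on_goal 6 => have := base_le_adT n d
    all_goals simp (disch := omega) only [Function.update_of_ne, Function.update_self]
    · omega
    · unfold adS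
      ring
    · exact (kr r (by omega)).trans (er r hr)
    · exact (ka a ha).trans (ea a ha)
  · rintro m1 ⟨e, -⟩
    omega
  · rintro m1 ⟨-, -, h⟩
    exact h

end PhaseLearning

namespace PhaseLearning

/-! ### The off-diagonal entries -/

/-- Body of the loop of `copyRow`. -/
def copyRowBody : Prog :=
  block [.load 27 26, .minus 28 25 23, .ite 28 (.store 21 27) skip, .plus 21 21 2, .plus 26 26 2,
    .plus 25 25 2, .minus 24 24 2]

/-- Copies the entries after number `m 23` of the second half of the work space to address `m 21`. -/
def copyRow : Prog :=
  block [.plus 24 0 3, .const 25 0, .plus 26 5 0, .loop 24 copyRowBody]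

theorem copyRow_spec {X n G α β P k : ℕ} {m : Mem} {z : ℕ → ZMod 2}
    (hX : n ≤ X) (hm : Consts n G α β m) (h21 : m 21 = P) (h23 : m 23 = k) (hP : 64 + 2 * n ≤ P)
    (hz : ∀ i < n, m (64 + n + i) = (z i).val) :
    Wp X 30 copyRow m [] fun m' => (∀ r < 24, r ≠ 21 → m' r = m r) ∧ m' 21 = P + n ∧
      ∀ a, 64 ≤ a → m' a = if P + k < a ∧ a < P + n then (z (a - P)).val else m a := by
  apply Wp.step
  apply Wp.plus rfl
  apply Wp.step
  apply Wp.const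
  apply Wp.step
  apply Wp.plus rfl
  refine (Wp.loopc (d := 20) (N := n) (fun s m' => m' 24 = n - s ∧ m' 25 = s ∧ m' 26 = 64 + n + s ∧
    m' 21 = P + s ∧ (∀ r < 24, r ≠ 21 → m' r = m r) ∧
    ∀ a, 64 ≤ a → m' a = if P + k < a ∧ a < P + s then (z (a - P)).val else m a)
      hX ?_ ?_ ?_).mono (by norm_num) ?_
  · refine ⟨?_, ?_, ?_, ?_, fun r hr _ => ?_, fun a ha => ?_⟩
    all_goals simp (disch := omega) only [Function.update_of_ne, Function.update_self, hm.c0,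
      hm.c3, hm.c5, h21, if_neg]
    all_goals rfl
  · rintro s hs m1 ⟨e24, e25, e26, e21, er, ea⟩
    refine ⟨by omega, ?_⟩
    have e2 : m1 2 = 1 := (er 2 (by norm_num) (by norm_num)).trans hm.c2
    have e23 : m1 23 = k := (er 23 (by norm_num) (by norm_num)).trans h23
    apply Wp.step
    apply Wp.load (v := (z s).val)
    · rw [e26, ea _ (by omega), if_neg (by omega), hz s hs]
    apply Wp.step
    -- Truncation makes this nonzero exactly for columns to the right of the diagonal, so nothing
    -- else is overwritten.
    apply Wp.minus (v := s - k)
    · simp (disch := decide) only [Function.update_of_ne, e25, e23]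
    refine Wp.call (d' := 5) (o1 := []) (o2 := []) (R1 := fun m' => m' 24 = n - s ∧ m' 25 = s ∧
      m' 26 = 64 + n + s ∧ m' 21 = P + s ∧ (∀ r < 24, r ≠ 21 → m' r = m r) ∧
      ∀ a, 64 ≤ a → m' a = if P + k < a ∧ a < P + (s + 1) then (z (a - P)).val else m a) ?_
      (by norm_num) rfl ?_
    · refine Wp.ite ?_ ?_
      · intro h
        rw [Function.update_self] at h
        apply Wp.store (a := P + s) (v := (z s).val)
        · simp (disch := decide) only [Function.update_of_ne, e21]
        · simp (disch := decide) only [Function.update_of_ne, Function.update_self]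
        refine ⟨?_, ?_, ?_, ?_, fun r hr hr' => ?_, fun a ha => ?_⟩
        · simp (disch := omega) only [Function.update_of_ne, e24]
        · simp (disch := omega) only [Function.update_of_ne, e25]
        · simp (disch := omega) only [Function.update_of_ne, e26]
        · simp (disch := omega) only [Function.update_of_ne, e21]
        · simp (disch := omega) only [Function.update_of_ne]
          exact er r hr hr'
        · by_cases hsa : a = P + s
          · subst hsa
            rw [Function.update_self, if_pos (by omega), Nat.add_sub_cancel_left]
          · simp (disch := omega) only [Function.update_of_ne]
            rw [ea a ha]
            congr 1
            apply propext
            omega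
      · intro h
        rw [Function.update_self] at h
        apply Wp.const
        refine ⟨?_, ?_, ?_, ?_, fun r hr hr' => ?_, fun a ha => ?_⟩
        · simp (disch := omega) only [Function.update_of_ne, e24]
        · simp (disch := omega) only [Function.update_of_ne, e25]
        · simp (disch := omega) only [Function.update_of_ne, e26]
        · simp (disch := omega) only [Function.update_of_ne, e21]
        · simp (disch := omega) only [Function.update_of_ne]
          exact er r hr hr'
        · simp (disch := omega) only [Function.update_of_ne]
          rw [ea a ha]
          congr 1
          apply propext
          omega
    rintro m2 ⟨f24, f25, f26, f21, fr, fa⟩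
    have f2 : m2 2 = 1 := (fr 2 (by norm_num) (by norm_num)).trans hm.c2
    iterate 4
      try apply Wp.step
      first
      | apply Wp.plus
      | apply Wp.minus
      on_goal 1 => simp (disch := decide) only
        [Function.update_of_ne, f2, f24, f25, f26, f21]; rfl
    refine ⟨?_, ?_, ?_, ?_, fun r hr hr' => ?_, fun a ha => ?_⟩
    all_goals simp (disch := omega) only [Function.update_of_ne, Function.update_self]
    · omega
    · omega
    · omega
    · exact fr r hr hr'
    · exact fa a ha
  · rintro m1 ⟨e, -⟩
    omega
  · rintro m1 ⟨-, -, -, h1, h2, h3⟩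
    exact ⟨h2, h1, h3⟩

/-- Body of the loop of `offDiagonal`. -/
def offDiagonalBody : Prog :=
  block [clearVec, .store 22 2, reduce, copyRow, .plus 22 22 2, .plus 23 23 2, .minus 20 20 2]

/-- Computes the entries above the diagonal from a full set of pivot vectors. -/
def offDiagonal : Prog :=
  block [.plus 20 0 3, .plus 21 7 3, .plus 22 5 3, .const 23 0, .loop 20 offDiagonalBody]

/-- Row number `k` of the matrix that is represented by the pivot vectors `T`. -/
def solvedRow (n : ℕ) (T : ℕ → ℕ → ZMod 2) (k : ℕ) : ℕ → ZMod 2 :=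
  fun i => (red n (T, Pi.single k 1)).2 (n + i)

/-- The array of the matrix holds the entries of `U`. -/
def HoldsU (m : Mem) (n : ℕ) (U : ℕ → ℕ → ℕ) : Prop :=
  ∀ k < n, ∀ i < n, m (adU n + n * k + i) = U k i

theorem row_lt {n k l i : ℕ} (h : k < l) (hi : i < n) : n * k + i < n * l := by
  have := Nat.mul_le_mul_left n h
  rw [Nat.mul_succ] at this
  omega

/-- The hypothesis `hfull` says that reduction inserts no new pivot, so the same pivots serve for
all unit vectors. The residual of a unit vector is a column of the symmetric matrix, which is why it
can be stored as a row. -/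
theorem offDiagonal_spec {X n G α β : ℕ} {m : Mem} {T : ℕ → ℕ → ZMod 2} {w : ℕ → ZMod 2}
    (hX : 2 * n ≤ X) (hm : Consts n G α β m) (hw : HoldsV m 64 (2 * n) w)
    (hT : HoldsT m n T) (hfull : ∀ w, (red n (T, w)).1 = T) (hU : HoldsU m n fun _ _ => 0) :
    Wp X 80 offDiagonal m [] fun m' => SameRegs 20 m m' ∧ (∀ a, adC n ≤ a → m' a = m a) ∧
      HoldsU m' n fun k i => if k < i then (solvedRow n T k i).val else 0 := by
  have hb := base_le_adU n
  have hUC : adC n = adU n + n * n := rfl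
  apply Wp.step
  apply Wp.plus rfl
  apply Wp.step
  apply Wp.plus rfl
  apply Wp.step
  apply Wp.plus rfl
  apply Wp.step
  apply Wp.const
  refine (Wp.loopc (d := 70) (N := n) (fun s m' => m' 20 = n - s ∧ m' 21 = adU n + n * s ∧
    m' 22 = 64 + s ∧ m' 23 = s ∧ SameRegs 20 m m' ∧ (∀ a, adC n ≤ a → m' a = m a) ∧
    (∃ w', HoldsV m' 64 (2 * n) w') ∧ HoldsT m' n T ∧
    HoldsU m' n fun k i => if k < s ∧ k < i then (solvedRow n T k i).val else 0)
      (by omega) ?_ ?_ ?_).mono (by norm_num) ?_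
  · refine ⟨?_, ?_, ?_, ?_, fun r hr => ?_, fun a ha => ?_, ⟨w, hw.of_eq fun a _ _ => ?_⟩,
      fun d hd => (hT d hd).of_eq fun a h _ => ?_, fun k hk i hi => ?_⟩
    on_goal 8 => have := base_le_adT n d
    all_goals simp (disch := omega) only [Function.update_of_ne, Function.update_self, hm.c0,
      hm.c3, hm.c5, hm.c7, Nat.mul_zero]
    · rfl
    · simpa using hU k hk i hi
  · rintro k hk m1 ⟨e20, e21, e22, e23, er, ea, ⟨w1, ew⟩, eT, eU⟩
    refine ⟨by omega, ?_⟩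
    have hkn : n * k + n ≤ n * n := by
      have := Nat.mul_le_mul_left n hk
      rwa [Nat.mul_succ] at this
    have hm1 : Consts n G α β m1 := hm.of_eq fun r hr => er r (by omega)
    refine Wp.call (clearVec_spec hX hm1 ew) (by norm_num) rfl ?_
    rintro m2 ⟨fr, fa, fw⟩
    have hm2 : Consts n G α β m2 := hm1.of_eq fun r hr => fr r (by omega)
    apply Wp.step
    apply Wp.store (a := 64 + k) (v := 1)
    · simp (disch := decide) only [fr, e22]
    · exact hm2.c2
    refine Wp.call (reduce_spec (w := Pi.single k 1) (T := T) hX (hm2.of_eq fun r hr => ?_)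
      (fun i hi => ?_) fun d hd => (eT d hd).of_eq fun a h _ => ?_) (by norm_num) rfl ?_
    · simp (disch := omega) only [Function.update_of_ne]
    · by_cases hik : i = k
      · subst hik
        rw [Function.update_self, Pi.single_eq_same, ZMod.val_one]
      · simp (disch := omega) only [Function.update_of_ne]
        rw [fw i hi, Pi.single_eq_of_ne hik]
        rfl
    · have := base_le_adT n d
      simp (disch := omega) only [Function.update_of_ne, fa]
    rintro m3 ⟨gr, ga, gw, gT⟩
    have hr3 : ∀ r < 40, m3 r = m1 r := fun r hr => by
      rw [gr r hr]
      simp (disch := omega) only [Function.update_of_ne, fr]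
    have ha3 : ∀ a, adU n ≤ a → m3 a = m1 a := fun a ha => by
      rw [ga a ha]
      simp (disch := omega) only [Function.update_of_ne, fa]
    have hm3 : Consts n G α β m3 := hm1.of_eq fun r hr => hr3 r (by omega)
    rw [hfull] at gT
    refine Wp.call (copyRow_spec (P := adU n + n * k) (k := k) (z := solvedRow n T k) (by omega)
      hm3 ?_ ?_ (by omega) gw.snd) (by norm_num) rfl ?_
    · rw [hr3 21 (by norm_num), e21]
    · rw [hr3 23 (by norm_num), e23]
    rintro m4 ⟨kr, k21, ka⟩
    have k2 : m4 2 = 1 := (kr 2 (by norm_num) (by norm_num)).trans hm3.c2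
    have k20 := (kr 20 (by norm_num) (by norm_num)).trans ((hr3 20 (by norm_num)).trans e20)
    have k22 := (kr 22 (by norm_num) (by norm_num)).trans ((hr3 22 (by norm_num)).trans e22)
    have k23 := (kr 23 (by norm_num) (by norm_num)).trans ((hr3 23 (by norm_num)).trans e23)
    iterate 3
      try apply Wp.step
      first
      | apply Wp.plus
      | apply Wp.minus
      on_goal 1 => simp (disch := decide) only [Function.update_of_ne, k2, k20, k22, k23]; rfl
    refine ⟨?_, ?_, ?_, ?_, fun r hr => ?_, fun a ha => ?_, ⟨_, gw.of_eq fun a _ _ => ?_⟩,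
      fun d hd => (gT d hd).of_eq fun a h h' => ?_, fun l hl i hi => ?_⟩
    on_goal 8 =>
      have := base_le_adT n d
      have := adT_add_le_adU hd
    all_goals simp (disch := omega) only [Function.update_of_ne, Function.update_self]
    · omega
    · rw [k21]; ring
    · omega
    · rw [kr r (by omega) (by omega), hr3 r (by omega), er r hr]
    · rw [ka a (by omega), if_neg (by omega), ha3 a (by omega), ea a ha]
    · rw [ka a (by omega), if_neg (by omega)]
    · rw [ka a (by omega), if_neg (by omega)]
    · rw [ka _ (by omega), ha3 _ (by omega), eU l hl i hi]
      rcases Nat.lt_trichotomy l k with h | h | h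
      · have := row_lt h hi
        rw [if_neg (by omega)]
        simp only [h, true_and, show l < k + 1 by omega]
      · subst h
        simp only [lt_irrefl, false_and, if_false, lt_add_one, true_and, add_assoc]
        by_cases h1 : l < i
        · rw [if_pos (by omega), if_pos h1, show adU n + (n * l + i) - (adU n + n * l) = i by omega]
        · rw [if_neg (by omega), if_neg h1]
      · have h2 := Nat.mul_le_mul_left n (show k + 1 ≤ l from h)
        rw [Nat.mul_succ] at h2
        rw [if_neg (by omega)]
        beta_reduce
        rw [if_neg (by omega), if_neg (by omega)]
  · rintro m1 ⟨e, -⟩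
    omega
  · rintro m1 ⟨-, -, -, -, h1, h2, -, -, h3⟩
    refine ⟨h1, h2, fun k hk i hi => ?_⟩
    rw [h3 k hk i hi]
    simp only [hk, true_and]

end PhaseLearning

namespace PhaseLearning

/-! ### Initialization -/

/-- Sets up the constants. -/
def initConsts (α β : ℕ) : Prog :=
  block [.const 2 1, .plus 4 0 0, .const 5 64, .plus 6 5 4, .minus 20 1 2, .minus 20 20 2,
    .const 21 3, .const 11 α, .const 12 β,
    .loop 20 (block [.plus 10 10 2, .minus 20 20 21]),
    .plus 7 6 3, .plus 22 0 3, .loop 22 (block [.plus 7 7 4, .minus 22 22 2]),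
    .plus 8 7 3, .plus 22 0 3, .loop 22 (block [.plus 8 8 0, .minus 22 22 2]),
    .plus 9 8 0]

/-- Multiplication by repeated addition, which is how the base addresses are computed. -/
theorem countdown_spec {X N k p i : ℕ} {m : Mem} (hN : N ≤ X) (hki : k ≠ i) (hi2 : i ≠ 2)
    (hk2 : k ≠ 2) (hpk : p ≠ k) (hpi : p ≠ i) (h2 : m 2 = 1) (hi : m i = N) :
    Wp X 10 (.loop i (block [.plus k k p, .minus i i 2])) m [] fun m' =>
      m' k = m k + m p * N ∧ ∀ a, a ≠ k → a ≠ i → m' a = m a := by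
  refine (Wp.loopc (d := 5) (N := N) (fun s m' => m' i = N - s ∧ m' k = m k + m p * s ∧
    ∀ a, a ≠ k → a ≠ i → m' a = m a) hN ?_ ?_ ?_).mono (by norm_num) ?_
  · exact ⟨by omega, by simp, fun _ _ _ => rfl⟩
  · rintro s hs m1 ⟨ei, ek, ea⟩
    refine ⟨by omega, ?_⟩
    apply Wp.step
    apply Wp.plus rfl
    apply Wp.minus rfl
    refine ⟨?_, ?_, fun a h1 h2 => ?_⟩
    · rw [Function.update_self, Function.update_of_ne hki.symm, Function.update_of_ne hk2.symm,
        ea 2 hk2.symm hi2.symm, ei, h2]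
      omega
    · rw [Function.update_of_ne hki, Function.update_self, ek, ea p hpk hpi]
      ring
    · rw [Function.update_of_ne h2, Function.update_of_ne h1, ea a h1 h2]
  · rintro m1 ⟨e, -⟩
    omega
  · rintro m1 ⟨-, h⟩
    exact h

theorem initConsts_spec {X n M : ℕ} (α β : ℕ) (hn : n ≤ X) (hM : M ≤ X) :
    Wp X 40 (initConsts α β) (inputMem n M) [] fun m' => Consts n (M / 3) α β m' ∧
      ∀ a, 64 ≤ a → m' a = 0 := by
  have z : ∀ a, 2 ≤ a → inputMem n M a = 0 := fun a ha => by
    unfold inputMem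
    rw [if_neg (by omega), if_neg (by omega)]
  have z0 : inputMem n M 0 = n := rfl
  have z1 : inputMem n M 1 = M := rfl
  have e0 : ∀ m : Mem, m = inputMem n M → Wp X 40 (initConsts α β) m [] fun m' =>
      Consts n (M / 3) α β m' ∧ ∀ a, 64 ≤ a → m' a = 0 := by
    intro m hm
    rw [← hm] at z z0 z1
    iterate 9
      apply Wp.step
      first
      | apply Wp.const
      | apply Wp.plus
        on_goal 1 => simp (disch := decide) only
          [Function.update_of_ne, Function.update_self, z, z0, z1]; rfl
      | apply Wp.minus
        on_goal 1 => simp (disch := decide) only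
          [Function.update_of_ne, Function.update_self, z, z0, z1]; rfl
    -- Division by three: counting down from M - 2 in steps of 3 with truncated subtraction takes
    -- exactly M / 3 rounds.
    refine Wp.call (Wp.loopc (d := 5) (N := M / 3) (fun s m' => m' 20 = M - 1 - 1 - 3 * s ∧
      m' 10 = s ∧ m' 0 = n ∧ m' 2 = 1 ∧ m' 3 = 0 ∧ m' 4 = 2 * n ∧ m' 5 = 64 ∧ m' 6 = adT n 0 ∧
      m' 21 = 3 ∧ m' 11 = α ∧ m' 12 = β ∧ ∀ a, 64 ≤ a → m' a = 0) (by omega) ?_ ?_ ?_)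
      (by norm_num) rfl ?_
    · refine ⟨?_, ?_, ?_, ?_, ?_, ?_, ?_, ?_, ?_, ?_, ?_, fun a ha => ?_⟩
      all_goals simp (disch := omega) only [Function.update_of_ne, Function.update_self, z, z0, z1]
      · rfl
      · omega
      · unfold adT
        omega
    · rintro s hs m1 ⟨e20, e10, e0, e2, e3, e4, e5, e6, e21, e11, e12, ea⟩
      refine ⟨by omega, ?_⟩
      apply Wp.step
      apply Wp.plus rfl
      apply Wp.minus rfl
      refine ⟨?_, ?_, ?_, ?_, ?_, ?_, ?_, ?_, ?_, ?_, ?_, fun a ha => ?_⟩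
      all_goals simp (disch := omega) only [Function.update_of_ne, Function.update_self, e20, e10,
        e0, e2, e3, e4, e5, e6, e21, e11, e12, ea]
      omega
    · rintro m1 ⟨e, -⟩
      omega
    rintro m1 ⟨e20, e10, e0, e2, e3, e4, e5, e6, e21, e11, e12, ea⟩
    iterate 2
      apply Wp.step
      apply Wp.plus
      on_goal 1 => simp (disch := decide) only [Function.update_of_ne, e0, e3, e6]; rfl
    refine Wp.call (countdown_spec (N := n) hn (by norm_num) (by norm_num) (by norm_num)
      (by norm_num) (by norm_num) ?_ ?_) (by norm_num) rfl ?_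
    · simp (disch := decide) only [Function.update_of_ne, e2]
    · simp (disch := decide) only [Function.update_self]
      rfl
    rintro m2 ⟨f7, fa⟩
    simp (disch := decide) only [Function.update_of_ne, Function.update_self, e4] at f7
    have fr : ∀ a, a ≠ 7 → a ≠ 22 → m2 a = m1 a := fun a h1 h2 => by
      rw [fa a h1 h2, Function.update_of_ne h2, Function.update_of_ne h1]
    clear fa
    iterate 2
      apply Wp.step
      apply Wp.plus
      on_goal 1 => simp (disch := decide) only [Function.update_of_ne, fr, e0, e3, f7]; rfl
    refine Wp.call (countdown_spec (N := n) hn (by norm_num) (by norm_num) (by norm_num)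
      (by norm_num) (by norm_num) ?_ ?_) (by norm_num) rfl ?_
    · simp (disch := decide) only [Function.update_of_ne, fr, e2]
    · simp (disch := decide) only [Function.update_self]
      rfl
    rintro m3 ⟨g8, ga⟩
    simp (disch := decide) only [Function.update_of_ne, Function.update_self, fr, e0] at g8
    have gr : ∀ a, a ≠ 8 → a ≠ 22 → m3 a = m2 a := fun a h1 h2 => by
      rw [ga a h1 h2, Function.update_of_ne h2, Function.update_of_ne h1]
    clear ga
    apply Wp.plus rfl
    refine ⟨⟨?_, ?_, ?_, ?_, ?_, ?_, ?_, ?_, ?_, ?_, ?_, ?_⟩, fun a ha => ?_⟩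
    all_goals simp (disch := omega) only [Function.update_of_ne, Function.update_self, gr, fr, ea,
      e0, e2, e3, e4, e5, e6, e10, e11, e12, f7, g8, adS, adC, adU]
    all_goals simp only [adT, Nat.add_zero, Nat.mul_zero]
  exact e0 _ rfl

/-! ### Measurements -/

/-- Measurement of the `n` qubits at address `a` in the Hadamard basis, with outcomes `d`. -/
def readOps (n a : ℕ) (d : ℕ → ZMod 2) : List QOp :=
  (List.range n).flatMap fun i => [.H (a + i), .P (a + i) (d i)]

/-- Measurement in the Bell basis of the `n` qubits at address `a` with those at address `b`. -/
def bellOps (n a b : ℕ) (y z : ℕ → ZMod 2) : List QOp :=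
  (List.range n).flatMap (fun i => [.C (a + i) (b + i), .P (b + i) (y i)]) ++ readOps n a z

/-- A vector of `2 n` bits, given by its halves. -/
def joinV (n : ℕ) (y z : ℕ → ZMod 2) : ℕ → ZMod 2 := fun i => if i < n then y i else z (i - n)

/-- Body of the loop of `sample`. -/
def sampleBody : Prog :=
  block [.plus 24 0 3,
    .loop 24 (block [.cnot 21 22, .measure 25 22, .store 23 25, .plus 21 21 2, .plus 22 22 2,
      .plus 23 23 2, .minus 24 24 2]),
    .minus 21 21 0, .plus 24 0 3,
    .loop 24 (block [.hadamard 21, .measure 25 21, .store 23 25, .plus 21 21 2,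
      .plus 23 23 2, .minus 24 24 2]),
    .plus 21 22 0, .plus 22 21 0, .minus 20 20 2]

/-- Bell measurements of the first two copies of every three. -/
def sample : Prog :=
  block [.plus 20 10 3, .const 21 0, .plus 22 0 3, .plus 23 9 3, .loop 20 sampleBody]

/-- The outcomes are arbitrary here, since only the classical bookkeeping is at stake; whether they
can occur is decided later by the norm of the state. The final pointers skip the third copy of the
group. -/
theorem sampleBody_spec {X n G α β a b P : ℕ} {m : Mem} (y z : ℕ → ZMod 2) (hn : n ≤ X)
    (hm : Consts n G α β m) (h21 : m 21 = a) (h22 : m 22 = b) (h23 : m 23 = P) (hP : 64 ≤ P) :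
    Wp X 30 sampleBody m (bellOps n a b y z) fun m' => SameRegs 20 m m' ∧ m' 20 = m 20 - 1 ∧
      m' 21 = b + 2 * n ∧ m' 22 = b + 3 * n ∧ m' 23 = P + 2 * n ∧
      (∀ c, 64 ≤ c → (c < P ∨ P + 2 * n ≤ c) → m' c = m c) ∧
      HoldsV m' P (2 * n) (joinV n y z) := by
  apply Wp.step
  apply Wp.plus rfl
  refine Wp.call (Wp.loop (d := 10) (N := n) (fun s m' => m' 24 = n - s ∧ m' 21 = a + s ∧
    m' 22 = b + s ∧ m' 23 = P + s ∧ (∀ r < 21, m' r = m r) ∧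
    ∀ c, 64 ≤ c → m' c = if P ≤ c ∧ c < P + s then (y (c - P)).val else m c)
    (fun i => [.C (a + i) (b + i), .P (b + i) (y i)]) hn ?_ ?_ ?_) (by norm_num) rfl ?_
  · refine ⟨?_, ?_, ?_, ?_, fun r hr => ?_, fun c hc => ?_⟩
    all_goals simp (disch := omega) only [Function.update_of_ne, Function.update_self, hm.c0,
      hm.c3, h21, h22, h23, if_neg]
    all_goals rfl
  · rintro s hs m1 ⟨e24, e21, e22, e23, er, ea⟩
    refine ⟨by omega, ?_⟩
    have e2 : m1 2 = 1 := (er 2 (by norm_num)).trans hm.c2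
    apply Wp.stepq
    apply Wp.cnot e21 e22
    apply Wp.stepq
    apply Wp.measure e22
    apply Wp.step
    apply Wp.store (a := P + s) (v := (y s).val)
    · simp (disch := decide) only [Function.update_of_ne, e23]
    · simp only [Function.update_self]
    iterate 4
      try apply Wp.step
      first
      | apply Wp.plus
      | apply Wp.minus
      on_goal 1 => simp (disch := first | decide | omega) only
        [Function.update_of_ne, e2, e24, e21, e22, e23]; rfl
    refine ⟨?_, ?_, ?_, ?_, fun r hr => ?_, fun c hc => ?_⟩
    all_goals try simp (disch := omega) only [Function.update_of_ne, Function.update_self]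
    · omega
    · omega
    · omega
    · omega
    · exact er r hr
    · by_cases hsc : c = P + s
      · subst hsc
        rw [Function.update_self, if_pos (by omega), Nat.add_sub_cancel_left]
      · rw [Function.update_of_ne hsc, Function.update_of_ne (by omega), ea c hc]
        congr 1
        apply propext
        omega
  · rintro m1 ⟨e, -⟩
    omega
  rintro m1 ⟨-, e21, e22, e23, er, ea⟩
  have e0 : m1 0 = n := (er 0 (by norm_num)).trans hm.c0
  have e3 : m1 3 = 0 := (er 3 (by norm_num)).trans hm.c3
  apply Wp.step
  -- The pointer returns to the start of the first copy for the pass of Hadamard measurements.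
  apply Wp.minus (v := a)
  · rw [e21, e0]
    omega
  apply Wp.step
  apply Wp.plus (v := n)
  · simp (disch := decide) only [Function.update_of_ne, e0, e3]
    rfl
  refine Wp.call (o2 := []) (Wp.loop (d := 10) (N := n) (fun s m' => m' 24 = n - s ∧ m' 21 = a + s ∧
    m' 22 = b + n ∧ m' 23 = P + n + s ∧ (∀ r < 21, m' r = m r) ∧
    ∀ c, 64 ≤ c → m' c = if P ≤ c ∧ c < P + n + s then (joinV n y z (c - P)).val else m c)
    (fun i => [.H (a + i), .P (a + i) (z i)]) hn ?_ ?_ ?_) (by norm_num) (by simp [readOps]) ?_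
  · refine ⟨?_, ?_, ?_, ?_, fun r hr => ?_, fun c hc => ?_⟩
    all_goals simp (disch := omega) only [Function.update_of_ne, Function.update_self, e22, e23,
      Nat.sub_zero, Nat.add_zero]
    · exact er r hr
    · rw [ea c hc]
      by_cases h : P ≤ c ∧ c < P + n
      · rw [if_pos h, if_pos h, joinV, if_pos (by omega)]
      · rw [if_neg h, if_neg h]
  · rintro s hs m1 ⟨e24, e21, e22, e23, er, ea⟩
    refine ⟨by omega, ?_⟩
    have e2 : m1 2 = 1 := (er 2 (by norm_num)).trans hm.c2
    apply Wp.stepq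
    apply Wp.hadamard e21
    apply Wp.stepq
    apply Wp.measure e21
    apply Wp.step
    apply Wp.store (a := P + n + s) (v := (z s).val)
    · simp (disch := decide) only [Function.update_of_ne, e23]
    · simp only [Function.update_self]
    iterate 3
      try apply Wp.step
      first
      | apply Wp.plus
      | apply Wp.minus
      on_goal 1 => simp (disch := first | decide | omega) only
        [Function.update_of_ne, e2, e24, e21, e22, e23]; rfl
    refine ⟨?_, ?_, ?_, ?_, fun r hr => ?_, fun c hc => ?_⟩
    all_goals try simp (disch := omega) only [Function.update_of_ne, Function.update_self]
    · omega
    · omega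
    · exact e22
    · omega
    · exact er r hr
    · by_cases hsc : c = P + n + s
      · subst hsc
        rw [Function.update_self, if_pos (by omega), joinV, if_neg (by omega),
          show P + n + s - P - n = s by omega]
      · rw [Function.update_of_ne hsc, Function.update_of_ne (by omega), ea c hc]
        congr 1
        apply propext
        omega
  · rintro m1 ⟨e, -⟩
    omega
  rintro m2 ⟨-, f21, f22, f23, fr, fa⟩
  have f0 : m2 0 = n := (fr 0 (by norm_num)).trans hm.c0
  have f2 : m2 2 = 1 := (fr 2 (by norm_num)).trans hm.c2
  have f20 : m2 20 = m 20 := fr 20 (by norm_num)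
  iterate 3
    try apply Wp.step
    first
    | apply Wp.plus
    | apply Wp.minus
    on_goal 1 => simp (disch := decide) only
      [Function.update_of_ne, Function.update_self, f0, f2, f20, f21, f22]; rfl
  refine ⟨fun r hr => ?_, ?_, ?_, ?_, ?_, fun c hc h => ?_, fun i hi => ?_⟩
  all_goals simp (disch := omega) only [Function.update_of_ne, Function.update_self]
  · exact fr r (by omega)
  · omega
  · omega
  · omega
  · rw [fa c hc, if_neg (by omega)]
  · rw [fa _ (by omega), if_pos (by omega), Nat.add_sub_cancel_left]

/-- The quantum operations of `sample`. -/
def sampleOps (n G : ℕ) (y z : ℕ → ℕ → ZMod 2) : List QOp :=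
  (List.range G).flatMap fun g => bellOps n (n * (3 * g)) (n * (3 * g + 1)) (y g) (z g)

theorem sample_spec {X n G α β : ℕ} {m : Mem} (y z : ℕ → ℕ → ZMod 2) (hn : n ≤ X) (hG : G ≤ X)
    (hm : Consts n G α β m) :
    Wp X 60 sample m (sampleOps n G y z) fun m' => SameRegs 20 m m' ∧
      (∀ c, 64 ≤ c → c < adS n 0 → m' c = m c) ∧
      HoldsS m' n G fun g => joinV n (y g) (z g) := by
  have hb := base_le_adU n
  apply Wp.step
  apply Wp.plus rfl
  apply Wp.step
  apply Wp.const
  apply Wp.step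
  apply Wp.plus rfl
  apply Wp.step
  apply Wp.plus rfl
  refine (Wp.loop (d := 40) (N := G) (fun s m' => m' 20 = G - s ∧ m' 21 = n * (3 * s) ∧
    m' 22 = n * (3 * s + 1) ∧ m' 23 = adS n s ∧ SameRegs 20 m m' ∧
    (∀ c, 64 ≤ c → c < adS n 0 → m' c = m c) ∧ HoldsS m' n s fun g => joinV n (y g) (z g))
    (fun g => bellOps n (n * (3 * g)) (n * (3 * g + 1)) (y g) (z g)) hG ?_ ?_ ?_).mono
    (by norm_num) ?_
  · refine ⟨?_, ?_, ?_, ?_, fun r hr => ?_, fun c hc _ => ?_, fun g hg => by omega⟩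
    all_goals simp (disch := omega) only [Function.update_of_ne, Function.update_self, hm.c0,
      hm.c3, hm.c9, hm.c10]
    all_goals simp
  · rintro s hs m1 ⟨e20, e21, e22, e23, er, ea, eS⟩
    refine ⟨by omega, ?_⟩
    have hS := adS_pos n s
    have h0s : adS n 0 ≤ adS n s := by unfold adS; omega
    refine (sampleBody_spec (y s) (z s) hn (hm.of_eq fun r hr => er r (by omega)) e21 e22 e23
      (by omega)).mono (by norm_num) ?_
    rintro m2 ⟨fr, f20, f21, f22, f23, fa, fS⟩
    refine ⟨by omega, by rw [f21]; ring, by rw [f22]; ring, by rw [f23]; unfold adS; ring,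
      fun r hr => (fr r hr).trans (er r hr), fun c hc h => ?_, fun g hg => ?_⟩
    · rw [fa c hc (by omega), ea c hc h]
    · rcases Nat.lt_succ_iff_lt_or_eq.1 hg with h | rfl
      · have h1 := Nat.mul_le_mul_left (2 * n) h
        have h2 : adS n g + 2 * n ≤ adS n s := by
          rw [Nat.mul_succ] at h1
          unfold adS
          omega
        have h3 := adS_pos n g
        exact (eS g h).of_eq fun c _ _ => fa c (by omega) (by omega)
      · exact fS
  · rintro m1 ⟨e, -⟩
    omega
  · rintro m1 ⟨-, -, -, -, h⟩
    exact h

end PhaseLearning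

namespace PhaseLearning

/-! ### The diagonal -/

/-- A controlled phase flip made of `T` and CNOT gates. -/
def czOps (c t : ℕ) : List QOp :=
  [.T c, .T c, .T t, .T t, .C c t, .T t, .T t, .T t, .T t, .T t, .T t, .C c t]

/-- Controlled phase flips on the qubits at address `a` for the nonzero entries of `U`. -/
def phaseOps (n : ℕ) (U : ℕ → ℕ → ℕ) (a : ℕ) : List QOp :=
  (List.range n).flatMap fun i => (List.range n).flatMap fun j =>
    if U i j ≠ 0 then czOps (a + i) (a + j) else []

/-- Controlled phase flip on the qubits `m 24` and `m 26`. -/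
def czGate : Prog :=
  block [.tgate 24, .tgate 24, .tgate 26, .tgate 26, .cnot 24 26, .tgate 26, .tgate 26, .tgate 26,
    .tgate 26, .tgate 26, .tgate 26, .cnot 24 26]

theorem czGate_spec {X c t : ℕ} {m : Mem} (hc : m 24 = c) (ht : m 26 = t) {R : Mem → Prop}
    (hR : R m) : Wp X 12 czGate m (czOps c t) R := by
  iterate 12
    try apply Wp.stepq
    first
    | apply Wp.tgate hc
    | apply Wp.tgate ht
    | apply Wp.cnot hc ht
  exact hR

/-- Removes the phases above the diagonal from the copy at address `m 21`. -/
def unphase : Prog :=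
  block [.plus 22 7 3, .plus 23 0 3, .plus 24 21 3,
    .loop 23 (block [.plus 25 0 3, .plus 26 21 3,
      .loop 25 (block [.load 27 22, .ite 27 czGate skip, .plus 22 22 2, .plus 26 26 2,
        .minus 25 25 2]),
      .plus 24 24 2, .minus 23 23 2])]

theorem unphase_spec {X n G α β a : ℕ} {m : Mem} {U : ℕ → ℕ → ℕ} (hn : n ≤ X)
    (hm : Consts n G α β m) (h21 : m 21 = a) (hU : HoldsU m n U) :
    Wp X 50 unphase m (phaseOps n U a) fun m' => SameRegs 22 m m' ∧
      ∀ c, 64 ≤ c → m' c = m c := by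
  have hb := base_le_adU n
  iterate 3
    apply Wp.step
    apply Wp.plus
    on_goal 1 => simp (disch := decide) only [Function.update_of_ne, hm.c0, hm.c3, hm.c7, h21]; rfl
  refine (Wp.loop (d := 40) (N := n) (fun s m' => m' 22 = adU n + n * s ∧ m' 23 = n - s ∧
    m' 24 = a + s ∧ SameRegs 22 m m' ∧ ∀ c, 64 ≤ c → m' c = m c)
    (fun i => (List.range n).flatMap fun j => if U i j ≠ 0 then czOps (a + i) (a + j) else [])
    hn ?_ ?_ ?_).mono (by norm_num) ?_
  · refine ⟨?_, ?_, ?_, fun r hr => ?_, fun c hc => ?_⟩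
    all_goals simp (disch := omega) only [Function.update_of_ne, Function.update_self]
    all_goals rfl
  · rintro k hk m1 ⟨e22, e23, e24, er, ea⟩
    refine ⟨by omega, ?_⟩
    have e21 := (er 21 (by norm_num)).trans h21
    have e0 : m1 0 = n := (er 0 (by norm_num)).trans hm.c0
    have e2 : m1 2 = 1 := (er 2 (by norm_num)).trans hm.c2
    have e3 : m1 3 = 0 := (er 3 (by norm_num)).trans hm.c3
    iterate 2
      apply Wp.step
      apply Wp.plus
      on_goal 1 => simp (disch := decide) only [Function.update_of_ne, e0, e3, e21]; rfl
    refine Wp.call (o2 := []) (Wp.loop (d := 30) (N := n) (fun s m' => m' 22 = adU n + n * k + s ∧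
      m' 23 = n - k ∧ m' 24 = a + k ∧ m' 25 = n - s ∧ m' 26 = a + s ∧ SameRegs 22 m m' ∧
      ∀ c, 64 ≤ c → m' c = m c)
      (fun j => if U k j ≠ 0 then czOps (a + k) (a + j) else []) hn ?_ ?_ ?_) (by norm_num)
      (by simp) ?_
    · refine ⟨?_, ?_, ?_, ?_, ?_, fun r hr => ?_, fun c hc => ?_⟩
      all_goals simp (disch := omega) only [Function.update_of_ne, Function.update_self, e22, e23,
        e24, Nat.add_zero, Nat.sub_zero]
      · exact er r hr
      · exact ea c hc
    · rintro s hs m2 ⟨f22, f23, f24, f25, f26, fr, fa⟩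
      refine ⟨by omega, ?_⟩
      have f2 : m2 2 = 1 := (fr 2 (by norm_num)).trans hm.c2
      apply Wp.step
      apply Wp.load (v := U k s)
      · rw [f22, fa _ (by omega), hU k hk s hs]
      refine Wp.call (d' := 20) (o2 := [])
        (o1 := if U k s ≠ 0 then czOps (a + k) (a + s) else []) (R1 := fun m' => m' 2 = 1 ∧
        m' 22 = adU n + n * k + s ∧ m' 23 = n - k ∧ m' 24 = a + k ∧ m' 25 = n - s ∧
        m' 26 = a + s ∧ SameRegs 22 m m' ∧
        ∀ c, 64 ≤ c → m' c = m c) ?_ (by norm_num) (by simp) ?_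
      · refine Wp.ite ?_ ?_
        · intro h
          rw [Function.update_self] at h
          rw [if_pos h]
          refine (czGate_spec (by simp (disch := decide) only [Function.update_of_ne, f24])
            (by simp (disch := decide) only [Function.update_of_ne, f26]) ?_).mono (by norm_num)
            fun _ h => h
          refine ⟨?_, ?_, ?_, ?_, ?_, ?_, fun r hr => ?_, fun c hc => ?_⟩
          all_goals simp (disch := omega) only [Function.update_of_ne, f2, f22, f23, f24, f25, f26]
          · exact fr r hr
          · exact fa c hc
        · intro h
          rw [Function.update_self] at h
          rw [if_neg (not_not.2 h)]
          apply Wp.const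
          refine ⟨?_, ?_, ?_, ?_, ?_, ?_, fun r hr => ?_, fun c hc => ?_⟩
          all_goals simp (disch := omega) only [Function.update_of_ne, f2, f22, f23, f24, f25, f26]
          · exact fr r hr
          · exact fa c hc
      rintro m3 ⟨k2, k22, k23, k24, k25, k26, kr, ka⟩
      iterate 3
        try apply Wp.step
        first
        | apply Wp.plus
        | apply Wp.minus
        on_goal 1 => simp (disch := decide) only
          [Function.update_of_ne, k2, k22, k25, k26]; rfl
      refine ⟨?_, ?_, ?_, ?_, ?_, fun r hr => ?_, fun c hc => ?_⟩
      all_goals simp (disch := omega) only [Function.update_of_ne, Function.update_self, k23, k24]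
      · rfl
      · omega
      · rfl
      · exact kr r hr
      · exact ka c hc
    · rintro m2 ⟨-, -, -, e, -⟩
      omega
    rintro m2 ⟨f22, f23, f24, -, -, fr, fa⟩
    have f2 : m2 2 = 1 := (fr 2 (by norm_num)).trans hm.c2
    iterate 2
      try apply Wp.step
      first
      | apply Wp.plus
      | apply Wp.minus
      on_goal 1 => simp (disch := decide) only
        [Function.update_of_ne, f2, f23, f24]; rfl
    refine ⟨?_, ?_, ?_, fun r hr => ?_, fun c hc => ?_⟩
    all_goals simp (disch := omega) only [Function.update_of_ne, Function.update_self, f22]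
    · ring
    · omega
    · rfl
    · exact fr r hr
    · exact fa c hc
  · rintro m1 ⟨-, e, -⟩
    omega
  · rintro m1 ⟨-, -, -, h⟩
    exact h

/-- Measures the copy at address `m 21` in the Hadamard basis and adds the outcomes to the
counters. -/
def tally : Prog :=
  block [.plus 22 8 3, .plus 23 0 3, .plus 24 21 3,
    .loop 23 (block [.hadamard 24, .measure 25 24, .load 26 22, .plus 26 26 25, .store 22 26,
      .plus 22 22 2, .plus 24 24 2, .minus 23 23 2])]

theorem tally_spec {X n G α β a : ℕ} {m : Mem} (d : ℕ → ZMod 2) (hn : n ≤ X)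
    (hm : Consts n G α β m) (h21 : m 21 = a) :
    Wp X 50 tally m (readOps n a d) fun m' => SameRegs 22 m m' ∧
      ∀ c, 64 ≤ c → m' c =
        if adC n ≤ c ∧ c < adC n + n then m c + (d (c - adC n)).val else m c := by
  have hb := base_le_adU n
  have hC : adU n ≤ adC n := by unfold adC; omega
  iterate 3
    apply Wp.step
    apply Wp.plus
    on_goal 1 => simp (disch := decide) only [Function.update_of_ne, hm.c0, hm.c3, hm.c8, h21]; rfl
  refine (Wp.loop (d := 40) (N := n) (fun s m' => m' 22 = adC n + s ∧ m' 23 = n - s ∧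
    m' 24 = a + s ∧ SameRegs 22 m m' ∧ ∀ c, 64 ≤ c → m' c =
      if adC n ≤ c ∧ c < adC n + s then m c + (d (c - adC n)).val else m c)
    (fun i => [.H (a + i), .P (a + i) (d i)]) hn ?_ ?_ ?_).mono (by norm_num) ?_
  · refine ⟨?_, ?_, ?_, fun r hr => ?_, fun c hc => ?_⟩
    all_goals simp (disch := omega) only [Function.update_of_ne, Function.update_self, if_neg]
    all_goals rfl
  · rintro s hs m1 ⟨e22, e23, e24, er, ea⟩
    refine ⟨by omega, ?_⟩
    have e2 : m1 2 = 1 := (er 2 (by norm_num)).trans hm.c2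
    have ev : m1 (adC n + s) = m (adC n + s) := by rw [ea _ (by omega), if_neg (by omega)]
    apply Wp.stepq
    apply Wp.hadamard e24
    apply Wp.stepq
    apply Wp.measure e24
    apply Wp.step
    apply Wp.load (v := m (adC n + s))
    · simp (disch := first | decide | omega) only [Function.update_of_ne, e22, ev]
    apply Wp.step
    apply Wp.plus (v := m (adC n + s) + (d s).val)
    · simp (disch := decide) only [Function.update_of_ne, Function.update_self]
    apply Wp.step
    apply Wp.store (a := adC n + s) (v := m (adC n + s) + (d s).val)
    · simp (disch := decide) only [Function.update_of_ne, e22]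
    · simp only [Function.update_self]
    iterate 3
      try apply Wp.step
      first
      | apply Wp.plus
      | apply Wp.minus
      on_goal 1 => simp (disch := first | decide | omega) only
        [Function.update_of_ne, e2, e22, e23, e24]; rfl
    refine ⟨?_, ?_, ?_, fun r hr => ?_, fun c hc => ?_⟩
    · simp (disch := omega) only [Function.update_of_ne, Function.update_self]
      rfl
    · simp (disch := omega) only [Function.update_self]
      omega
    · simp (disch := omega) only [Function.update_of_ne, Function.update_self]
      rfl
    · simp (disch := omega) only [Function.update_of_ne]
      exact er r hr
    · simp (disch := omega) only [Function.update_of_ne]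
      by_cases hsc : c = adC n + s
      · subst hsc
        rw [Function.update_self, if_pos (by omega), Nat.add_sub_cancel_left]
      · rw [Function.update_of_ne hsc, Function.update_of_ne (by omega),
          Function.update_of_ne (by omega), Function.update_of_ne (by omega), ea c hc]
        congr 1
        apply propext
        omega
  · rintro m1 ⟨-, e, -⟩
    omega
  · rintro m1 ⟨-, -, -, h⟩
    exact h

/-- Processes the third copy of every three. -/
def readThirds : Prog :=
  block [.plus 20 10 3, .plus 21 4 3,
    .loop 20 (block [unphase, tally, .plus 21 21 4, .plus 21 21 0, .minus 20 20 2])]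

/-- The quantum operations of `readThirds`. -/
def thirdsOps (n G : ℕ) (U : ℕ → ℕ → ℕ) (d : ℕ → ℕ → ZMod 2) : List QOp :=
  (List.range G).flatMap fun g =>
    phaseOps n U (n * (3 * g + 2)) ++ readOps n (n * (3 * g + 2)) (d g)

/-- The number of ones at position `i` in the first `G` vectors. -/
def ones (G : ℕ) (d : ℕ → ℕ → ZMod 2) (i : ℕ) : ℕ := ∑ g ∈ Finset.range G, (d g i).val

/-- The third copy of the first group starts at qubit 2 * n, a value that cell `4` already contains;
the stride from group to group is 3 * n. -/
theorem readThirds_spec {X n G α β : ℕ} {m : Mem} {U : ℕ → ℕ → ℕ} (d : ℕ → ℕ → ZMod 2)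
    (hn : n ≤ X) (hG : G ≤ X) (hm : Consts n G α β m) (hU : HoldsU m n U)
    (h0 : ∀ i < n, m (adC n + i) = 0) :
    Wp X 80 readThirds m (thirdsOps n G U d) fun m' => SameRegs 20 m m' ∧ HoldsU m' n U ∧
      ∀ i < n, m' (adC n + i) = ones G d i := by
  have hb := base_le_adU n
  have hC : adU n ≤ adC n := by unfold adC; omega
  iterate 2
    apply Wp.step
    apply Wp.plus
    on_goal 1 => simp (disch := decide) only [Function.update_of_ne, hm.c3, hm.c4, hm.c10]; rfl
  refine (Wp.loop (d := 70) (N := G) (fun s m' => m' 20 = G - s ∧ m' 21 = n * (3 * s + 2) ∧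
    SameRegs 20 m m' ∧ HoldsU m' n U ∧ ∀ i < n, m' (adC n + i) = ones s d i)
    (fun g => phaseOps n U (n * (3 * g + 2)) ++ readOps n (n * (3 * g + 2)) (d g))
    hG ?_ ?_ ?_).mono (by norm_num) ?_
  · refine ⟨?_, ?_, fun r hr => ?_, fun k hk i hi => ?_, fun i hi => ?_⟩
    all_goals simp (disch := omega) only [Function.update_of_ne, Function.update_self]
    · rfl
    · simp [mul_comm]
    · exact hU k hk i hi
    · rw [h0 i hi]
      rfl
  · rintro s hs m1 ⟨e20, e21, er, eU, eC⟩
    refine ⟨by omega, ?_⟩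
    have hm1 : Consts n G α β m1 := hm.of_eq fun r hr => er r (by omega)
    refine Wp.call (unphase_spec hn hm1 e21 eU) (by norm_num) rfl ?_
    rintro m2 ⟨fr, fa⟩
    refine Wp.call (o2 := []) (tally_spec (d s) hn (hm1.of_eq fun r hr => fr r (by omega))
      ((fr 21 (by norm_num)).trans e21)) (by norm_num) (by simp) ?_
    rintro m3 ⟨gr, ga⟩
    have k2 : m3 2 = 1 := (gr 2 (by norm_num)).trans ((fr 2 (by norm_num)).trans hm1.c2)
    have k4 : m3 4 = 2 * n := (gr 4 (by norm_num)).trans ((fr 4 (by norm_num)).trans hm1.c4)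
    have k0 : m3 0 = n := (gr 0 (by norm_num)).trans ((fr 0 (by norm_num)).trans hm1.c0)
    have k20 := (gr 20 (by norm_num)).trans ((fr 20 (by norm_num)).trans e20)
    have k21 := (gr 21 (by norm_num)).trans ((fr 21 (by norm_num)).trans e21)
    iterate 3
      try apply Wp.step
      first
      | apply Wp.plus
      | apply Wp.minus
      on_goal 1 => simp (disch := decide) only
        [Function.update_of_ne, Function.update_self, k0, k2, k4, k20, k21]; rfl
    refine ⟨?_, ?_, fun r hr => ?_, fun k hk i hi => ?_, fun i hi => ?_⟩
    all_goals simp (disch := omega) only [Function.update_of_ne, Function.update_self]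
    · omega
    · ring
    · rw [gr r (by omega), fr r (by omega), er r hr]
    · have h1 := row_lt hk hi
      have h2 : adC n = adU n + n * n := rfl
      rw [ga _ (by omega), if_neg (by omega), fa _ (by omega), eU k hk i hi]
    · rw [ga _ (by omega), if_pos (by omega), fa _ (by omega), eC i hi, Nat.add_sub_cancel_left,
        ones, ones, Finset.sum_range_succ]
  · rintro m1 ⟨e, -⟩
    omega
  · rintro m1 ⟨-, -, h⟩
    exact h

/-- Writes the diagonal entries, by majority. -/
def writeDiagonal : Prog :=
  block [.plus 20 0 3, .plus 21 7 3, .plus 22 8 3,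
    .loop 20 (block [.load 23 22, .plus 23 23 23, .minus 23 23 10, .ite 23 (.store 21 2) skip,
      .plus 21 21 0, .plus 21 21 2, .plus 22 22 2, .minus 20 20 2])]

theorem writeDiagonal_spec {X n G α β : ℕ} {m : Mem} {U : ℕ → ℕ → ℕ} {c : ℕ → ℕ}
    (hn : n ≤ X) (hm : Consts n G α β m) (hU : HoldsU m n U)
    (h0 : ∀ i < n, m (adC n + i) = c i) :
    Wp X 50 writeDiagonal m [] fun m' => SameRegs 20 m m' ∧
      HoldsU m' n fun k i => if k = i ∧ G < 2 * c i then 1 else U k i := by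
  have hb := base_le_adU n
  have hC : adC n = adU n + n * n := rfl
  iterate 3
    apply Wp.step
    apply Wp.plus
    on_goal 1 => simp (disch := decide) only [Function.update_of_ne, hm.c0, hm.c3, hm.c7, hm.c8]; rfl
  -- The stride n + 1 in cell `21` follows the diagonal of the matrix.
  refine (Wp.loopc (d := 40) (N := n) (fun s m' => m' 20 = n - s ∧ m' 21 = adU n + n * s + s ∧
    m' 22 = adC n + s ∧ SameRegs 20 m m' ∧ (∀ a, adC n ≤ a → m' a = m a) ∧
    HoldsU m' n fun k i => if k = i ∧ i < s ∧ G < 2 * c i then 1 else U k i)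
    hn ?_ ?_ ?_).mono (by norm_num) ?_
  · refine ⟨?_, ?_, ?_, fun r hr => ?_, fun a ha => ?_, fun k hk i hi => ?_⟩
    all_goals simp (disch := omega) only [Function.update_of_ne, Function.update_self]
    · rfl
    · rfl
    · rw [if_neg (by omega), hU k hk i hi]
  · rintro s hs m1 ⟨e20, e21, e22, er, ea, eU⟩
    refine ⟨by omega, ?_⟩
    have hm1 : Consts n G α β m1 := hm.of_eq fun r hr => er r (by omega)
    have hlt := row_lt hs hs
    apply Wp.step
    apply Wp.load (v := c s)
    · rw [e22, ea _ (by omega), h0 s hs]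
    apply Wp.step
    apply Wp.plus rfl
    apply Wp.step
    -- Nonzero exactly for a strict majority of ones.
    apply Wp.minus (v := c s + c s - G)
    · simp (disch := decide) only [Function.update_of_ne, Function.update_self, hm1.c10]
    refine Wp.call (d' := 10) (o1 := []) (o2 := []) (R1 := fun m' => SameRegs 23 m1 m' ∧
      (∀ a, adC n ≤ a → m' a = m a) ∧
      HoldsU m' n fun k i => if k = i ∧ i < s + 1 ∧ G < 2 * c i then 1 else U k i) ?_
      (by norm_num) rfl ?_
    · refine Wp.ite ?_ ?_
      · intro h
        rw [Function.update_self] at h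
        apply Wp.store (a := adU n + n * s + s) (v := 1)
        · simp (disch := decide) only [Function.update_of_ne, e21]
        · simp (disch := decide) only [Function.update_of_ne, hm1.c2]
        refine ⟨fun r hr => ?_, fun a ha => ?_, fun k hk i hi => ?_⟩
        · simp (disch := omega) only [Function.update_of_ne]
        · simp (disch := omega) only [Function.update_of_ne, ea]
        · by_cases hks : k = s
          · subst hks
            by_cases hik : i = k
            · subst hik
              rw [Function.update_self]
              beta_reduce
              rw [if_pos (by omega)]
            · simp (disch := omega) only [Function.update_of_ne]
              rw [eU k hk i hi]
              beta_reduce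
              rw [if_neg (by omega), if_neg (by omega)]
          · have hne : adU n + n * k + i ≠ adU n + n * s + s := by
              intro h
              rcases Nat.lt_or_gt_of_ne hks with h1 | h1
              · have := row_lt h1 hi
                omega
              · have := row_lt h1 hs
                omega
            simp (disch := omega) only [Function.update_of_ne]
            rw [eU k hk i hi]
            beta_reduce
            congr 1
            apply propext
            omega
      · intro h
        rw [Function.update_self] at h
        apply Wp.const
        refine ⟨fun r hr => ?_, fun a ha => ?_, fun k hk i hi => ?_⟩
        · simp (disch := omega) only [Function.update_of_ne]
        · simp (disch := omega) only [Function.update_of_ne, ea]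
        · simp (disch := omega) only [Function.update_of_ne]
          rw [eU k hk i hi]
          beta_reduce
          congr 1
          apply propext
          constructor
          · omega
          · rintro ⟨h1, h2, h3⟩
            have : i ≠ s := by
              rintro rfl
              omega
            omega
    rintro m2 ⟨fr, fa, fU⟩
    have k2 : m2 2 = 1 := (fr 2 (by norm_num)).trans hm1.c2
    have k0 : m2 0 = n := (fr 0 (by norm_num)).trans hm1.c0
    have k20 := (fr 20 (by norm_num)).trans e20
    have k21 := (fr 21 (by norm_num)).trans e21
    have k22 := (fr 22 (by norm_num)).trans e22
    iterate 4
      try apply Wp.step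
      first
      | apply Wp.plus
      | apply Wp.minus
      on_goal 1 => simp (disch := decide) only
        [Function.update_of_ne, Function.update_self, k0, k2, k20, k21, k22]; rfl
    refine ⟨?_, ?_, ?_, fun r hr => ?_, fun a ha => ?_, fun k hk i hi => ?_⟩
    all_goals simp (disch := omega) only [Function.update_of_ne, Function.update_self]
    · omega
    · ring
    · ring
    · rw [fr r (by omega), er r hr]
    · exact fa a ha
    · exact fU k hk i hi
  · rintro m1 ⟨e, -⟩
    omega
  · rintro m1 ⟨-, -, -, h1, -, h2⟩
    refine ⟨h1, fun k hk i hi => ?_⟩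
    rw [h2 k hk i hi]
    simp only [hi, true_and]

/-! ### The whole program -/

/-- The learning algorithm. -/
def learner (α β : ℕ) : Prog :=
  block [initConsts α β, sample, filter, offDiagonal, readThirds, writeDiagonal, .plus 0 7 3]

/-- The strictly upper triangular part, as computed from the samples. -/
def upperPart (n G α β : ℕ) (smp : ℕ → ℕ → ZMod 2) (k i : ℕ) : ℕ :=
  if k < i then (solvedRow n (pivots n G α β smp G) k i).val else 0

/-- The outcomes are still arbitrary except through `hfull`, which the computation of the
off-diagonal entries requires. -/
theorem learner_spec {X n M α β : ℕ} (y z d : ℕ → ℕ → ZMod 2) (hn : 2 * n ≤ X) (hM : M ≤ X)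
    (hfull : ∀ w, (red n (pivots n (M / 3) α β (fun g => joinV n (y g) (z g)) (M / 3), w)).1 =
      pivots n (M / 3) α β (fun g => joinV n (y g) (z g)) (M / 3)) :
    Wp X 100 (learner α β) (inputMem n M) (sampleOps n (M / 3) y z ++
      thirdsOps n (M / 3) (upperPart n (M / 3) α β fun g => joinV n (y g) (z g)) d) fun m' =>
        ∀ k < n, ∀ i < n, m' (m' 0 + n * k + i) = if k = i ∧ M / 3 < 2 * ones (M / 3) d i then 1
          else upperPart n (M / 3) α β (fun g => joinV n (y g) (z g)) k i := by
  have hG : M / 3 ≤ X := by omega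
  have hb := base_le_adU n
  have hC : adC n = adU n + n * n := rfl
  have hS : adS n 0 = adC n + n := rfl
  refine Wp.call (initConsts_spec α β (by omega) hM) (by norm_num) rfl ?_
  rintro m1 ⟨hm1, e1⟩
  refine Wp.call (sample_spec y z (by omega) hG hm1) (by norm_num) rfl ?_
  rintro m2 ⟨r2, e2, s2⟩
  have hm2 := hm1.of_eq fun r hr => r2 r (by omega)
  refine Wp.call (filter_spec (w := 0) hn hG hm2 (fun i hi => ?_) (fun c hc i hi => ?_) s2)
    (by norm_num) rfl ?_
  · rw [e2 _ (by omega) (by omega), e1 _ (by omega)]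
    rfl
  · have h1 := base_le_adT n c
    have h2 := adT_add_le_adU hc
    rw [e2 _ (by omega) (by omega), e1 _ (by omega)]
    rfl
  rintro m3 ⟨r3, e3, ⟨w, w3⟩, t3⟩
  have hm3 := hm2.of_eq fun r hr => r3 r (by omega)
  refine Wp.call (offDiagonal_spec hn hm3 w3 t3 hfull fun k hk i hi => ?_) (by norm_num) rfl ?_
  · have := row_lt hk hi
    rw [e3 _ (by omega), e2 _ (by omega) (by omega), e1 _ (by omega)]
  rintro m4 ⟨r4, e4, u4⟩
  have hm4 := hm3.of_eq fun r hr => r4 r (by omega)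
  refine Wp.call (o2 := []) (readThirds_spec d (by omega) hG hm4 u4 fun i hi => ?_) (by norm_num)
    (by simp; rfl) ?_
  · rw [e4 _ (by omega), e3 _ (by omega), e2 _ (by omega) (by omega), e1 _ (by omega)]
  rintro m5 ⟨r5, u5, c5⟩
  have hm5 := hm4.of_eq fun r hr => r5 r (by omega)
  refine Wp.call (writeDiagonal_spec (by omega) hm5 u5 c5) (by norm_num) rfl ?_
  rintro m6 ⟨r6, u6⟩
  have hm6 := hm5.of_eq fun r hr => r6 r (by omega)
  -- All subroutines read n from cell `0`; only the very last instruction turns it into the output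
  -- address.
  apply Wp.plus (v := adU n)
  · rw [hm6.c7, hm6.c3]
    rfl
  intro k hk i hi
  rw [Function.update_self, Function.update_of_ne (by omega)]
  exact u6 k hk i hi

end PhaseLearning

/-! ### The quantum side: gates and measurements on products of states. -/

namespace PhaseLearning

/-! ### Gates on registers that consist of several copies -/

noncomputable section

theorem onQubit_mulVec {Q : ℕ} (U : Matrix (ZMod 2) (ZMod 2) ℂ) (q : Fin Q) (φ : Bits Q → ℂ)
    (x : Bits Q) : (onQubit U q *ᵥ φ) x = ∑ b, U (x q) b * φ (Function.update x q b) := by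
  simp only [Matrix.mulVec, dotProduct, onQubit, Matrix.of_apply, ite_mul, zero_mul]
  rw [← Finset.sum_filter]
  refine Finset.sum_bij' (fun y _ => y q) (fun b _ => Function.update x q b) (fun _ _ => Finset.mem_univ _)
    (fun b _ => ?_) (fun y hy => ?_) (fun b _ => Function.update_self ..) (fun y hy => ?_)
  · rw [Finset.mem_filter]
    exact ⟨Finset.mem_univ _, fun p hp => (Function.update_of_ne hp _ _).symm⟩
  · rw [Finset.mem_filter] at hy
    funext p
    by_cases hp : p = q
    · subst hp
      rw [Function.update_self]
    · rw [Function.update_of_ne hp, hy.2 p hp]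
  · rw [Finset.mem_filter] at hy
    congr 2
    funext p
    by_cases hp : p = q
    · subst hp
      rw [Function.update_self]
    · rw [Function.update_of_ne hp, hy.2 p hp]

theorem cnot_mulVec {Q : ℕ} {c t : Fin Q} (h : c ≠ t) (φ : Bits Q → ℂ) (x : Bits Q) :
    (cnot c t *ᵥ φ) x = φ (Function.update x t (x t + x c)) := by
  simp only [Matrix.mulVec, dotProduct, cnot, Matrix.of_apply, ite_mul, zero_mul, one_mul]
  -- The gate is an involution, so the preimage of a basis string is also its image.
  have e : ∀ y : Bits Q, x = Function.update y t (y t + y c) ↔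
      Function.update x t (x t + x c) = y := by
    intro y
    constructor
    · rintro rfl
      rw [Function.update_self, Function.update_of_ne h, Function.update_idem, add_assoc,
        CharTwo.add_self_eq_zero, add_zero, Function.update_eq_self]
    · rintro rfl
      rw [Function.update_self, Function.update_of_ne h, Function.update_idem, add_assoc,
        CharTwo.add_self_eq_zero, add_zero, Function.update_eq_self]
  simp only [e, Finset.sum_ite_eq, Finset.mem_univ, if_true]

/-- The sign `(-1)^a`. -/
def chi (a : ZMod 2) : ℂ := (-1) ^ a.val

theorem chi_add (a b : ZMod 2) : chi (a + b) = chi a * chi b := by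
  have h : ∀ a : ZMod 2, a = 0 ∨ a = 1 := by decide
  rcases h a with rfl | rfl <;> rcases h b with rfl | rfl <;>
    simp [chi, ZMod.val_one, CharTwo.add_self_eq_zero]

@[simp] theorem chi_zero : chi 0 = 1 := by simp [chi]

@[simp] theorem chi_one : chi 1 = -1 := by simp [chi, ZMod.val_one]

theorem chi_mul_self (a : ZMod 2) : chi a * chi a = 1 := by
  rw [← chi_add, CharTwo.add_self_eq_zero, chi_zero]

theorem normSq_chi (a : ZMod 2) : Complex.normSq (chi a) = 1 := by
  have h : ∀ a : ZMod 2, a = 0 ∨ a = 1 := by decide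
  rcases h a with rfl | rfl <;> simp

theorem chi_sum {ι : Type} (s : Finset ι) (f : ι → ZMod 2) :
    chi (∑ i ∈ s, f i) = ∏ i ∈ s, chi (f i) := by
  classical
  induction s using Finset.induction_on with
  | empty => simp
  | insert a s ha ih => rw [Finset.sum_insert ha, Finset.prod_insert ha, chi_add, ih]

theorem gateH_apply (a b : ZMod 2) : gateH a b = chi (a * b) / ((Real.sqrt 2 : ℝ) : ℂ) := by
  have h : ∀ a b : ZMod 2, a.val * b.val = (a * b).val := by decide
  rw [gateH, Matrix.of_apply, h, chi]

variable {M n : ℕ}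

/-- A function of the contents of the copies, as a state of the register. -/
def up (Ψ : (Fin M → Bits n) → ℂ) : Bits (M * n) → ℂ :=
  fun x => Ψ fun k i => x (finProdFinEquiv (k, i))

/-- Replaces bit `i` of copy `k`. -/
def upd (X : Fin M → Bits n) (k : Fin M) (i : Fin n) (b : ZMod 2) : Fin M → Bits n :=
  Function.update X k (Function.update (X k) i b)

theorem up_update (Ψ : (Fin M → Bits n) → ℂ) (x : Bits (M * n)) (k : Fin M) (i : Fin n)
    (b : ZMod 2) : up Ψ (Function.update x (finProdFinEquiv (k, i)) b) =
      Ψ (upd (fun k i => x (finProdFinEquiv (k, i))) k i b) := by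
  unfold up upd
  congr 1
  funext l j
  by_cases hl : l = k
  · subst hl
    rw [Function.update_self]
    by_cases hj : j = i
    · subst hj
      simp only [Function.update_self]
    · rw [Function.update_of_ne hj, Function.update_of_ne]
      simpa using hj
  · rw [Function.update_of_ne hl, Function.update_of_ne]
    simp [hl]

theorem addr_eq (k : Fin M) (i : Fin n) : n * (k : ℕ) + i = (finProdFinEquiv (k, i) : ℕ) := by
  rw [finProdFinEquiv_apply_val, add_comm]

theorem act_H_up (Ψ : (Fin M → Bits n) → ℂ) (k : Fin M) (i : Fin n) :
    act (.H (n * k + i)) (up Ψ) =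
      up fun X => ∑ b, chi (X k i * b) / ((Real.sqrt 2 : ℝ) : ℂ) * Ψ (upd X k i b) := by
  rw [addr_eq]
  funext x
  simp only [act, Fin.is_lt, dite_true, Fin.eta, onQubit_mulVec, up_update, gateH_apply]
  rfl

theorem act_T_up (Ψ : (Fin M → Bits n) → ℂ) (k : Fin M) (i : Fin n) :
    act (.T (n * k + i)) (up Ψ) =
      up fun X => Complex.exp (Complex.I * (Real.pi : ℂ) / 4 * ((X k i).val : ℂ)) * Ψ X := by
  rw [addr_eq]
  funext x
  simp only [act, Fin.is_lt, dite_true, Fin.eta, onQubit_mulVec, gateT, Matrix.diagonal_apply,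
    ite_mul, zero_mul, Finset.sum_ite_eq, Finset.mem_univ, if_true, Function.update_eq_self]
  rfl

theorem act_C_up (Ψ : (Fin M → Bits n) → ℂ) (k l : Fin M) (i j : Fin n) (h : (k, i) ≠ (l, j)) :
    act (.C (n * k + i) (n * l + j)) (up Ψ) = up fun X => Ψ (upd X l j (X l j + X k i)) := by
  rw [addr_eq, addr_eq]
  funext x
  have h1 : finProdFinEquiv (k, i) ≠ finProdFinEquiv (l, j) := fun e => h (finProdFinEquiv.injective e)
  have h2 : (finProdFinEquiv (k, i) : ℕ) ≠ (finProdFinEquiv (l, j) : ℕ) := fun e => h1 (Fin.ext e)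
  simp only [act]
  rw [dif_pos ⟨Fin.is_lt _, Fin.is_lt _, h2⟩]
  simp only [Fin.eta]
  rw [cnot_mulVec h1, up_update]
  rfl

theorem act_P_up (Ψ : (Fin M → Bits n) → ℂ) (k : Fin M) (i : Fin n) (b : ZMod 2) :
    act (.P (n * k + i) b) (up Ψ) = up fun X => if X k i = b then Ψ X else 0 := by
  rw [addr_eq]
  funext x
  simp only [act, Fin.is_lt, dite_true, Fin.eta, onQubit_mulVec, proj, Matrix.diagonal_apply,
    ite_mul, zero_mul, one_mul, Finset.sum_ite_eq, Finset.mem_univ, if_true,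
    Function.update_eq_self]
  rfl

theorem nrm_up (Ψ : (Fin M → Bits n) → ℂ) : nrm (up Ψ) = ∑ X, Complex.normSq (Ψ X) := by
  unfold nrm up
  let e : Bits (M * n) ≃ (Fin M → Bits n) :=
    (Equiv.arrowCongr finProdFinEquiv.symm (Equiv.refl _)).trans (Equiv.curry _ _ _)
  exact Fintype.sum_equiv e _ _ fun x => rfl

/-! ### Product states -/

/-- The product of the states `F k` of the copies. -/
def prodState (F : Fin M → Bits n → ℂ) : Bits (M * n) → ℂ := up fun X => ∏ k, F k (X k)

theorem nrm_prodState (F : Fin M → Bits n → ℂ) :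
    nrm (prodState F) = ∏ k, ∑ u, Complex.normSq (F k u) := by
  unfold prodState
  rw [nrm_up, Finset.prod_univ_sum, Fintype.piFinset_univ]
  exact Finset.sum_congr rfl fun X _ => map_prod Complex.normSq _ _

theorem prod_update_left (F : Fin M → Bits n → ℂ) (k : Fin M) (g : Bits n → ℂ)
    (X : Fin M → Bits n) : ∏ j, (Function.update F k g) j (X j) =
      g (X k) * ∏ j ∈ Finset.univ \ {k}, F j (X j) := by
  rw [← Finset.prod_update_of_mem (Finset.mem_univ k) (fun j => F j (X j))]
  refine Finset.prod_congr rfl fun j _ => ?_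
  by_cases h : j = k
  · subst h
    simp only [Function.update_self]
  · simp only [Function.update_of_ne h]

theorem prod_update_right (F : Fin M → Bits n → ℂ) (k : Fin M) (u : Bits n)
    (X : Fin M → Bits n) : ∏ j, F j (Function.update X k u j) =
      F k u * ∏ j ∈ Finset.univ \ {k}, F j (X j) := by
  rw [← Finset.prod_update_of_mem (Finset.mem_univ k) (fun j => F j (X j))]
  refine Finset.prod_congr rfl fun j _ => ?_
  by_cases h : j = k
  · subst h
    simp only [Function.update_self]
  · simp only [Function.update_of_ne h]

/-- The first `n` bits of a sequence. -/
def firstBits (n : ℕ) (y : ℕ → ZMod 2) : Bits n := fun i => y i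

/-- A basis vector. -/
def ket (v : Bits n) : Bits n → ℂ := fun u => if u = v then 1 else 0

theorem flatMap_range_succ {α : Type} (f : ℕ → List α) (s : ℕ) :
    (List.range (s + 1)).flatMap f = (List.range s).flatMap f ++ f s := by
  rw [List.range_succ, List.flatMap_append]
  simp

/-- Round s touches only qubit s of the target copy, and its control in copy k is never altered.
Pulling the state back through the gates replaces the treated bits of the target by their sums with
the control bits. -/
theorem acts_cnot_measure (Ψ : (Fin M → Bits n) → ℂ) {k l : Fin M} (hkl : k ≠ l)
    (y : ℕ → ZMod 2) (s : ℕ) (hs : s ≤ n) :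
    acts ((List.range s).flatMap fun i => [.C (n * k + i) (n * l + i), .P (n * l + i) (y i)])
      (up Ψ) = up fun X => if ∀ i : Fin n, (i : ℕ) < s → X l i = y i then
        Ψ (Function.update X l fun i => if (i : ℕ) < s then X l i + X k i else X l i) else 0 := by
  induction s with
  | zero => simp
  | succ s ih =>
    rw [flatMap_range_succ, acts_append, ih (by omega)]
    simp only [acts_cons, acts_nil]
    have e1 := fun Φ => act_C_up (M := M) (n := n) Φ k l ⟨s, hs⟩ ⟨s, hs⟩ (by simp [hkl])
    have e2 := fun Φ => act_P_up (M := M) (n := n) Φ l ⟨s, hs⟩ (y s)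
    simp only at e1 e2
    rw [e1, e2]
    congr 1
    funext X
    have hk : ∀ b, upd X l ⟨s, hs⟩ b k = X k := fun b => by
      rw [upd, Function.update_of_ne hkl]
    have hl : ∀ (b) (i : Fin n), (i : ℕ) < s → upd X l ⟨s, hs⟩ b l i = X l i := fun b i hi => by
      rw [upd, Function.update_self, Function.update_of_ne]
      intro h
      rw [h] at hi
      exact lt_irrefl _ hi
    have hc : (X l ⟨s, hs⟩ = y s ∧ ∀ i : Fin n, (i : ℕ) < s → X l i = y i) ↔
        ∀ i : Fin n, (i : ℕ) < s + 1 → X l i = y i := by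
      constructor
      · rintro ⟨h1, h2⟩ i hi
        rcases Nat.lt_succ_iff_lt_or_eq.1 hi with h | h
        · exact h2 i h
        · obtain rfl : i = ⟨s, hs⟩ := Fin.ext h
          exact h1
      · intro h
        exact ⟨h _ (Nat.lt_succ_self s), fun i hi => h i (by omega)⟩
    simp only [← hc, ite_and]
    by_cases h1 : X l ⟨s, hs⟩ = y s
    · rw [if_pos h1, if_pos h1]
      have hc2 : (∀ i : Fin n, (i : ℕ) < s →
          upd X l ⟨s, hs⟩ (X l ⟨s, hs⟩ + X k ⟨s, hs⟩) l i = y i) ↔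
          ∀ i : Fin n, (i : ℕ) < s → X l i = y i :=
        forall₂_congr fun i hi => by rw [hl _ i hi]
      simp only [hc2]
      refine if_congr Iff.rfl (congrArg Ψ ?_) rfl
      rw [upd, Function.update_idem]
      congr 1
      funext i
      rw [Function.update_of_ne hkl, Function.update_self]
      rcases Nat.lt_trichotomy (i : ℕ) s with h | h | h
      · rw [if_pos h, if_pos (by omega), Function.update_of_ne]
        rintro rfl
        exact lt_irrefl _ h
      · obtain rfl : i = ⟨s, hs⟩ := Fin.ext h
        rw [if_neg (lt_irrefl _), if_pos (Nat.lt_succ_self s), Function.update_self]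
      · rw [if_neg (by omega), if_neg (by omega), Function.update_of_ne]
        rintro rfl
        exact lt_irrefl _ h
    · rw [if_neg h1, if_neg h1]

/-- Each qubit of copy k carries a separate sign character, that is, the Hadamard image of a basis
state. The Hadamard gate restores this basis state, so the outcome is certain and no norm is lost.
The power of √2 corrects the amplitude, and `hR` says that R ignores copy k. -/
theorem acts_read (R : (Fin M → Bits n) → ℂ) (k : Fin M) (hR : ∀ X u, R (Function.update X k u) = R X)
    (z : ℕ → ZMod 2) (s : ℕ) (hs : s ≤ n) :
    acts ((List.range s).flatMap fun i => [.H (n * k + i), .P (n * k + i) (z i)])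
      (up fun X => (∏ i : Fin n, chi (z i * X k i)) * R X) =
      up fun X => if ∀ i : Fin n, (i : ℕ) < s → X k i = z i then
        ((Real.sqrt 2 : ℝ) : ℂ) ^ s * (∏ i : Fin n, if (i : ℕ) < s then 1 else chi (z i * X k i)) *
          R X else 0 := by
  induction s with
  | zero => simp
  | succ s ih =>
    rw [flatMap_range_succ, acts_append, ih (by omega)]
    simp only [acts_cons, acts_nil]
    have e1 := fun Φ => act_H_up (M := M) (n := n) Φ k ⟨s, hs⟩
    have e2 := fun Φ => act_P_up (M := M) (n := n) Φ k ⟨s, hs⟩ (z s)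
    simp only at e1 e2
    rw [e1, e2]
    congr 1
    funext X
    have hl : ∀ (b) (i : Fin n), (i : ℕ) ≠ s → upd X k ⟨s, hs⟩ b k i = X k i := fun b i hi => by
      rw [upd, Function.update_self, Function.update_of_ne]
      intro h
      rw [h] at hi
      exact hi rfl
    have hs' : ∀ b, upd X k ⟨s, hs⟩ b k ⟨s, hs⟩ = b := fun b => by
      rw [upd, Function.update_self, Function.update_self]
    have hc : (X k ⟨s, hs⟩ = z s ∧ ∀ i : Fin n, (i : ℕ) < s → X k i = z i) ↔
        ∀ i : Fin n, (i : ℕ) < s + 1 → X k i = z i := by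
      constructor
      · rintro ⟨h1, h2⟩ i hi
        rcases Nat.lt_succ_iff_lt_or_eq.1 hi with h | h
        · exact h2 i h
        · obtain rfl : i = ⟨s, hs⟩ := Fin.ext h
          exact h1
      · intro h
        exact ⟨h _ (Nat.lt_succ_self s), fun i hi => h i (by omega)⟩
    simp only [← hc, ite_and]
    by_cases h1 : X k ⟨s, hs⟩ = z s
    · rw [if_pos h1, if_pos h1]
      have hc2 : ∀ b, (∀ i : Fin n, (i : ℕ) < s → upd X k ⟨s, hs⟩ b k i = z i) ↔
          ∀ i : Fin n, (i : ℕ) < s → X k i = z i :=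
        fun b => forall₂_congr fun i hi => by rw [hl _ i (by omega)]
      simp only [hc2]
      by_cases h2 : ∀ i : Fin n, (i : ℕ) < s → X k i = z i
      · simp only [if_pos h2]
        have hp : ∀ b, (∏ i : Fin n, if (i : ℕ) < s then 1 else
            chi (z i * upd X k ⟨s, hs⟩ b k i)) = chi (z s * b) *
              ∏ i : Fin n, if (i : ℕ) < s + 1 then 1 else chi (z i * X k i) := by
          intro b
          rw [← Finset.mul_prod_erase _ _ (Finset.mem_univ (⟨s, hs⟩ : Fin n)),
            ← Finset.mul_prod_erase (a := (⟨s, hs⟩ : Fin n)) _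
              (fun i : Fin n => if (i : ℕ) < s + 1 then 1 else chi (z i * X k i)) (Finset.mem_univ _)]
          simp only [lt_irrefl, if_false, lt_add_one, if_true, one_mul, hs']
          congr 1
          refine Finset.prod_congr rfl fun i hi => ?_
          have hne : (i : ℕ) ≠ s := fun h => Finset.ne_of_mem_erase hi (Fin.ext h)
          rw [hl b i hne]
          exact if_congr (by omega) rfl rfl
        have hR' : ∀ b, R (upd X k ⟨s, hs⟩ b) = R X := fun b => hR X _
        simp only [hp, hR', h1]
        have h2ne : ((Real.sqrt 2 : ℝ) : ℂ) ≠ 0 := by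
          rw [Ne, Complex.ofReal_eq_zero]
          positivity
        have hsq : ((Real.sqrt 2 : ℝ) : ℂ) * ((Real.sqrt 2 : ℝ) : ℂ) = 2 := by
          rw [← Complex.ofReal_mul, Real.mul_self_sqrt (by norm_num)]
          norm_num
        -- Constructive interference: the sign in the state and the sign of the Hadamard gate
        -- coincide and square to one, so both summands are equal.
        have hterm : ∀ (b : ZMod 2) (p r : ℂ), chi (z s * b) / ((Real.sqrt 2 : ℝ) : ℂ) *
            (((Real.sqrt 2 : ℝ) : ℂ) ^ s * (chi (z s * b) * p) * r) =
            ((Real.sqrt 2 : ℝ) : ℂ) ^ s / ((Real.sqrt 2 : ℝ) : ℂ) * p * r := by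
          intro b p r
          linear_combination (((Real.sqrt 2 : ℝ) : ℂ) ^ s / ((Real.sqrt 2 : ℝ) : ℂ) * p * r) *
            chi_mul_self (z s * b)
        simp only [hterm, Finset.sum_const, Finset.card_univ, ZMod.card, nsmul_eq_mul]
        field_simp
        rw [show ((2 : ℕ) : ℂ) = 2 by norm_num, ← hsq]
        ring
      · simp only [if_neg h2, mul_zero, Finset.sum_const_zero]
    · rw [if_neg h1, if_neg h1]

/-- The result is again a product: the measured copy becomes a basis state, and the amplitudes of
the other copy are multiplied by shifted amplitudes of the measured one. -/
theorem acts_bell_prodState (F : Fin M → Bits n → ℂ) {k l : Fin M} (hkl : k ≠ l) (y : ℕ → ZMod 2) :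
    acts ((List.range n).flatMap fun i => [.C (n * k + i) (n * l + i), .P (n * l + i) (y i)])
      (prodState F) = prodState (Function.update (Function.update F k fun u =>
        F k u * F l (firstBits n y + u)) l (ket (firstBits n y))) := by
  unfold prodState
  rw [acts_cnot_measure _ hkl y n le_rfl]
  congr 1
  funext X
  have hc : (∀ i : Fin n, (i : ℕ) < n → X l i = y i) ↔ X l = firstBits n y := by
    rw [funext_iff]
    exact forall_congr' fun i => by simp [firstBits]
  rw [prod_update_left, prod_update_right, ket]
  simp only [hc]
  simp only [Fin.is_lt, if_true]
  by_cases h : X l = firstBits n y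
  · rw [if_pos h, if_pos h, one_mul]
    have hk : k ∈ Finset.univ \ {l} := by simp [hkl]
    rw [← Finset.mul_prod_erase _ _ hk, ← Finset.mul_prod_erase _ (fun j => Function.update F k _ j (X j)) hk,
      Function.update_self]
    have : (fun i => X l i + X k i) = firstBits n y + X k := by rw [h]; rfl
    rw [this, ← mul_assoc, mul_comm (F l _)]
    congr 1
    refine Finset.prod_congr rfl fun j hj => ?_
    rw [Function.update_of_ne (Finset.ne_of_mem_erase hj)]
  · rw [if_neg h, if_neg h, zero_mul]

theorem acts_read_prodState (F : Fin M → Bits n → ℂ) (k : Fin M) (z : ℕ → ZMod 2) (c : ℂ)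
    (hF : ∀ u, F k u = c * chi (∑ i : Fin n, z i * u i)) :
    acts (readOps n (n * k) z) (prodState F) =
      prodState (Function.update F k fun u => c * ((Real.sqrt 2 : ℝ) : ℂ) ^ n * ket (firstBits n z) u) := by
  unfold prodState readOps
  have e : (fun X : Fin M → Bits n => ∏ j, F j (X j)) = fun X =>
      (∏ i : Fin n, chi (z i * X k i)) * (c * ∏ j ∈ Finset.univ \ {k}, F j (X j)) := by
    funext X
    rw [← Finset.mul_prod_erase _ _ (Finset.mem_univ k), hF, chi_sum, Finset.sdiff_singleton_eq_erase]
    ring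
  rw [e, acts_read _ k _ z n le_rfl]
  · congr 1
    funext X
    have hc : (∀ i : Fin n, (i : ℕ) < n → X k i = z i) ↔ X k = firstBits n z := by
      rw [funext_iff]
      exact forall_congr' fun i => by simp [firstBits]
    rw [prod_update_left, ket]
    simp only [hc]
    simp only [Fin.is_lt, if_true, Finset.prod_const_one]
    split_ifs <;> ring
  · intro X u
    congr 1
    refine Finset.prod_congr rfl fun j hj => ?_
    rw [Function.update_of_ne]
    simpa using hj

/-- Two T gates multiply by a power of i. For bits a, c with parity p the circuit gives the factor
i^(a + c + 3p) = i^(a + c - p), and a + c - p = 2ac, so the factor is (-1)^(ac). -/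
theorem acts_cz_up (Ψ : (Fin M → Bits n) → ℂ) (k : Fin M) {i j : Fin n} (hij : i ≠ j) :
    acts (czOps (n * k + i) (n * k + j)) (up Ψ) = up fun X => chi (X k i * X k j) * Ψ X := by
  simp only [czOps, acts_cons, acts_nil, act_T_up, act_C_up _ k k i j (by simp [hij])]
  congr 1
  funext X
  have hi : ∀ b, upd X k j b k i = X k i := fun b => by
    rw [upd, Function.update_self, Function.update_of_ne hij]
  have hj : ∀ b, upd X k j b k j = b := fun b => by
    rw [upd, Function.update_self, Function.update_self]
  have hu : ∀ b c, upd (upd X k j b) k j c = upd X k j c := fun b c => by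
    simp only [upd, Function.update_self, Function.update_idem]
  have hx : upd X k j (X k j) = X := by
    simp only [upd, Function.update_eq_self]
  simp only [hi, hj, hu, add_assoc, CharTwo.add_self_eq_zero, add_zero, hx]
  have h : ∀ a : ZMod 2, a = 0 ∨ a = 1 := by decide
  have hw : Complex.exp (Complex.I * (Real.pi : ℂ) / 4) ^ 4 = -1 := by
    rw [← Complex.exp_nat_mul, ← Complex.exp_pi_mul_I]
    congr 1
    push_cast
    ring
  generalize Ψ X = r
  rcases h (X k i) with ha | ha <;> rcases h (X k j) with hb | hb <;> rw [ha, hb]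
  all_goals simp only [CharTwo.add_self_eq_zero, add_zero, zero_add, ZMod.val_zero, ZMod.val_one,
    Nat.cast_zero, Nat.cast_one, mul_zero, mul_one, zero_mul, one_mul, Complex.exp_zero, chi_zero,
    chi_one]
  all_goals generalize Complex.exp (Complex.I * (Real.pi : ℂ) / 4) = w at hw
  -- With exactly one bit set the phase is w ^ 8 = 1; with both set it is w ^ 4 = -1.
  · linear_combination ((w ^ 4 - 1) * r) * hw
  · linear_combination ((w ^ 4 - 1) * r) * hw
  · linear_combination r * hw

end
end PhaseLearning

/-! ### Phase circuits, and the norm that survives outcomes consistent with the phases. -/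

namespace PhaseLearning

noncomputable section

variable {M n : ℕ}

/-- A bit string as a sequence that ends with zeros. -/
def ext (v : Bits n) : ℕ → ZMod 2 := fun i => if h : i < n then v ⟨i, h⟩ else 0

theorem ext_coe (v : Bits n) (i : Fin n) : ext v i = v i := by
  unfold ext
  rw [dif_pos i.2]

theorem firstBits_ext (v : Bits n) : firstBits n (ext v) = v := funext fun i => ext_coe v i

theorem acts_flatMap_sign (o : ℕ → List QOp) (h : ℕ → (Fin M → Bits n) → ZMod 2) (s : ℕ)
    (hs : ∀ i < s, ∀ Ψ : (Fin M → Bits n) → ℂ, acts (o i) (up Ψ) = up fun X => chi (h i X) * Ψ X)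
    (Ψ : (Fin M → Bits n) → ℂ) : acts ((List.range s).flatMap o) (up Ψ) =
      up fun X => chi (∑ i ∈ Finset.range s, h i X) * Ψ X := by
  induction s with
  | zero => simp
  | succ s ih =>
    rw [flatMap_range_succ, acts_append, ih fun i hi => hs i (by omega), hs s (by omega)]
    congr 1
    funext X
    rw [Finset.sum_range_succ, chi_add]
    ring

/-- The quadratic form of a matrix with zero diagonal. -/
def pairForm (n : ℕ) (U : ℕ → ℕ → ℕ) (u : ℕ → ZMod 2) : ZMod 2 :=
  ∑ i ∈ Finset.range n, ∑ j ∈ Finset.range n, if U i j ≠ 0 then u i * u j else 0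

/-- Signs of diagonal gates multiply, so their exponents add up to the quadratic form. `hU` excludes
the pairs i = j, for which control and target of the CNOT would coincide. -/
theorem acts_phaseOps (U : ℕ → ℕ → ℕ) (hU : ∀ i, U i i = 0) (k : Fin M)
    (Ψ : (Fin M → Bits n) → ℂ) : acts (phaseOps n U (n * k)) (up Ψ) =
      up fun X => chi (pairForm n U (ext (X k))) * Ψ X := by
  refine acts_flatMap_sign _ (fun i X => ∑ j ∈ Finset.range n,
    if U i j ≠ 0 then ext (X k) i * ext (X k) j else 0) n (fun i hi Ψ => ?_) Ψ
  refine acts_flatMap_sign _ (fun j X =>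
    if U i j ≠ 0 then ext (X k) i * ext (X k) j else 0) n (fun j hj Ψ => ?_) Ψ
  by_cases h : U i j ≠ 0
  · simp only [if_pos h]
    have hij : (⟨i, hi⟩ : Fin n) ≠ ⟨j, hj⟩ := by
      intro e
      rw [Fin.mk.injEq] at e
      subst e
      exact h (hU i)
    rw [acts_cz_up Ψ k hij]
    congr 1
    funext X
    rw [ext_coe (X k) ⟨i, hi⟩, ext_coe (X k) ⟨j, hj⟩]
  · simp only [if_neg h, acts_nil, chi_zero, one_mul]

/-- The amplitude of a phase state. -/
def amp (n : ℕ) : ℂ := 1 / ((Real.sqrt (2 ^ n) : ℝ) : ℂ)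

theorem normSq_amp (n : ℕ) : Complex.normSq (amp n) = (2 ^ n)⁻¹ := by
  rw [amp, map_div₀, Complex.normSq_ofReal, Real.mul_self_sqrt (by positivity), map_one, one_div]

theorem normSq_sqrt_two_pow (n : ℕ) :
    Complex.normSq (((Real.sqrt 2 : ℝ) : ℂ) ^ n) = 2 ^ n := by
  rw [map_pow, Complex.normSq_ofReal, Real.mul_self_sqrt (by norm_num)]

theorem sum_normSq_ket (c : ℂ) (v : Bits n) :
    ∑ u, Complex.normSq (c * ket v u) = Complex.normSq c := by
  simp only [ket, mul_ite, mul_one, mul_zero, apply_ite Complex.normSq, map_zero,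
    Finset.sum_ite_eq', Finset.mem_univ, if_true]

theorem sum_normSq_phase (q : Bits n → ZMod 2) :
    ∑ u, Complex.normSq (amp n * chi (q u)) = 1 := by
  simp only [Complex.normSq_mul, normSq_amp, normSq_chi, mul_one, Finset.sum_const,
    Finset.card_univ, Fintype.card_pi, ZMod.card, Finset.prod_const, Fintype.card_fin, nsmul_eq_mul]
  push_cast
  exact mul_inv_cancel₀ (by positivity)

/-- The product of the phase states with phases `q k`. -/
def phaseProd (q : Fin M → Bits n → ZMod 2) : Fin M → Bits n → ℂ := fun k u => amp n * chi (q k u)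

/-- By `hz`, once y is fixed the phase left on the first copy is affine with slope z, so z is read
with certainty. The only loss of norm is the factor 2⁻ⁿ per group for the uniform y. The third
copies stay intact for the diagonal. -/
theorem sampleOps_state (q : Fin M → Bits n → ZMod 2) (G : ℕ) (hG : 3 * G ≤ M)
    (y z : ℕ → ℕ → ZMod 2)
    (hz : ∀ g < G, ∀ k l : Fin M, (k : ℕ) = 3 * g → (l : ℕ) = 3 * g + 1 → ∃ c, ∀ u,
      q k u + q l (firstBits n (y g) + u) = c + ∑ i : Fin n, z g i * u i) :
    ∃ F, acts (sampleOps n G y z) (prodState (phaseProd q)) = prodState F ∧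
      (∀ k : Fin M, (3 * G ≤ k ∨ (k : ℕ) % 3 = 2) → F k = phaseProd q k) ∧
      ∀ k : Fin M, ∑ u, Complex.normSq (F k u) =
        if (k : ℕ) < 3 * G ∧ (k : ℕ) % 3 = 0 then (2 ^ n)⁻¹ else 1 := by
  induction G with
  | zero =>
    refine ⟨_, rfl, fun _ _ => rfl, fun k => ?_⟩
    rw [if_neg (by omega)]
    exact sum_normSq_phase _
  | succ G ih =>
    obtain ⟨F, hF, hF0, hFn⟩ := ih (by omega) fun g hg => hz g (by omega)
    obtain ⟨k, hk⟩ : ∃ k : Fin M, (k : ℕ) = 3 * G := ⟨⟨3 * G, by omega⟩, rfl⟩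
    obtain ⟨l, hl⟩ : ∃ l : Fin M, (l : ℕ) = 3 * G + 1 := ⟨⟨3 * G + 1, by omega⟩, rfl⟩
    have hkl : k ≠ l := fun h => by rw [h, hl] at hk; omega
    obtain ⟨c, hc⟩ := hz G (by omega) k l hk hl
    have hso : sampleOps n (G + 1) y z = sampleOps n G y z ++
        bellOps n (n * (3 * G)) (n * (3 * G + 1)) (y G) (z G) := flatMap_range_succ _ _
    rw [hso, acts_append, hF, bellOps, acts_append, ← hl, ← hk, acts_bell_prodState F hkl,
      acts_read_prodState _ k (z G) (amp n * amp n * chi c)]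
    · refine ⟨_, rfl, fun j hj => ?_, fun j => ?_⟩
      · rw [Function.update_of_ne, Function.update_of_ne, Function.update_of_ne]
        · exact hF0 j (by omega)
        all_goals
          rintro rfl
          omega
      · by_cases hjk : j = k
        · subst hjk
          rw [Function.update_self, if_pos (by omega), sum_normSq_ket, map_mul, map_mul, map_mul,
            normSq_amp, normSq_chi, normSq_sqrt_two_pow]
          field_simp
        · rw [Function.update_of_ne hjk]
          by_cases hjl : j = l
          · subst hjl
            rw [Function.update_self, if_neg (by omega)]
            have := sum_normSq_ket 1 (firstBits n (y G))
            simpa only [one_mul, map_one] using this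
          · have h1 : (j : ℕ) ≠ 3 * G := fun h => hjk (Fin.ext (h.trans hk.symm))
            have h2 : (j : ℕ) ≠ 3 * G + 1 := fun h => hjl (Fin.ext (h.trans hl.symm))
            rw [Function.update_of_ne hjl, Function.update_of_ne hjk, hFn j]
            exact if_congr (by omega) rfl rfl
    · intro u
      rw [Function.update_of_ne hkl, Function.update_self, hF0 k (by omega), hF0 l (by omega),
        phaseProd, phaseProd, mul_assoc (amp n * amp n), ← chi_add, ← hc, chi_add]
      ring

/-- By `hd`, the phase flips leave an affine phase with slope d on each third copy, so its reading
is deterministic and keeps the norm. -/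
theorem thirdsOps_state (q : Fin M → Bits n → ZMod 2) (G : ℕ) (hG : 3 * G ≤ M)
    (U : ℕ → ℕ → ℕ) (hU : ∀ i, U i i = 0) (d : ℕ → ℕ → ZMod 2)
    (hd : ∀ g < G, ∀ k : Fin M, (k : ℕ) = 3 * g + 2 → ∃ c, ∀ u,
      pairForm n U (ext u) + q k u = c + ∑ i : Fin n, d g i * u i)
    (F : Fin M → Bits n → ℂ)
    (hF : ∀ k : Fin M, (k : ℕ) % 3 = 2 → F k = phaseProd q k) :
    ∃ F', acts (thirdsOps n G U d) (prodState F) = prodState F' ∧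
      (∀ k : Fin M, (3 * G ≤ k ∨ (k : ℕ) % 3 ≠ 2) → F' k = F k) ∧
      ∀ k : Fin M, (k : ℕ) < 3 * G → (k : ℕ) % 3 = 2 → ∑ u, Complex.normSq (F' k u) = 1 := by
  induction G with
  | zero => exact ⟨F, rfl, fun _ _ => rfl, fun k hk => by omega⟩
  | succ G ih =>
    obtain ⟨F', hF', hF0, hFn⟩ := ih (by omega) fun g hg => hd g (by omega)
    obtain ⟨k, hk⟩ : ∃ k : Fin M, (k : ℕ) = 3 * G + 2 := ⟨⟨3 * G + 2, by omega⟩, rfl⟩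
    obtain ⟨c, hc⟩ := hd G (by omega) k hk
    have hto : thirdsOps n (G + 1) U d = thirdsOps n G U d ++
        (phaseOps n U (n * (3 * G + 2)) ++ readOps n (n * (3 * G + 2)) (d G)) :=
      flatMap_range_succ _ _
    have hph : acts (phaseOps n U (n * k)) (prodState F') =
        prodState (Function.update F' k fun u => chi (pairForm n U (ext u)) * F' k u) := by
      unfold prodState
      rw [acts_phaseOps U hU]
      congr 1
      funext X
      rw [prod_update_left, ← Finset.mul_prod_erase _ _ (Finset.mem_univ k),
        Finset.sdiff_singleton_eq_erase, mul_assoc]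
    rw [hto, acts_append, hF', acts_append, ← hk, hph,
      acts_read_prodState _ k (d G) (amp n * chi c)]
    · refine ⟨_, rfl, fun j hj => ?_, fun j hj hj3 => ?_⟩
      · rw [Function.update_of_ne, Function.update_of_ne]
        · exact hF0 j (by omega)
        all_goals
          rintro rfl
          omega
      · by_cases hjk : j = k
        · subst hjk
          rw [Function.update_self, sum_normSq_ket, map_mul, map_mul,
            normSq_amp, normSq_chi, normSq_sqrt_two_pow]
          field_simp
        · have h1 : (j : ℕ) ≠ 3 * G + 2 := fun h => hjk (Fin.ext (h.trans hk.symm))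
          rw [Function.update_of_ne hjk, Function.update_of_ne hjk]
          exact hFn j (by omega) hj3
    · intro u
      rw [Function.update_self, hF0 k (by omega), hF k (by omega), phaseProd, mul_assoc (amp n),
        ← chi_add, ← hc, chi_add]
      ring

theorem prod_thirds (c : ℝ) (G r : ℕ) :
    ∏ k ∈ Finset.range (3 * G + r), (if k < 3 * G ∧ k % 3 = 0 then c else 1) = c ^ G := by
  rw [Finset.prod_range_add]
  have h1 : ∏ k ∈ Finset.range r,
      (if 3 * G + k < 3 * G ∧ (3 * G + k) % 3 = 0 then c else 1) = 1 :=
    Finset.prod_eq_one fun k _ => if_neg (by omega)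
  rw [h1, mul_one]
  have h2 : ∏ k ∈ Finset.range (3 * G), (if k < 3 * G ∧ k % 3 = 0 then c else 1) =
      ∏ k ∈ Finset.range (3 * G), (if k % 3 = 0 then c else 1) :=
    Finset.prod_congr rfl fun k hk => if_congr (by simp [Finset.mem_range.1 hk]) rfl rfl
  rw [h2]
  induction G with
  | zero => simp
  | succ G ih =>
    have h3 : ∏ k ∈ Finset.range (3 * G), (if k % 3 = 0 then c else 1) = c ^ G := by
      refine ih (Finset.prod_eq_one fun k _ => if_neg (by omega))
        (Finset.prod_congr rfl fun k hk => if_congr (by simp [Finset.mem_range.1 hk]) rfl rfl)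
    rw [show 3 * (G + 1) = 3 * G + 1 + 1 + 1 by ring, Finset.prod_range_succ, Finset.prod_range_succ,
      Finset.prod_range_succ, h3, if_pos (by omega), if_neg (by omega), if_neg (by omega), pow_succ]
    ring

/-- The norm that remains after all measurements whose outcomes fit the phases. -/
theorem nrm_final (q : Fin M → Bits n → ZMod 2) (U : ℕ → ℕ → ℕ) (hU : ∀ i, U i i = 0)
    (y z d : ℕ → ℕ → ZMod 2)
    (hz : ∀ g < M / 3, ∀ k l : Fin M, (k : ℕ) = 3 * g → (l : ℕ) = 3 * g + 1 → ∃ c, ∀ u,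
      q k u + q l (firstBits n (y g) + u) = c + ∑ i : Fin n, z g i * u i)
    (hd : ∀ g < M / 3, ∀ k : Fin M, (k : ℕ) = 3 * g + 2 → ∃ c, ∀ u,
      pairForm n U (ext u) + q k u = c + ∑ i : Fin n, d g i * u i) :
    nrm (acts (sampleOps n (M / 3) y z ++ thirdsOps n (M / 3) U d) (prodState (phaseProd q))) =
      ((2 ^ n)⁻¹) ^ (M / 3) := by
  obtain ⟨F, hF, hF0, hFn⟩ := sampleOps_state q (M / 3) (by omega) y z hz
  obtain ⟨F', hF', hF'0, hF'n⟩ := thirdsOps_state q (M / 3) (by omega) U hU d hd F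
    fun k hk => hF0 k (Or.inr hk)
  rw [acts_append, hF, hF', nrm_prodState, ← prod_thirds _ (M / 3) (M % 3),
    show 3 * (M / 3) + M % 3 = M by omega, Finset.prod_range]
  refine Finset.prod_congr rfl fun k _ => ?_
  by_cases h : (k : ℕ) < 3 * (M / 3) ∧ (k : ℕ) % 3 = 2
  · rw [hF'n k h.1 h.2, if_neg (by omega)]
  · rw [hF'0 k (by omega), hFn k]

end
end PhaseLearning

/-! ### Linear algebra over 𝔽₂: recovering the matrix from noisy points of its graph. -/

namespace PhaseLearning

/-! ### Correctness of the elimination -/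

/-- The vector of `2 n` bits lies on the graph of the matrix `B`. -/
def OnGraph (n : ℕ) (B : ℕ → ℕ → ZMod 2) (w : ℕ → ZMod 2) : Prop :=
  ∀ i < n, w (n + i) = ∑ j ∈ Finset.range n, B i j * w j

theorem OnGraph.add {n : ℕ} {B : ℕ → ℕ → ZMod 2} {v w : ℕ → ZMod 2} (hv : OnGraph n B v)
    (hw : OnGraph n B w) : OnGraph n B (v + w) := by
  intro i hi
  rw [Pi.add_apply, hv i hi, hw i hi, ← Finset.sum_add_distrib]
  exact Finset.sum_congr rfl fun j _ => by rw [Pi.add_apply, mul_add]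

theorem OnGraph.zero (n : ℕ) (B : ℕ → ℕ → ZMod 2) : OnGraph n B 0 := by
  intro i _
  simp

/-- The pivot vectors lie on the graph and are in echelon form. -/
structure Echelon (n : ℕ) (B : ℕ → ℕ → ZMod 2) (T : ℕ → ℕ → ZMod 2) : Prop where
  onGraph : ∀ c < n, OnGraph n B (T c)
  below : ∀ c < n, ∀ i < c, T c i = 0
  empty : ∀ c < n, T c c = 0 → ∀ i < n, T c i = 0

/-- The inner product of the first `n` entries. -/
def ip (n : ℕ) (h v : ℕ → ZMod 2) : ZMod 2 := ∑ i ∈ Finset.range n, h i * v i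

theorem ip_add (n : ℕ) (h v w : ℕ → ZMod 2) : ip n h (v + w) = ip n h v + ip n h w := by
  simp only [ip, Pi.add_apply, mul_add, Finset.sum_add_distrib]

theorem ip_eq_zero {n : ℕ} {v : ℕ → ZMod 2} (hv : ∀ i < n, v i = 0) (h : ℕ → ZMod 2) :
    ip n h v = 0 :=
  Finset.sum_eq_zero fun i hi => by rw [hv i (Finset.mem_range.1 hi), mul_zero]

theorem zmod2_cases (a : ZMod 2) : a = 0 ∨ a = 1 := by revert a; decide

theorem zmod2_eq_one {a : ZMod 2} (h : a ≠ 0) : a = 1 := (zmod2_cases a).resolve_left h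

/-- The last clause expresses spanning dually: a functional that kills the first halves of the new
pivots kills those of the old ones and cannot tell w from its residual. For k = n the residual has
zero first half, so such a functional kills w as well. -/
theorem red_echelon {n : ℕ} {B T : ℕ → ℕ → ZMod 2} {w : ℕ → ZMod 2} (hT : Echelon n B T)
    (hw : OnGraph n B w) (k : ℕ) (hk : k ≤ n) :
    Echelon n B (red k (T, w)).1 ∧ OnGraph n B (red k (T, w)).2 ∧
      (∀ i < k, (red k (T, w)).2 i = 0) ∧
      ∀ h, (∀ c < n, ip n h ((red k (T, w)).1 c) = 0) →
        (∀ c < n, ip n h (T c) = 0) ∧ ip n h w = ip n h (red k (T, w)).2 := by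
  induction k with
  | zero => exact ⟨hT, hw, fun i hi => by omega, fun h hh => ⟨hh, rfl⟩⟩
  | succ k ih =>
    obtain ⟨hE, hG, hz, hh⟩ := ih (by omega)
    rw [red]
    generalize red k (T, w) = s at *
    obtain ⟨S, v⟩ := s
    simp only at hE hG hz hh
    unfold redStep
    simp only
    by_cases h1 : v k = 0
    · rw [if_pos h1]
      dsimp only
      refine ⟨hE, hG, fun i hi => ?_, hh⟩
      rcases Nat.lt_succ_iff_lt_or_eq.1 hi with h | rfl
      · exact hz i h
      · exact h1
    · rw [if_neg h1]
      by_cases h2 : S k k = 0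
      · rw [if_pos h2]
        dsimp only
        -- The empty slot has zero first half. Hence the stored sum has the first half of v, and the
        -- vector that remains is `S k`, on which all further steps are idle.
        have hS := hE.empty k (by omega) h2
        have hSv : S k + v + v = S k := by rw [add_assoc, CharTwo.add_self_eq_zero, add_zero]
        refine ⟨⟨fun c hc => ?_, fun c hc i hi => ?_, fun c hc h i hi => ?_⟩, ?_, fun i hi => ?_,
          fun h hZ => ?_⟩
        · by_cases hck : c = k
          · subst hck
            rw [Function.update_self]
            exact (hE.onGraph c hc).add hG
          · rw [Function.update_of_ne hck]
            exact hE.onGraph c hc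
        · by_cases hck : c = k
          · subst hck
            rw [Function.update_self, Pi.add_apply, hE.below c hc i hi, hz i hi, add_zero]
          · rw [Function.update_of_ne hck]
            exact hE.below c hc i hi
        · by_cases hck : c = k
          · subst hck
            rw [Function.update_self, Pi.add_apply, h2, zero_add] at h
            exact absurd h h1
          · rw [Function.update_of_ne hck] at h ⊢
            exact hE.empty c hc h i hi
        · exact hG.add ((hE.onGraph k (by omega)).add hG)
        · rw [show v + (S k + v) = S k by rw [add_comm v]; exact hSv, hS i (by omega)]
        · have h3 : ip n h (S k + v) = 0 := by
            have := hZ k (by omega)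
            rwa [Function.update_self] at this
          have hSk : ip n h (S k) = 0 := ip_eq_zero hS h
          have h4 : ∀ c < n, ip n h (S c) = 0 := by
            intro c hc
            by_cases hck : c = k
            · subst hck
              exact hSk
            · have := hZ c hc
              rwa [Function.update_of_ne hck] at this
          refine ⟨(hh h h4).1, ?_⟩
          rw [(hh h h4).2, ip_add, h3, add_zero]
      · rw [if_neg h2]
        dsimp only
        refine ⟨hE, hG.add (hE.onGraph k (by omega)), fun i hi => ?_, fun h hZ => ⟨(hh h hZ).1, ?_⟩⟩
        · rcases Nat.lt_succ_iff_lt_or_eq.1 hi with h | rfl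
          · rw [Pi.add_apply, hz i h, hE.below k (by omega) i h, add_zero]
          · rw [Pi.add_apply, zmod2_eq_one h1, zmod2_eq_one h2, CharTwo.add_self_eq_zero]
        · rw [(hh h hZ).2, ip_add, hZ k (by omega), add_zero]

/-- Insertion preserves the echelon form because accepted samples lie on the graph. The second
clause is the dual form of saying that the pivots span the first halves of all accepted samples. -/
theorem pivots_echelon {n G α β : ℕ} {B : ℕ → ℕ → ZMod 2} {smp : ℕ → ℕ → ZMod 2}
    (hacc : ∀ j < G, α * conflicts n G smp (smp j) < β * G → OnGraph n B (smp j)) (j : ℕ)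
    (hj : j ≤ G) : Echelon n B (pivots n G α β smp j) ∧
      ∀ h, (∀ c < n, ip n h (pivots n G α β smp j c) = 0) →
        ∀ i < j, α * conflicts n G smp (smp i) < β * G → ip n h (smp i) = 0 := by
  induction j with
  | zero =>
    exact ⟨⟨fun _ _ => OnGraph.zero n B, fun _ _ _ _ => rfl, fun _ _ _ _ _ => rfl⟩,
      fun h _ i hi => by omega⟩
  | succ j ih =>
    obtain ⟨hE, hh⟩ := ih (by omega)
    rw [pivots]
    by_cases h1 : α * conflicts n G smp (smp j) < β * G
    · rw [if_pos h1]
      obtain ⟨e1, -, e3, e4⟩ := red_echelon hE (hacc j (by omega) h1) n le_rfl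
      refine ⟨e1, fun h hZ i hi hi2 => ?_⟩
      obtain ⟨z1, z2⟩ := e4 h hZ
      rcases Nat.lt_succ_iff_lt_or_eq.1 hi with h3 | rfl
      · exact hh h z1 i h3 hi2
      · rw [z2, ip_eq_zero e3]
    · rw [if_neg h1]
      refine ⟨hE, fun h hZ i hi hi2 => ?_⟩
      rcases Nat.lt_succ_iff_lt_or_eq.1 hi with h3 | rfl
      · exact hh h hZ i h3 hi2
      · exact absurd hi2 h1

/-- A missing pivot is a zero row in the square matrix of first halves. This matrix is then
singular, and a kernel vector is a nonzero functional that kills all pivots. -/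
theorem Echelon.full {n : ℕ} {B T : ℕ → ℕ → ZMod 2} (hT : Echelon n B T)
    (h : ∀ h : Bits n, h ≠ 0 → ∃ c < n, ip n (ext h) (T c) ≠ 0) : ∀ c < n, T c c ≠ 0 := by
  intro c hc h0
  have hrow := hT.empty c hc h0
  let N : Matrix (Fin n) (Fin n) (ZMod 2) := Matrix.of fun i j => T i j
  have hdet : N.det = 0 := Matrix.det_eq_zero_of_row_eq_zero ⟨c, hc⟩ fun j => hrow j j.2
  obtain ⟨v, hv, hNv⟩ := Matrix.exists_mulVec_eq_zero_iff.2 hdet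
  obtain ⟨d, hd, hne⟩ := h v hv
  apply hne
  have := congrFun hNv ⟨d, hd⟩
  rw [Pi.zero_apply, Matrix.mulVec, dotProduct] at this
  rw [← this, ip, Finset.sum_range]
  refine Finset.sum_congr rfl fun i _ => ?_
  rw [ext_coe, mul_comm]
  rfl

theorem red_fst_of_full {n : ℕ} {T : ℕ → ℕ → ZMod 2} (hT : ∀ c < n, T c c ≠ 0) (w : ℕ → ZMod 2)
    (k : ℕ) (hk : k ≤ n) : (red k (T, w)).1 = T := by
  induction k with
  | zero => rfl
  | succ k ih =>
    have h := ih (by omega)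
    rw [red]
    unfold redStep
    rw [h, if_neg (hT k (by omega))]
    split_ifs <;> simp [h]

/-- Residual and input differ by a sum of pivots, all of which lie on the graph. -/
theorem red_snd_of_full {n : ℕ} {B T : ℕ → ℕ → ZMod 2} (hE : Echelon n B T)
    (hT : ∀ c < n, T c c ≠ 0) (w : ℕ → ZMod 2) (k : ℕ) (hk : k ≤ n) :
    OnGraph n B ((red k (T, w)).2 + w) ∧ ∀ i < k, (red k (T, w)).2 i = 0 := by
  induction k with
  | zero =>
    refine ⟨?_, fun i hi => by omega⟩
    rw [red, CharTwo.add_self_eq_zero]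
    exact OnGraph.zero n B
  | succ k ih =>
    obtain ⟨h1, h2⟩ := ih (by omega)
    have h := red_fst_of_full hT w k (by omega)
    rw [red]
    unfold redStep
    rw [h, if_neg (hT k (by omega))]
    by_cases h3 : (red k (T, w)).2 k = 0
    · rw [if_pos h3]
      refine ⟨h1, fun i hi => ?_⟩
      rcases Nat.lt_succ_iff_lt_or_eq.1 hi with h4 | rfl
      · exact h2 i h4
      · exact h3
    · rw [if_neg h3]
      refine ⟨?_, fun i hi => ?_⟩
      · have := h1.add (hE.onGraph k (by omega))
        rwa [add_right_comm] at this
      · rcases Nat.lt_succ_iff_lt_or_eq.1 hi with h4 | rfl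
        · dsimp only
          rw [Pi.add_apply, h2 i h4, hE.below k (by omega) i h4, add_zero]
        · dsimp only
          rw [Pi.add_apply, zmod2_eq_one h3, zmod2_eq_one (hT i (by omega)),
            CharTwo.add_self_eq_zero]

/-- The residual (0, r) of the unit vector (eₖ, 0) satisfies that (eₖ, r) is on the graph, so r = B
eₖ. -/
theorem solvedRow_of_full {n : ℕ} {B T : ℕ → ℕ → ZMod 2} (hE : Echelon n B T)
    (hT : ∀ c < n, T c c ≠ 0) {k i : ℕ} (hk : k < n) (hi : i < n) :
    solvedRow n T k i = B i k := by
  obtain ⟨h1, h2⟩ := red_snd_of_full hE hT (Pi.single k 1) n le_rfl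
  have h3 := h1 i hi
  unfold solvedRow
  rw [Pi.add_apply, Pi.single_eq_of_ne (by omega), add_zero] at h3
  rw [h3, Finset.sum_eq_single k]
  · rw [Pi.add_apply, h2 k hk, Pi.single_eq_same, zero_add, mul_one]
  · intro j hj hjk
    rw [Pi.add_apply, h2 j (Finset.mem_range.1 hj), Pi.single_eq_of_ne hjk, add_zero, mul_zero]
  · intro h
    exact absurd (Finset.mem_range.2 hk) h

end PhaseLearning

namespace PhaseLearning

noncomputable section

variable {M n G : ℕ}

/-! ### Correctness of the algorithm for given noise and given outcomes -/

/-- The matrix of the polar form of `x ↦ xᵀ A x`. -/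
def polar (A : Matrix (Fin n) (Fin n) (ZMod 2)) : Matrix (Fin n) (Fin n) (ZMod 2) := A + Aᵀ

theorem polar_transpose (A : Matrix (Fin n) (Fin n) (ZMod 2)) : (polar A)ᵀ = polar A := by
  rw [polar, Matrix.transpose_add, Matrix.transpose_transpose, add_comm]

theorem dotProduct_polar (A : Matrix (Fin n) (Fin n) (ZMod 2)) (u v : Bits n) :
    u ⬝ᵥ (polar A *ᵥ v) = (polar A *ᵥ u) ⬝ᵥ v := by
  rw [Matrix.dotProduct_mulVec, ← Matrix.mulVec_transpose, polar_transpose]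

theorem quadPoly_add (A : Matrix (Fin n) (Fin n) (ZMod 2)) (u v : Bits n) :
    quadPoly A (u + v) = quadPoly A u + quadPoly A v + (polar A *ᵥ u) ⬝ᵥ v := by
  have h : u ⬝ᵥ (A *ᵥ v) = (Aᵀ *ᵥ u) ⬝ᵥ v := by
    rw [Matrix.dotProduct_mulVec, ← Matrix.mulVec_transpose]
  simp only [quadPoly, Matrix.mulVec_add, dotProduct_add, add_dotProduct, polar,
    Matrix.add_mulVec, h]
  rw [dotProduct_comm v (A *ᵥ u)]
  ring

/-- The noise of the three copies of a group. -/
def grp (b : Fin M → Bits n) (g : Fin (M / 3)) (i : Fin 3) : Bits n :=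
  b ⟨3 * g + i, by have := g.2; have := i.2; omega⟩

/-- A family of bit strings as a family of sequences. -/
def extFam (y : Fin G → Bits n) (g : ℕ) : ℕ → ZMod 2 := if h : g < G then ext (y ⟨g, h⟩) else 0

theorem extFam_coe (y : Fin G → Bits n) (g : Fin G) : extFam y g = ext (y g) := by
  rw [extFam, dif_pos g.2]

/-- A matrix as a double sequence. -/
def extMat (B : Matrix (Fin n) (Fin n) (ZMod 2)) (i : ℕ) : ℕ → ZMod 2 :=
  extFam (fun i j => B i j) i

theorem extMat_coe (B : Matrix (Fin n) (Fin n) (ZMod 2)) (i j : Fin n) : extMat B i j = B i j := by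
  rw [extMat, extFam_coe, ext_coe]

theorem onGraph_iff (B : Matrix (Fin n) (Fin n) (ZMod 2)) (w : ℕ → ZMod 2) :
    OnGraph n (extMat B) w ↔ (firstBits n fun i => w (n + i)) = B *ᵥ firstBits n w := by
  constructor
  · intro h
    funext i
    refine (h i i.2).trans ?_
    rw [Finset.sum_range]
    exact Finset.sum_congr rfl fun j _ => by rw [extMat_coe]; rfl
  · intro h i hi
    have e := extMat_coe B ⟨i, hi⟩
    simp only at e
    rw [Finset.sum_range]
    simp only [e]
    exact congrFun h ⟨i, hi⟩

/-- The second half of a sample. -/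
def zOut (A : Matrix (Fin n) (Fin n) (ZMod 2)) (t : Fin G → Fin 3 → Bits n) (y : Fin G → Bits n) :
    Fin G → Bits n := fun g => polar A *ᵥ y g + t g 0 + t g 1

/-- The outcomes for the third copies. -/
def dOut (A : Matrix (Fin n) (Fin n) (ZMod 2)) (t : Fin G → Fin 3 → Bits n) :
    Fin G → Bits n := fun g i => A i i + t g 2 i

/-- The samples. -/
def samples (A : Matrix (Fin n) (Fin n) (ZMod 2)) (t : Fin G → Fin 3 → Bits n)
    (y : Fin G → Bits n) : ℕ → ℕ → ZMod 2 :=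
  fun g => joinV n (extFam y g) (extFam (zOut A t y) g)

/-- Symmetry of the polar form moves it across the product. The coefficient of y is then the
deviation of v from the graph, and the noise of the sample is seen only through the first half of v.
-/
theorem symp_samples (A : Matrix (Fin n) (Fin n) (ZMod 2)) (t : Fin G → Fin 3 → Bits n)
    (y : Fin G → Bits n) (v : ℕ → ZMod 2) (g : Fin G) : symp n v (samples A t y g) =
      (polar A *ᵥ firstBits n v + firstBits n fun i => v (n + i)) ⬝ᵥ y g +
        firstBits n v ⬝ᵥ (t g 0 + t g 1) := by
  have h1 : symp n v (samples A t y g) =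
      firstBits n v ⬝ᵥ zOut A t y g + (firstBits n fun i => v (n + i)) ⬝ᵥ y g := by
    unfold symp samples joinV
    rw [Finset.sum_range, Finset.sum_range]
    congr 1
    · refine Finset.sum_congr rfl fun i _ => ?_
      rw [if_neg (by omega), Nat.add_sub_cancel_left, extFam_coe, ext_coe]
      rfl
    · refine Finset.sum_congr rfl fun i _ => ?_
      rw [if_pos i.2, extFam_coe, ext_coe]
      rfl
  rw [h1, zOut, add_assoc, dotProduct_add, dotProduct_polar, add_dotProduct]
  ring

/-- The noise and the outcomes for which the algorithm succeeds. -/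
structure Good (α β : ℕ) (A : Matrix (Fin n) (Fin n) (ZMod 2)) (t : Fin G → Fin 3 → Bits n)
    (y : Fin G → Bits n) : Prop where
  reject : ∀ u w : Bits n, w ≠ 0 → β * G ≤ α * ∑ g, (w ⬝ᵥ y g + u ⬝ᵥ (t g 0 + t g 1)).val
  accept : ∀ u : Bits n, α * ∑ g, (u ⬝ᵥ (t g 0 + t g 1)).val < β * G
  rank : ∀ h : Bits n, h ≠ 0 → ∃ g, t g 0 + t g 1 = 0 ∧ h ⬝ᵥ y g ≠ 0
  diag : ∀ i, 2 * ∑ g, (t g 2 i).val < G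

theorem conflicts_samples (A : Matrix (Fin n) (Fin n) (ZMod 2)) (t : Fin G → Fin 3 → Bits n)
    (y : Fin G → Bits n) (v : ℕ → ZMod 2) : conflicts n G (samples A t y) v =
      ∑ g, ((polar A *ᵥ firstBits n v + firstBits n fun i => v (n + i)) ⬝ᵥ y g +
        firstBits n v ⬝ᵥ (t g 0 + t g 1)).val := by
  rw [conflicts, Finset.sum_range]
  exact Finset.sum_congr rfl fun g _ => by rw [symp_samples]

theorem bits_add_self (u : Bits n) : u + u = 0 := funext fun i => CharTwo.add_self_eq_zero (u i)

/-- The deviation of v from the graph is the w of `Good.reject`. As that condition covers all pairs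
(u, w) at once, v may itself be one of the samples. -/
theorem Good.onGraph {α β : ℕ} {A : Matrix (Fin n) (Fin n) (ZMod 2)} {t : Fin G → Fin 3 → Bits n}
    {y : Fin G → Bits n} (h : Good α β A t y) (v : ℕ → ZMod 2)
    (hv : α * conflicts n G (samples A t y) v < β * G) : OnGraph n (extMat (polar A)) v := by
  rw [onGraph_iff]
  by_contra hne
  rw [conflicts_samples] at hv
  refine absurd (h.reject _ _ fun h0 => hne ?_) (not_le.2 hv)
  have := congrArg (fun x => polar A *ᵥ firstBits n v + x) h0
  simp only [← add_assoc, bits_add_self, zero_add, add_zero] at this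
  exact this

/-- A sample whose noise cancels lies on the graph and passes the test by `Good.accept`, so a
functional that kills the pivots kills its first half. By `Good.rank` no nonzero functional kills
all of these. -/
theorem Good.echelon {α β : ℕ} {A : Matrix (Fin n) (Fin n) (ZMod 2)} {t : Fin G → Fin 3 → Bits n}
    {y : Fin G → Bits n} (h : Good α β A t y) :
    Echelon n (extMat (polar A)) (pivots n G α β (samples A t y) G) ∧
      ∀ c < n, pivots n G α β (samples A t y) G c c ≠ 0 := by
  obtain ⟨h1, h2⟩ := pivots_echelon (fun j _ => h.onGraph (samples A t y j)) G le_rfl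
  refine ⟨h1, h1.full fun w hw => ?_⟩
  by_contra! hc
  obtain ⟨g, hg, hy⟩ := h.rank w hw
  have hfst : firstBits n (samples A t y g) = y g := by
    funext i
    rw [firstBits, samples, joinV, if_pos i.2, extFam_coe, ext_coe]
  have hsnd : (firstBits n fun i => samples A t y g (n + i)) = polar A *ᵥ y g := by
    funext i
    rw [firstBits, samples, joinV, if_neg (by omega), Nat.add_sub_cancel_left, extFam_coe, ext_coe,
      zOut, add_assoc, hg, add_zero]
  have := h2 (ext w) hc g g.2 (by
    rw [conflicts_samples, hfst, hsnd]
    simp only [bits_add_self, zero_dotProduct, zero_add]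
    exact h.accept _)
  apply hy
  rw [← this, ip, Finset.sum_range, dotProduct]
  exact Finset.sum_congr rfl fun i _ => by rw [ext_coe, ← hfst]; rfl

theorem Good.upperPart {α β : ℕ} {A : Matrix (Fin n) (Fin n) (ZMod 2)}
    {t : Fin G → Fin 3 → Bits n} {y : Fin G → Bits n} (h : Good α β A t y)
    (hA : ∀ i j, j < i → A i j = 0) (k i : Fin n) :
    upperPart n G α β (samples A t y) k i = if k < i then (A k i).val else 0 := by
  obtain ⟨h1, h2⟩ := h.echelon
  rw [PhaseLearning.upperPart, solvedRow_of_full h1 h2 k.2 i.2, extMat_coe]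
  by_cases hk : k < i
  · rw [if_pos hk, if_pos (Fin.lt_def.1 hk), polar, Matrix.add_apply, Matrix.transpose_apply,
      hA i k hk, zero_add]
  · rw [if_neg hk, if_neg fun h => hk (Fin.lt_def.2 h)]

/-- The terms above the diagonal occur twice and cancel, and a square equals its base in 𝔽₂, so the
remaining diagonal part is linear. -/
theorem Good.pairForm {α β : ℕ} {A : Matrix (Fin n) (Fin n) (ZMod 2)}
    {t : Fin G → Fin 3 → Bits n} {y : Fin G → Bits n} (h : Good α β A t y)
    (hA : ∀ i j, j < i → A i j = 0) (u : Bits n) :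
    pairForm n (PhaseLearning.upperPart n G α β (samples A t y)) (ext u) + quadPoly A u =
      ∑ i, A i i * u i := by
  have h1 : PhaseLearning.pairForm n (PhaseLearning.upperPart n G α β (samples A t y)) (ext u) =
      ∑ i : Fin n, ∑ j : Fin n, if i < j then A i j * (u i * u j) else 0 := by
    unfold PhaseLearning.pairForm
    rw [Finset.sum_range]
    refine Finset.sum_congr rfl fun i _ => ?_
    rw [Finset.sum_range]
    refine Finset.sum_congr rfl fun j _ => ?_
    rw [h.upperPart hA, ext_coe, ext_coe]
    by_cases hij : i < j
    · rw [if_pos hij, if_pos hij]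
      rcases zmod2_cases (A i j) with e | e <;> simp [e, ZMod.val_one]
    · rw [if_neg hij, if_neg hij, if_neg (by simp)]
  rw [h1, quadPoly]
  simp only [dotProduct, Matrix.mulVec, Finset.mul_sum]
  rw [← Finset.sum_add_distrib]
  refine Finset.sum_congr rfl fun i _ => ?_
  rw [← Finset.sum_add_distrib, Finset.sum_eq_single i]
  · rw [if_neg (lt_irrefl i)]
    rcases zmod2_cases (u i) with e | e <;> simp [e]
  · intro j _ hji
    rcases lt_or_gt_of_ne hji with hlt | hlt
    · rw [if_neg (not_lt.2 hlt.le), hA i j hlt]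
      ring
    · rw [if_pos hlt, show u i * (A i j * u j) = A i j * (u i * u j) by ring,
        CharTwo.add_self_eq_zero]
  · intro hi
    exact absurd (Finset.mem_univ i) hi

/-- Fewer than half of the noise bits are ones; adding a diagonal entry 1 complements every bit and
reverses the majority. -/
theorem Good.ones {α β : ℕ} {A : Matrix (Fin n) (Fin n) (ZMod 2)}
    {t : Fin G → Fin 3 → Bits n} {y : Fin G → Bits n} (h : Good α β A t y) (i : Fin n) :
    G < 2 * ones G (extFam (dOut A t)) i ↔ A i i = 1 := by
  have h1 : PhaseLearning.ones G (extFam (dOut A t)) i = ∑ g, (A i i + t g 2 i).val := by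
    rw [PhaseLearning.ones, Finset.sum_range]
    exact Finset.sum_congr rfl fun g _ => by rw [extFam_coe, ext_coe, dOut]
  have h2 := h.diag i
  rw [h1]
  rcases zmod2_cases (A i i) with e | e
  · simp only [e, zero_add, zero_ne_one, iff_false]
    omega
  · simp only [e, iff_true]
    have h3 : ∑ g, (1 + t g 2 i).val + ∑ g, (t g 2 i).val = G := by
      rw [← Finset.sum_add_distrib]
      have : ∀ a : ZMod 2, (1 + a).val + a.val = 1 := by decide
      simp [this]
    omega

/-- The phases of the copies. -/
def phases (A : Matrix (Fin n) (Fin n) (ZMod 2)) (b : Fin M → Bits n) : Fin M → Bits n → ZMod 2 :=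
  fun k u => quadPoly A u + b k ⬝ᵥ u

/-- The events of the successful run. -/
def runOps (α β : ℕ) (A : Matrix (Fin n) (Fin n) (ZMod 2)) (t : Fin G → Fin 3 → Bits n)
    (y : Fin G → Bits n) : List QOp :=
  sampleOps n G (extFam y) (extFam (zOut A t y)) ++
    thirdsOps n G (upperPart n G α β (samples A t y)) (extFam (dOut A t))

/-- The phases fit the outcomes: polarization makes the phase of a Bell pair affine with slope
`zOut`, and `Good.pairForm` makes that of a third copy linear with slope `dOut`. -/
theorem Good.nrm {α β : ℕ} {A : Matrix (Fin n) (Fin n) (ZMod 2)} {b : Fin M → Bits n}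
    {y : Fin (M / 3) → Bits n} (h : Good α β A (grp b) y) (hA : ∀ i j, j < i → A i j = 0) :
    nrm (acts (runOps α β A (grp b) y) (prodState (phaseProd (phases A b)))) =
      ((2 ^ n)⁻¹) ^ (M / 3) := by
  refine nrm_final _ _ (fun i => by simp [PhaseLearning.upperPart]) _ _ _ ?_ ?_
  · intro g hg k l hk hl
    have e1 : b k = grp b ⟨g, hg⟩ 0 := congrArg b (Fin.ext hk)
    have e2 : b l = grp b ⟨g, hg⟩ 1 := congrArg b (Fin.ext hl)
    have e3 := extFam_coe y ⟨g, hg⟩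
    have e4 := extFam_coe (zOut A (grp b) y) ⟨g, hg⟩
    simp only at e3 e4
    refine ⟨quadPoly A (y ⟨g, hg⟩) + b l ⬝ᵥ y ⟨g, hg⟩, fun u => ?_⟩
    have e5 : ∑ i : Fin n, extFam (zOut A (grp b) y) g i * u i = zOut A (grp b) y ⟨g, hg⟩ ⬝ᵥ u :=
      Finset.sum_congr rfl fun i _ => by rw [e4, ext_coe]
    rw [e3, e5, firstBits_ext, phases, phases, quadPoly_add, zOut, ← e1, ← e2, dotProduct_add,
      add_dotProduct, add_dotProduct]
    -- The quadratic phases of the two copies are equal and cancel in characteristic two.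
    linear_combination (quadPoly A u) * CharTwo.two_eq_zero (R := ZMod 2)
  · intro g hg k hk
    have e1 : b k = grp b ⟨g, hg⟩ 2 := congrArg b (Fin.ext hk)
    have e4 := extFam_coe (dOut A (grp b)) ⟨g, hg⟩
    simp only at e4
    refine ⟨0, fun u => ?_⟩
    rw [phases, ← add_assoc, h.pairForm hA, zero_add, e1, dotProduct, ← Finset.sum_add_distrib]
    refine Finset.sum_congr rfl fun i _ => ?_
    rw [e4, ext_coe, dOut, add_mul]

theorem Good.pathWeight {α β X T : ℕ} {A : Matrix (Fin n) (Fin n) (ZMod 2)} {b : Fin M → Bits n}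
    {y : Fin (M / 3) → Bits n} (h : Good α β A (grp b) y) (hA : ∀ i j, j < i → A i j = 0)
    (hn : 2 * n ≤ X) (hM : M ≤ X) (hT : (X + 3) ^ 100 ≤ T) :
    pathWeight (Outputs A) T [learner α β] (inputMem n M) (prodState (phaseProd (phases A b)))
      (outcomes (runOps α β A (grp b) y)) = ((2 ^ n)⁻¹) ^ (M / 3) := by
  obtain ⟨h1, h2⟩ := h.echelon
  obtain ⟨s, m', hs, hrun, hm'⟩ := learner_spec (extFam y) (extFam (zOut A (grp b) y))
    (extFam (dOut A (grp b))) hn hM fun w => red_fst_of_full h2 w n le_rfl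
  -- The `T - s` steps left over do no harm, since no program remains to be executed.
  have h3 := hrun (M * n) (Outputs A) (T - s) [] (prodState (phaseProd (phases A b))) []
  rw [Nat.sub_add_cancel (hs.trans hT), List.append_nil] at h3
  refine h3.trans ?_
  have h4 : Outputs A m' := by
    intro k i
    rw [hm' k k.2 i i.2]
    have h5 := h.upperPart hA k i
    have h6 := h.ones k
    unfold samples at h5
    rw [h5]
    by_cases hki : k = i
    · subst hki
      by_cases h7 : A k k = 1
      · rw [if_pos ⟨rfl, h6.2 h7⟩, h7, ZMod.val_one]
      · rw [if_neg fun e => h7 (h6.1 e.2), if_neg (lt_irrefl k),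
          (zmod2_cases (A k k)).resolve_right h7, ZMod.val_zero]
    · rw [if_neg fun e => hki (Fin.ext e.1)]
      split_ifs with h7
      · rfl
      · rw [hA k i (lt_of_le_of_ne (not_lt.1 h7) fun e => hki e.symm), ZMod.val_zero]
  rw [PhaseLearning.pathWeight, if_pos ⟨h4, rfl⟩]
  exact h.nrm hA

/-! ### The outcomes determine the first halves of the samples -/

theorem outcomes_flatMap (f : ℕ → List QOp) (l : List ℕ) :
    outcomes (l.flatMap f) = l.flatMap fun i => outcomes (f i) := by
  simp [outcomes, List.flatMap_assoc]

theorem outcomes_bellOps (n a b : ℕ) (y z : ℕ → ZMod 2) :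
    outcomes (bellOps n a b y z) = (List.range n).map y ++ (List.range n).map z := by
  rw [bellOps, outcomes_append, readOps, outcomes_flatMap, outcomes_flatMap]
  have h : ∀ (f : ℕ → ZMod 2) (l : List ℕ), (l.flatMap fun i => [f i]) = l.map f := fun f l => by
    induction l <;> simp_all
  simp [outcomes, QOp.outcome, h]

/-- The arbitrary tails let the induction peel off the last group; blocks of equal length make the
concatenations comparable. -/
theorem sampleOps_injective {n G : ℕ} {y z y' z' : ℕ → ℕ → ZMod 2} {l l' : List (ZMod 2)}
    (h : outcomes (sampleOps n G y z) ++ l = outcomes (sampleOps n G y' z') ++ l') :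
    ∀ g < G, ∀ i < n, y g i = y' g i := by
  induction G generalizing l l' with
  | zero => intro g hg; omega
  | succ G ih =>
    rw [sampleOps, sampleOps, flatMap_range_succ, flatMap_range_succ, outcomes_append,
      outcomes_append, List.append_assoc, List.append_assoc] at h
    have h1 := ih h
    intro g hg i hi
    rcases Nat.lt_succ_iff_lt_or_eq.1 hg with h2 | rfl
    · exact h1 g h2 i hi
    have h3 : ∀ y z : ℕ → ℕ → ZMod 2, (outcomes (sampleOps n g y z)).length = g * (2 * n) := by
      intro y z
      rw [sampleOps, outcomes_flatMap]
      simp [outcomes_bellOps, List.length_flatMap, two_mul]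
    have h4 := (List.append_inj h ((h3 _ _).trans (h3 _ _).symm)).2
    rw [outcomes_bellOps, outcomes_bellOps, List.append_assoc, List.append_assoc] at h4
    have h5 := (List.append_inj h4 (by simp)).1
    exact List.map_inj_left.1 h5 i (List.mem_range.2 hi)

/-- All other outcomes are functions of y and the noise, but y itself is recorded on the tape. -/
theorem runOps_injective (α β : ℕ) (A : Matrix (Fin n) (Fin n) (ZMod 2))
    (t : Fin G → Fin 3 → Bits n) :
    Function.Injective fun y => outcomes (runOps α β A t y) := by
  intro y y' h
  simp only [runOps, outcomes_append] at h
  have h1 := sampleOps_injective h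
  funext g i
  have := h1 g g.2 i i.2
  rwa [extFam_coe, extFam_coe, ext_coe, ext_coe] at this

end
end PhaseLearning

/-! ### Probability: noise as random linear terms, tail bounds and the union bound. -/

namespace PhaseLearning

noncomputable section

variable {M n G : ℕ}

/-! ### Global depolarizing noise as a mixture of phase states -/

/-- The real sign `(-1)^a`. -/
def sgn (a : ZMod 2) : ℝ := (-1) ^ a.val

theorem sgn_zero : sgn 0 = 1 := by simp [sgn]

theorem sgn_one : sgn 1 = -1 := by simp [sgn, ZMod.val_one]

theorem sgn_add (a b : ZMod 2) : sgn (a + b) = sgn a * sgn b := by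
  rcases zmod2_cases a with rfl | rfl <;> rcases zmod2_cases b with rfl | rfl <;>
    simp [sgn_zero, sgn_one, CharTwo.add_self_eq_zero]

theorem ofReal_sgn (a : ZMod 2) : (sgn a : ℂ) = chi a := by simp [sgn, chi]

theorem sum_sgn (c : Bits n) : ∑ b : Bits n, sgn (c ⬝ᵥ b) = if c = 0 then 2 ^ n else 0 := by
  split_ifs with h
  · subst h
    simp [sgn_zero, ZMod.card]
  · obtain ⟨i, hi⟩ := Function.ne_iff.1 h
    -- Translation by a unit vector at a position where c is nonzero permutes the summands and flips
    -- every sign.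
    have h1 : ∑ b : Bits n, sgn (c ⬝ᵥ (b + Pi.single i 1)) = ∑ b : Bits n, sgn (c ⬝ᵥ b) :=
      Fintype.sum_equiv (Equiv.addRight (Pi.single i 1)) _ _ fun b => rfl
    simp only [dotProduct_add, sgn_add, dotProduct_single, zmod2_eq_one hi, mul_one, sgn_one,
      mul_neg, Finset.sum_neg_distrib] at h1
    linarith

/-- The distribution of the random linear term that describes the noise on one copy. -/
def noiseWeight (ε : ℝ) (b : Bits n) : ℝ := (if b = 0 then 1 - ε else 0) + ε / 2 ^ n

theorem noiseWeight_nonneg {ε : ℝ} (h0 : 0 ≤ ε) (h1 : ε ≤ 1) (b : Bits n) :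
    0 ≤ noiseWeight ε b := by
  unfold noiseWeight
  have : 0 ≤ 1 - ε := by linarith
  positivity

theorem sum_noiseWeight_mul (ε : ℝ) (f : Bits n → ℝ) :
    ∑ b, noiseWeight ε b * f b = (1 - ε) * f 0 + ε / 2 ^ n * ∑ b, f b := by
  simp only [noiseWeight, add_mul, Finset.sum_add_distrib, ite_mul, zero_mul, Finset.mul_sum]
  simp

theorem sum_noiseWeight (ε : ℝ) : ∑ b : Bits n, noiseWeight ε b = 1 := by
  have := sum_noiseWeight_mul (n := n) ε fun _ => 1
  simp only [mul_one] at this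
  rw [this]
  simp [ZMod.card]

theorem phaseState_eq (f : Bits n → ZMod 2) (x : Bits n) : phaseState f x = amp n * chi (f x) := by
  rw [phaseState, amp, chi]
  ring

theorem amp_mul_star : amp n * star (amp n) = (((2 ^ n)⁻¹ : ℝ) : ℂ) := by
  rw [← normSq_amp, ← Complex.mul_conj]
  rfl

theorem star_chi (a : ZMod 2) : star (chi a) = chi a := by
  rw [← ofReal_sgn]
  exact Complex.conj_ofReal _

/-- A linear term b multiplies the entry at (x, y) by (-1)^((x + y)·b). Averaged over uniform b,
this vanishes off the diagonal, which leaves the identity divided by 2ⁿ. -/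
theorem noisyPhaseState_apply (ε : ℝ) (f : Bits n → ZMod 2) (x y : Bits n) :
    noisyPhaseState ε f x y = ∑ b : Bits n, (noiseWeight ε b : ℂ) *
      ((amp n * chi (f x + b ⬝ᵥ x)) * star (amp n * chi (f y + b ⬝ᵥ y))) := by
  have h1 : ∀ b : Bits n, (amp n * chi (f x + b ⬝ᵥ x)) * star (amp n * chi (f y + b ⬝ᵥ y)) =
      ((((2 ^ n)⁻¹ * (sgn (f x + f y) * sgn ((x + y) ⬝ᵥ b)) : ℝ)) : ℂ) := by
    intro b
    rw [star_mul', star_chi, mul_mul_mul_comm, amp_mul_star, ← chi_add, Complex.ofReal_mul,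
      ← sgn_add, ofReal_sgn, dotProduct_comm (x + y), dotProduct_add]
    congr 2
    ring
  simp only [h1]
  have h2 := sum_noiseWeight_mul (n := n) ε
    fun b => (2 ^ n)⁻¹ * (sgn (f x + f y) * sgn ((x + y) ⬝ᵥ b))
  rw [← Finset.mul_sum, ← Finset.mul_sum, sum_sgn] at h2
  have h3 := congrArg (fun r : ℝ => (r : ℂ)) h2
  push_cast at h3
  push_cast
  rw [h3, noisyPhaseState, Matrix.add_apply, Matrix.smul_apply, Matrix.smul_apply,
    Matrix.vecMulVec_apply, Pi.star_apply, phaseState_eq, phaseState_eq, star_mul', star_chi,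
    mul_mul_mul_comm, amp_mul_star, ← chi_add, Matrix.one_apply, dotProduct_zero, sgn_zero,
    ofReal_sgn, smul_eq_mul, smul_eq_mul]
  have h4 : x + y = 0 ↔ x = y := by
    rw [add_eq_zero_iff_eq_neg]
    have : -y = y := by rw [neg_eq_iff_add_eq_zero, bits_add_self]
    rw [this]
  by_cases hxy : x = y
  · subst hxy
    rw [if_pos (h4.2 rfl), CharTwo.add_self_eq_zero]
    simp
  · rw [if_neg hxy, if_neg fun e => hxy (h4.1 e)]
    simp

/-- Expanding the tensor power of a mixture gives a mixture over independent linear terms, one for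
each copy. -/
theorem copies_eq (ε : ℝ) (A : Matrix (Fin n) (Fin n) (ZMod 2)) :
    copies M (noisyPhaseState ε (quadPoly A)) = ∑ b : Fin M → Bits n,
      ((∏ k, noiseWeight ε (b k) : ℝ) : ℂ) • pureOp (prodState (phaseProd (phases A b))) := by
  ext x y
  simp only [copies, Matrix.of_apply, noisyPhaseState_apply, Matrix.sum_apply, Matrix.smul_apply,
    pureOp, Matrix.vecMulVec_apply, Pi.star_apply, prodState, up, phaseProd, phases, smul_eq_mul]
  rw [Finset.prod_univ_sum, Fintype.piFinset_univ]
  refine Finset.sum_congr rfl fun b _ => ?_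
  rw [Finset.prod_mul_distrib, Finset.prod_mul_distrib, star_prod]
  push_cast
  rfl

open Classical in
/-- The success probability is at least that of good noise and good outcomes. -/
theorem sum_good_le_learnProb {α β X T : ℕ} {ε : ℝ} (h0 : 0 ≤ ε) (h1 : ε ≤ 1)
    {A : Matrix (Fin n) (Fin n) (ZMod 2)} (hA : ∀ i j, j < i → A i j = 0)
    (hn : 2 * n ≤ X) (hM : M ≤ X) (hT : (X + 3) ^ 100 ≤ T) :
    ∑ b : Fin M → Bits n, (∏ k, noiseWeight ε (b k)) * ∑ y : Fin (M / 3) → Bits n,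
      (if Good α β A (grp b) y then ((2 ^ n)⁻¹ : ℝ) ^ (M / 3) else 0) ≤
      learnProb (learner α β) ε A M T := by
  rw [learnProb, copies_eq, haltWeight_sum]
  refine Finset.sum_le_sum fun b _ => mul_le_mul_of_nonneg_left ?_
    (Finset.prod_nonneg fun k _ => noiseWeight_nonneg h0 h1 _)
  refine le_trans (Finset.sum_le_sum fun y _ => ?_)
    (sum_pathWeight_le (Outputs A) T [learner α β] (inputMem n M) _ Finset.univ
      (fun y : Fin (M / 3) → Bits n => outcomes (runOps α β A (grp b) y))
      (runOps_injective α β A (grp b)).injOn)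
  split_ifs with h
  · exact (h.pathWeight hA hn hM hT).ge
  · exact pathWeight_nonneg _ _ _ _ _ _

end
end PhaseLearning

namespace PhaseLearning

noncomputable section

variable {M n G : ℕ}

/-! ### The probability of good noise and good outcomes -/

/-- The copies in groups of three, and the rest. -/
def copyEquiv (M : ℕ) : (Fin (M / 3) × Fin 3) ⊕ Fin (M % 3) ≃ Fin M :=
  ((Equiv.sumCongr finProdFinEquiv (Equiv.refl _)).trans finSumFinEquiv).trans
    (finCongr (by omega))

/-- Families over the copies in groups of three. -/
def famEquiv (M : ℕ) (α : Type) :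
    (Fin M → α) ≃ (Fin (M / 3) → Fin 3 → α) × (Fin (M % 3) → α) :=
  (((copyEquiv M).arrowCongr (Equiv.refl α)).symm.trans (Equiv.sumArrowEquivProdArrow _ _ α)).trans
    (Equiv.prodCongr (Equiv.curry _ _ _) (Equiv.refl _))

theorem famEquiv_fst (b : Fin M → Bits n) : (famEquiv M (Bits n) b).1 = grp b := by
  funext g i
  refine congrArg b (Fin.ext ?_)
  simp [copyEquiv, finProdFinEquiv]
  omega

theorem prod_copies (μ : Bits n → ℝ) (b : Fin M → Bits n) :
    ∏ k, μ (b k) = (∏ g, ∏ i, μ (grp b g i)) * ∏ j, μ ((famEquiv M (Bits n) b).2 j) := by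
  rw [← famEquiv_fst, ← Equiv.prod_comp (copyEquiv M), Fintype.prod_sum_type, Fintype.prod_prod_type]
  rfl

theorem sum_prod_pow {α : Type} [Fintype α] [DecidableEq α] (f : α → ℝ) (s : ℕ) :
    ∑ x : Fin s → α, ∏ j, f (x j) = (∑ a, f a) ^ s := by
  rw [← Fintype.piFinset_univ, ← Finset.prod_univ_sum]
  simp

/-- The expectation over the noise of one group and the uniform outcome. -/
def groupEx (ε : ℝ) (F : (Fin 3 → Bits n) → Bits n → ℝ) : ℝ :=
  ∑ t : Fin 3 → Bits n, (∏ i, noiseWeight ε (t i)) * ∑ y, (2 ^ n)⁻¹ * F t y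

/-- The expectation over the noise of all copies and the uniform outcomes. -/
def totalEx (M : ℕ) (ε : ℝ) (Φ : (Fin M → Bits n) → (Fin (M / 3) → Bits n) → ℝ) : ℝ :=
  ∑ b : Fin M → Bits n, (∏ k, noiseWeight ε (b k)) *
    ∑ y : Fin (M / 3) → Bits n, ((2 ^ n)⁻¹ : ℝ) ^ (M / 3) * Φ b y

/-- The groups are independent, and the at most two copies outside of all groups contribute total
weight one. -/
theorem totalEx_prod (ε : ℝ) (F : (Fin 3 → Bits n) → Bits n → ℝ) :
    totalEx M ε (fun b y => ∏ g, F (grp b g) (y g)) = groupEx ε F ^ (M / 3) := by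
  have h1 : ∀ b : Fin M → Bits n, ∑ y : Fin (M / 3) → Bits n,
      ((2 ^ n)⁻¹ : ℝ) ^ (M / 3) * ∏ g, F (grp b g) (y g) =
      ∏ g, ∑ y, (2 ^ n)⁻¹ * F (grp b g) y := by
    intro b
    rw [Finset.prod_univ_sum, Fintype.piFinset_univ]
    refine Finset.sum_congr rfl fun y _ => ?_
    rw [Finset.prod_mul_distrib, Finset.prod_const, Finset.card_univ, Fintype.card_fin]
  unfold totalEx
  simp only [h1]
  rw [Fintype.sum_equiv (famEquiv M (Bits n)) _ (fun p =>
    (∏ g, ((∏ i, noiseWeight ε (p.1 g i)) * ∑ y, (2 ^ n)⁻¹ * F (p.1 g) y)) *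
      ∏ j, noiseWeight ε (p.2 j)), Fintype.sum_prod_type]
  · refine (Fintype.sum_mul_sum (fun x : Fin (M / 3) → Fin 3 → Bits n =>
      ∏ g, ((∏ i, noiseWeight ε (x g i)) * ∑ y, (2 ^ n)⁻¹ * F (x g) y))
      fun c : Fin (M % 3) → Bits n => ∏ j, noiseWeight ε (c j)).symm.trans ?_
    rw [sum_prod_pow, sum_noiseWeight, one_pow, mul_one]
    exact sum_prod_pow (fun t : Fin 3 → Bits n =>
      (∏ i, noiseWeight ε (t i)) * ∑ y, (2 ^ n)⁻¹ * F t y) (M / 3)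
  · intro b
    rw [prod_copies, famEquiv_fst, Finset.prod_mul_distrib]
    ring

theorem totalEx_mono {ε : ℝ} (h0 : 0 ≤ ε) (h1 : ε ≤ 1)
    {Φ Ψ : (Fin M → Bits n) → (Fin (M / 3) → Bits n) → ℝ} (h : ∀ b y, Φ b y ≤ Ψ b y) :
    totalEx M ε Φ ≤ totalEx M ε Ψ := by
  refine Finset.sum_le_sum fun b _ => mul_le_mul_of_nonneg_left (Finset.sum_le_sum fun y _ =>
    mul_le_mul_of_nonneg_left (h b y) (by positivity))
    (Finset.prod_nonneg fun k _ => noiseWeight_nonneg h0 h1 _)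

theorem totalEx_add (ε : ℝ) (Φ Ψ : (Fin M → Bits n) → (Fin (M / 3) → Bits n) → ℝ) :
    totalEx M ε (fun b y => Φ b y + Ψ b y) = totalEx M ε Φ + totalEx M ε Ψ := by
  simp only [totalEx, mul_add, Finset.sum_add_distrib]

theorem totalEx_sum {ι : Type} (ε : ℝ) (s : Finset ι)
    (Φ : ι → (Fin M → Bits n) → (Fin (M / 3) → Bits n) → ℝ) :
    totalEx M ε (fun b y => ∑ i ∈ s, Φ i b y) = ∑ i ∈ s, totalEx M ε (Φ i) := by
  simp only [totalEx, Finset.mul_sum]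
  conv_rhs => rw [Finset.sum_comm]
  refine Finset.sum_congr rfl fun b _ => ?_
  rw [Finset.sum_comm]

theorem groupEx_mul (ε : ℝ) (f : Fin 3 → Bits n → ℝ) (k : Bits n → ℝ) :
    groupEx ε (fun t y => (∏ i, f i (t i)) * k y) =
      (∏ i, ∑ b, noiseWeight ε b * f i b) * ((2 ^ n)⁻¹ * ∑ y, k y) := by
  rw [Finset.prod_univ_sum, Fintype.piFinset_univ, Finset.sum_mul]
  refine Finset.sum_congr rfl fun t _ => ?_
  simp only [Finset.prod_mul_distrib, Finset.mul_sum]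
  exact Finset.sum_congr rfl fun y _ => by ring

theorem groupEx_mono {ε : ℝ} (h0 : 0 ≤ ε) (h1 : ε ≤ 1) {F K : (Fin 3 → Bits n) → Bits n → ℝ}
    (h : ∀ t y, F t y ≤ K t y) : groupEx ε F ≤ groupEx ε K := by
  refine Finset.sum_le_sum fun b _ => mul_le_mul_of_nonneg_left (Finset.sum_le_sum fun y _ =>
    mul_le_mul_of_nonneg_left (h b y) (by positivity))
    (Finset.prod_nonneg fun k _ => noiseWeight_nonneg h0 h1 _)

theorem groupEx_nonneg {ε : ℝ} (h0 : 0 ≤ ε) (h1 : ε ≤ 1) {F : (Fin 3 → Bits n) → Bits n → ℝ}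
    (h : ∀ t y, 0 ≤ F t y) : 0 ≤ groupEx ε F :=
  Finset.sum_nonneg fun t _ => mul_nonneg
    (Finset.prod_nonneg fun k _ => noiseWeight_nonneg h0 h1 _)
    (Finset.sum_nonneg fun y _ => mul_nonneg (by positivity) (h t y))

theorem groupEx_one (ε : ℝ) : groupEx ε (fun (_ : Fin 3 → Bits n) _ => 1) = 1 := by
  have := groupEx_mul (n := n) ε (fun _ _ => 1) fun _ => 1
  simp only [mul_one, sum_noiseWeight, Finset.prod_const_one] at this
  rw [this]
  simp [ZMod.card]

theorem groupEx_affine (ε c d : ℝ) (F : (Fin 3 → Bits n) → Bits n → ℝ) :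
    groupEx ε (fun t y => c + d * F t y) = c + d * groupEx ε F := by
  conv_rhs => rw [← mul_one c, ← groupEx_one (n := n) ε]
  simp only [groupEx, Finset.mul_sum, ← Finset.sum_add_distrib]
  exact Finset.sum_congr rfl fun t _ => Finset.sum_congr rfl fun y _ => by ring

theorem totalEx_one (ε : ℝ) :
    totalEx M ε (fun (_ : Fin M → Bits n) _ => 1) = 1 := by
  have := totalEx_prod (M := M) (n := n) ε fun _ _ => 1
  simpa [groupEx_one] using this

open Classical in
/-- A tail bound for the sum of a statistic of the groups. -/
theorem totalEx_tail {ε η ρ : ℝ} (h0 : 0 ≤ ε) (h1 : ε ≤ 1) (hη0 : 0 ≤ η) (hη1 : η ≤ 1)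
    (hρ0 : 0 ≤ ρ) (hρ1 : ρ ≤ 1) {F : (Fin 3 → Bits n) → Bits n → ℝ} (hF0 : ∀ t y, 0 ≤ F t y)
    (hF1 : ∀ t y, F t y ≤ 1) (hF : groupEx ε F + η ≤ ρ) :
    totalEx M ε (fun b y => if ρ * (M / 3 : ℕ) ≤ ∑ g, F (grp b g) (y g) then 1 else 0) ≤
      (1 - η ^ 2 / 4) ^ (M / 3) := by
  -- Exponential moment with parameter η / 2. The bound exp x ≤ 1 + x + x² for |x| ≤ 1 gives at most
  -- 1 - η² / 2 + η² / 4, since the mean is at least η below ρ.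
  have h2 : groupEx ε (fun t y => Real.exp (η / 2 * (F t y - ρ))) ≤ 1 - η ^ 2 / 4 := by
    refine (groupEx_mono h0 h1 (K := fun t y => (1 - η / 2 * ρ + η ^ 2 / 4) + η / 2 * F t y)
      fun t y => ?_).trans ?_
    · have h3 : |F t y - ρ| ≤ 1 := by
        have := hF0 t y
        have := hF1 t y
        rw [abs_le]
        constructor <;> linarith
      have h4 : |η / 2 * (F t y - ρ)| ≤ 1 := by
        rw [abs_mul, abs_of_nonneg (by positivity)]
        nlinarith [abs_nonneg (F t y - ρ)]
      have h5 := (abs_le.1 (Real.abs_exp_sub_one_sub_id_le h4)).2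
      have h6 : (F t y - ρ) ^ 2 ≤ 1 := by
        rw [← sq_abs]
        exact pow_le_one₀ (abs_nonneg _) h3
      nlinarith [sq_nonneg η]
    · rw [groupEx_affine]
      nlinarith
  -- Markov's inequality: the indicator is at most the exponential of the total excess, and that
  -- factors over the groups.
  refine (totalEx_mono h0 h1 (Ψ := fun b y => ∏ g, Real.exp (η / 2 * (F (grp b g) (y g) - ρ)))
    fun b y => ?_).trans ?_
  · split_ifs with h
    · rw [← Real.exp_sum]
      refine Real.one_le_exp ?_
      rw [← Finset.mul_sum, Finset.sum_sub_distrib]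
      refine mul_nonneg (by positivity) ?_
      simp only [Finset.sum_const, Finset.card_univ, Fintype.card_fin, nsmul_eq_mul]
      linarith
    · exact Finset.prod_nonneg fun g _ => (Real.exp_pos _).le
  · rw [totalEx_prod ε fun t y => Real.exp (η / 2 * (F t y - ρ))]
    exact pow_le_pow_left₀ (groupEx_nonneg h0 h1 fun t y => (Real.exp_pos _).le) h2 _

/-! ### Means of the statistics -/

theorem val_eq_sgn (a : ZMod 2) : (a.val : ℝ) = 1 / 2 + -1 / 2 * sgn a := by
  rcases zmod2_cases a with rfl | rfl <;> norm_num [sgn_zero, sgn_one, ZMod.val_one]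

theorem sum_noiseWeight_sgn (ε : ℝ) {u : Bits n} (hu : u ≠ 0) :
    ∑ b, noiseWeight ε b * sgn (u ⬝ᵥ b) = 1 - ε := by
  rw [sum_noiseWeight_mul, sum_sgn, if_neg hu, dotProduct_zero, sgn_zero]
  ring

/-- For w ≠ 0 the bit w·y is fair and independent of the noise, so adding any function of the noise
leaves it fair. -/
theorem groupEx_reject (ε : ℝ) (u : Bits n) {w : Bits n} (hw : w ≠ 0) :
    groupEx ε (fun t y => ((w ⬝ᵥ y + u ⬝ᵥ (t 0 + t 1)).val : ℝ)) = 1 / 2 := by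
  simp only [val_eq_sgn]
  rw [groupEx_affine]
  have := groupEx_mul ε ![fun b => sgn (u ⬝ᵥ b), fun b => sgn (u ⬝ᵥ b), fun _ => 1]
    fun y => sgn (w ⬝ᵥ y)
  rw [sum_sgn, if_neg hw, mul_zero, mul_zero] at this
  simp only [Fin.prod_univ_three, Matrix.cons_val] at this
  have h2 : groupEx ε (fun t y => sgn (w ⬝ᵥ y + u ⬝ᵥ (t 0 + t 1))) = 0 := by
    rw [← this]
    congr 1
    funext t y
    rw [sgn_add, dotProduct_add, sgn_add]
    ring
  rw [h2]
  ring

/-- For u ≠ 0 the sign of u·b has mean 1 - ε on each copy, so two independent copies give (1 - ε)²,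
and (1 - (1 - ε)²) / 2 = ε (1 - ε / 2). -/
theorem groupEx_accept {ε : ℝ} (h0 : 0 ≤ ε) (h1 : ε ≤ 1) (u : Bits n) :
    groupEx ε (fun t _ => ((u ⬝ᵥ (t 0 + t 1)).val : ℝ)) ≤ ε * (1 - ε / 2) := by
  by_cases hu : u = 0
  · subst hu
    have : 0 ≤ ε * (1 - ε / 2) := mul_nonneg h0 (by linarith)
    simpa [groupEx] using this
  simp only [val_eq_sgn]
  rw [groupEx_affine]
  have := groupEx_mul ε ![fun b => sgn (u ⬝ᵥ b), fun b => sgn (u ⬝ᵥ b), fun _ => 1] fun _ => 1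
  simp only [Fin.prod_univ_three, Matrix.cons_val, sum_noiseWeight_sgn ε hu, mul_one,
    sum_noiseWeight] at this
  have h2 : groupEx ε (fun t _ => sgn (u ⬝ᵥ (t 0 + t 1))) = (1 - ε) * (1 - ε) := by
    simp only [dotProduct_add, sgn_add]
    rw [this]
    simp [ZMod.card]
  rw [h2]
  apply le_of_eq
  ring

theorem groupEx_diag (ε : ℝ) (i : Fin n) :
    groupEx ε (fun t _ => ((t 2 i).val : ℝ)) = ε / 2 := by
  simp only [val_eq_sgn]
  rw [groupEx_affine]
  have hu : (Pi.single i 1 : Bits n) ≠ 0 := by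
    intro h
    have := congrFun h i
    simp at this
  have := groupEx_mul ε ![fun _ => 1, fun _ => 1, fun b => sgn (Pi.single i 1 ⬝ᵥ b)] fun _ => 1
  have h2 := sum_noiseWeight_sgn ε hu
  simp only [Fin.prod_univ_three, Matrix.cons_val, mul_one, one_mul, sum_noiseWeight,
    single_one_dotProduct] at this h2
  rw [this, h2]
  simp [ZMod.card]
  ring

open Classical in
-- Both noise vectors vanish with probability at least (1 - ε)², and independently h·y is a fair
-- bit. Equal nonzero noise vectors would also help but are not counted.
theorem groupEx_rank {ε : ℝ} (h0 : 0 ≤ ε) (h1 : ε ≤ 1) {h : Bits n} (hh : h ≠ 0) :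
    groupEx ε (fun t y => if t 0 + t 1 = 0 ∧ h ⬝ᵥ y ≠ 0 then 0 else 1) ≤
      1 - (1 - ε) ^ 2 / 2 := by
  obtain ⟨z, hz⟩ : ∃ z : Bits n → ℝ, ∀ b, z b = if b = 0 then 1 else 0 := ⟨_, fun _ => rfl⟩
  have h2 := groupEx_mul ε ![z, z, fun _ => 1] fun y => ((h ⬝ᵥ y).val : ℝ)
  have h3 : (2 ^ n : ℝ)⁻¹ * ∑ y : Bits n, ((h ⬝ᵥ y).val : ℝ) = 1 / 2 := by
    simp only [val_eq_sgn, Finset.sum_add_distrib, ← Finset.mul_sum, sum_sgn, if_neg hh]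
    simp [ZMod.card]
  have h4 : 1 - ε ≤ ∑ b, noiseWeight ε b * z b := by
    simp only [hz, mul_ite, mul_one, mul_zero, Finset.sum_ite_eq', Finset.mem_univ, if_true,
      noiseWeight]
    have : 0 ≤ ε / 2 ^ n := by positivity
    linarith
  simp only [h3, Fin.prod_univ_three, Matrix.cons_val, mul_one, sum_noiseWeight] at h2
  refine (groupEx_mono h0 h1 (K := fun t y => 1 + -1 * (z (t 0) * z (t 1) * ((h ⬝ᵥ y).val : ℝ)))
    fun t y => ?_).trans ?_
  · by_cases e0 : t 0 = 0
    · by_cases e1 : t 1 = 0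
      · rcases zmod2_cases (h ⬝ᵥ y) with e | e <;> simp [hz, e0, e1, e, ZMod.val_one]
      · simp [hz, e1]
        split_ifs <;> norm_num
    · simp [hz, e0]
      split_ifs <;> norm_num
  · rw [groupEx_affine, h2]
    nlinarith

end
end PhaseLearning

namespace PhaseLearning

noncomputable section

variable {M n G : ℕ}

/-! ### The union bound -/

/-- The slack `η` separates the thresholds of the algorithm from the means of the statistics. -/
structure Slack (ε η : ℝ) (α β : ℕ) : Prop where
  pos : 0 < η
  le_one : η ≤ 1
  alpha : 0 < α
  reject : 1 / 2 + η ≤ 1 - (β : ℝ) / α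
  accept : ε * (1 - ε / 2) + η ≤ (β : ℝ) / α
  rank : η ≤ (1 - ε) ^ 2 / 2
  diag : ε / 2 + η ≤ 1 / 2

open Classical in
-- The union bound before taking expectations: a violated clause of `Good` switches on one of the
-- indicators. The lower tail of `Good.reject` becomes an upper tail by complementing the bits, and
-- the threshold 1 in the rank term means that every group fails.
theorem one_le_good_add {ε η : ℝ} {α β : ℕ} (hs : Slack ε η α β)
    (A : Matrix (Fin n) (Fin n) (ZMod 2)) (t : Fin G → Fin 3 → Bits n) (y : Fin G → Bits n) :
    (1 : ℝ) ≤ (if Good α β A t y then 1 else 0) +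
      (∑ p : Bits n × {w : Bits n // w ≠ 0}, (if (1 - (β : ℝ) / α) * G ≤
        ∑ g, (1 + -1 * ((p.2.1 ⬝ᵥ y g + p.1 ⬝ᵥ (t g 0 + t g 1)).val : ℝ)) then 1 else 0) +
      (∑ u : Bits n, (if (β : ℝ) / α * G ≤ ∑ g, ((u ⬝ᵥ (t g 0 + t g 1)).val : ℝ) then 1 else 0) +
      (∑ h : {h : Bits n // h ≠ 0}, (if 1 * (G : ℝ) ≤
        ∑ g, (if t g 0 + t g 1 = 0 ∧ h.1 ⬝ᵥ y g ≠ 0 then 0 else 1) then 1 else 0) +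
      ∑ i : Fin n, (if 1 / 2 * (G : ℝ) ≤ ∑ g, ((t g 2 i).val : ℝ) then 1 else 0)))) := by
  have hα : (0 : ℝ) < α := by exact_mod_cast hs.alpha
  have key : ∀ {ι : Type} [Fintype ι] (Q : ι → Prop) (i : ι), Q i →
      (1 : ℝ) ≤ ∑ j, if Q j then 1 else 0 := by
    intro ι _ Q i hi
    refine le_trans ?_ (Finset.single_le_sum (f := fun j => if Q j then (1 : ℝ) else 0)
      (fun j _ => by positivity) (Finset.mem_univ i))
    simp [hi]
  have nn : ∀ {ι : Type} [Fintype ι] (Q : ι → Prop), (0 : ℝ) ≤ ∑ j, if Q j then 1 else 0 :=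
    fun Q => Finset.sum_nonneg fun j _ => by positivity
  by_cases hg : Good α β A t y
  · rw [if_pos hg]
    have := nn fun p : Bits n × {w : Bits n // w ≠ 0} => (1 - (β : ℝ) / α) * G ≤
        ∑ g, (1 + -1 * ((p.2.1 ⬝ᵥ y g + p.1 ⬝ᵥ (t g 0 + t g 1)).val : ℝ))
    have := nn fun u : Bits n => (β : ℝ) / α * G ≤ ∑ g, ((u ⬝ᵥ (t g 0 + t g 1)).val : ℝ)
    have := nn fun h : {h : Bits n // h ≠ 0} => 1 * (G : ℝ) ≤
        ∑ g, (if t g 0 + t g 1 = 0 ∧ h.1 ⬝ᵥ y g ≠ 0 then 0 else 1)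
    have := nn fun i : Fin n => 1 / 2 * (G : ℝ) ≤ ∑ g, ((t g 2 i).val : ℝ)
    linarith
  rw [if_neg hg, zero_add]
  have h4 := nn fun i : Fin n => 1 / 2 * (G : ℝ) ≤ ∑ g, ((t g 2 i).val : ℝ)
  have h3 := nn fun h : {h : Bits n // h ≠ 0} => 1 * (G : ℝ) ≤
        ∑ g, (if t g 0 + t g 1 = 0 ∧ h.1 ⬝ᵥ y g ≠ 0 then 0 else 1)
  have h2 := nn fun u : Bits n => (β : ℝ) / α * G ≤ ∑ g, ((u ⬝ᵥ (t g 0 + t g 1)).val : ℝ)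
  have h1 := nn fun p : Bits n × {w : Bits n // w ≠ 0} => (1 - (β : ℝ) / α) * G ≤
        ∑ g, (1 + -1 * ((p.2.1 ⬝ᵥ y g + p.1 ⬝ᵥ (t g 0 + t g 1)).val : ℝ))
  by_cases c1 : ∀ u w : Bits n, w ≠ 0 → β * G ≤ α * ∑ g, (w ⬝ᵥ y g + u ⬝ᵥ (t g 0 + t g 1)).val
  · by_cases c2 : ∀ u : Bits n, α * ∑ g, (u ⬝ᵥ (t g 0 + t g 1)).val < β * G
    · by_cases c3 : ∀ h : Bits n, h ≠ 0 → ∃ g, t g 0 + t g 1 = 0 ∧ h ⬝ᵥ y g ≠ 0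
      · by_cases c4 : ∀ i, 2 * ∑ g, (t g 2 i).val < G
        · exact absurd ⟨c1, c2, c3, c4⟩ hg
        · push Not at c4
          obtain ⟨i, hi⟩ := c4
          have hi' : (G : ℝ) ≤ 2 * ∑ g, ((t g 2 i).val : ℝ) := by exact_mod_cast hi
          have := key (fun i : Fin n => 1 / 2 * (G : ℝ) ≤ ∑ g, ((t g 2 i).val : ℝ)) i
            (by linarith)
          linarith
      · push Not at c3
        obtain ⟨h, hh, hc⟩ := c3
        have := key (fun h : {h : Bits n // h ≠ 0} => 1 * (G : ℝ) ≤
          ∑ g, (if t g 0 + t g 1 = 0 ∧ h.1 ⬝ᵥ y g ≠ 0 then 0 else 1)) ⟨h, hh⟩ (by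
            rw [Finset.sum_congr rfl fun g _ => if_neg fun e => e.2 (hc g e.1)]
            simp)
        linarith
    · push Not at c2
      obtain ⟨u, hu⟩ := c2
      have hu' : (β : ℝ) * G ≤ α * ∑ g, ((u ⬝ᵥ (t g 0 + t g 1)).val : ℝ) := by exact_mod_cast hu
      have := key (fun u : Bits n => (β : ℝ) / α * G ≤ ∑ g, ((u ⬝ᵥ (t g 0 + t g 1)).val : ℝ)) u
        (by rw [div_mul_eq_mul_div, div_le_iff₀ hα]; linarith)
      linarith
  · push Not at c1
    obtain ⟨u, w, hw, hu⟩ := c1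
    have hu' : (α : ℝ) * ∑ g, ((w ⬝ᵥ y g + u ⬝ᵥ (t g 0 + t g 1)).val : ℝ) < β * G := by
      exact_mod_cast hu
    have := key (fun p : Bits n × {w : Bits n // w ≠ 0} => (1 - (β : ℝ) / α) * G ≤
        ∑ g, (1 + -1 * ((p.2.1 ⬝ᵥ y g + p.1 ⬝ᵥ (t g 0 + t g 1)).val : ℝ))) (u, ⟨w, hw⟩) (by
          rw [Finset.sum_add_distrib, ← Finset.mul_sum, sub_mul, div_mul_eq_mul_div]
          have h5 := (lt_div_iff₀' hα).2 hu'
          simp only [Finset.sum_const, Finset.card_univ, Fintype.card_fin, nsmul_eq_mul, mul_one]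
          linarith)
    linarith

theorem card_bits : Fintype.card (Bits n) = 2 ^ n := by simp [ZMod.card]

open Classical in
-- There are four families of bad events. The pairs (u, w) number at most 4ⁿ, and the other families
-- are bounded by the same number, whence the factor 4 * 4 ^ n.
theorem le_totalEx_good {ε η : ℝ} {α β : ℕ} (h0 : 0 ≤ ε) (h1 : ε ≤ 1) (hs : Slack ε η α β)
    (A : Matrix (Fin n) (Fin n) (ZMod 2)) : 1 - 4 * 4 ^ n * (1 - η ^ 2 / 4) ^ (M / 3) ≤
      totalEx M ε fun b y => if Good α β A (grp b) y then 1 else 0 := by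
  have hα : (0 : ℝ) < α := by exact_mod_cast hs.alpha
  have hη0 := hs.pos.le
  have hη1 := hs.le_one
  have hβ : (0 : ℝ) ≤ (β : ℝ) / α := by positivity
  have hβ2 := hs.reject
  have hval : ∀ a : ZMod 2, ((a.val : ℕ) : ℝ) ≤ 1 := by
    intro a
    rcases zmod2_cases a with rfl | rfl <;> simp [ZMod.val_one]
  set r : ℝ := (1 - η ^ 2 / 4) ^ (M / 3) with hr
  have hr0 : 0 ≤ r := pow_nonneg (by nlinarith) _
  have t1 : ∀ p : Bits n × {w : Bits n // w ≠ 0}, totalEx M ε (fun b y =>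
      if (1 - (β : ℝ) / α) * (M / 3 : ℕ) ≤ ∑ g, (1 + -1 * ((p.2.1 ⬝ᵥ y g +
        p.1 ⬝ᵥ (grp b g 0 + grp b g 1)).val : ℝ)) then 1 else 0) ≤ r := by
    intro p
    refine totalEx_tail (F := fun t y => 1 + -1 * ((p.2.1 ⬝ᵥ y + p.1 ⬝ᵥ (t 0 + t 1)).val : ℝ))
      h0 h1 hη0 hη1 (by linarith) (by linarith)
      (fun t y => by linarith [hval (p.2.1 ⬝ᵥ y + p.1 ⬝ᵥ (t 0 + t 1))])
      (fun t y => by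
        have : (0 : ℝ) ≤ ((p.2.1 ⬝ᵥ y + p.1 ⬝ᵥ (t 0 + t 1)).val : ℝ) := Nat.cast_nonneg _
        linarith) ?_
    rw [groupEx_affine, groupEx_reject ε _ p.2.2]
    linarith
  have t2 : ∀ u : Bits n, totalEx M ε (fun b _ => if (β : ℝ) / α * (M / 3 : ℕ) ≤
      ∑ g, ((u ⬝ᵥ (grp b g 0 + grp b g 1)).val : ℝ) then 1 else 0) ≤ r := by
    intro u
    refine totalEx_tail (F := fun t _ => ((u ⬝ᵥ (t 0 + t 1)).val : ℝ))
      h0 h1 hη0 hη1 hβ (by linarith) (fun t y => Nat.cast_nonneg _) (fun t y => hval _) ?_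
    linarith [groupEx_accept h0 h1 u, hs.accept]
  have t3 : ∀ h : {h : Bits n // h ≠ 0}, totalEx M ε (fun b y => if 1 * ((M / 3 : ℕ) : ℝ) ≤
      ∑ g, (if grp b g 0 + grp b g 1 = 0 ∧ h.1 ⬝ᵥ y g ≠ 0 then 0 else 1) then 1 else 0) ≤ r := by
    intro h
    refine totalEx_tail (F := fun t y => if t 0 + t 1 = 0 ∧ h.1 ⬝ᵥ y ≠ 0 then 0 else 1)
      h0 h1 hη0 hη1 zero_le_one le_rfl (fun t y => by split_ifs <;> norm_num)
      (fun t y => by split_ifs <;> norm_num) ?_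
    linarith [groupEx_rank h0 h1 h.2, hs.rank]
  have t4 : ∀ i : Fin n, totalEx M ε (fun b _ => if 1 / 2 * ((M / 3 : ℕ) : ℝ) ≤
      ∑ g, ((grp b g 2 i).val : ℝ) then 1 else 0) ≤ r := by
    intro i
    refine totalEx_tail (F := fun t _ => ((t 2 i).val : ℝ)) h0 h1 hη0 hη1 (by norm_num)
      (by norm_num) (fun t y => Nat.cast_nonneg _) (fun t y => hval _) ?_
    rw [groupEx_diag]
    exact hs.diag
  have h5 := totalEx_mono (M := M) (n := n) h0 h1 fun b y => one_le_good_add hs A (grp b) y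
  rw [totalEx_one, totalEx_add, totalEx_add, totalEx_add, totalEx_add, totalEx_sum, totalEx_sum,
    totalEx_sum, totalEx_sum] at h5
  have s1 := Finset.sum_le_card_nsmul Finset.univ _ r fun p _ => t1 p
  have s2 := Finset.sum_le_card_nsmul Finset.univ _ r fun p _ => t2 p
  have s3 := Finset.sum_le_card_nsmul Finset.univ _ r fun p _ => t3 p
  have s4 := Finset.sum_le_card_nsmul Finset.univ _ r fun p _ => t4 p
  have c0 : Fintype.card {w : Bits n // w ≠ 0} ≤ 2 ^ n := (Fintype.card_subtype_le _).trans_eq card_bits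
  have p2 : (2 : ℝ) ^ n ≤ 4 ^ n := pow_le_pow_left₀ (by norm_num) (by norm_num) n
  have b1 : ((Fintype.card (Bits n × {w : Bits n // w ≠ 0}) : ℕ) : ℝ) ≤ 4 ^ n := by
    rw [Fintype.card_prod, card_bits]
    have : 2 ^ n * Fintype.card {w : Bits n // w ≠ 0} ≤ 4 ^ n := by
      refine (Nat.mul_le_mul_left _ c0).trans_eq ?_
      rw [← mul_pow]
      norm_num
    exact_mod_cast this
  have b2 : ((Fintype.card (Bits n) : ℕ) : ℝ) ≤ 4 ^ n := by
    rw [card_bits]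
    exact_mod_cast p2
  have b3 : ((Fintype.card {h : Bits n // h ≠ 0} : ℕ) : ℝ) ≤ 4 ^ n := by
    refine le_trans ?_ p2
    exact_mod_cast c0
  have b4 : ((Fintype.card (Fin n) : ℕ) : ℝ) ≤ 4 ^ n := by
    rw [Fintype.card_fin]
    exact_mod_cast (Nat.lt_pow_self (by norm_num : 1 < 4)).le
  rw [nsmul_eq_mul, Finset.card_univ] at s1 s2 s3 s4
  have q1 := s1.trans (mul_le_mul_of_nonneg_right b1 hr0)
  have q2 := s2.trans (mul_le_mul_of_nonneg_right b2 hr0)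
  have q3 := s3.trans (mul_le_mul_of_nonneg_right b3 hr0)
  have q4 := s4.trans (mul_le_mul_of_nonneg_right b4 hr0)
  linarith

theorem le_learnProb {ε η : ℝ} {α β X T : ℕ} (h0 : 0 ≤ ε) (h1 : ε ≤ 1) (hs : Slack ε η α β)
    {A : Matrix (Fin n) (Fin n) (ZMod 2)} (hA : ∀ i j, j < i → A i j = 0)
    (hn : 2 * n ≤ X) (hM : M ≤ X) (hT : (X + 3) ^ 100 ≤ T) :
    1 - 4 * 4 ^ n * (1 - η ^ 2 / 4) ^ (M / 3) ≤ learnProb (learner α β) ε A M T := by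
  refine (le_totalEx_good h0 h1 hs A).trans
    (le_trans (le_of_eq ?_) (sum_good_le_learnProb h0 h1 hA hn hM hT))
  simp only [totalEx, mul_ite, mul_one, mul_zero]

/-! ### Choice of the constants and asymptotics -/

/-- Since ε (1 - ε / 2) = (1 - (1 - ε)²) / 2 is below 1 / 2, a rational threshold β / α fits
strictly between. The slack is the smallest of the four gaps. -/
theorem exists_slack {ε : ℝ} (h0 : 0 < ε) (h1 : ε < 1) : ∃ η α β, Slack ε η α β := by
  have hq : ε * (1 - ε / 2) < 1 / 2 := by nlinarith [sq_pos_of_pos (sub_pos.2 h1)]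
  have hq0 : 0 < ε * (1 - ε / 2) := mul_pos h0 (by linarith)
  obtain ⟨c, hc1, hc2⟩ := exists_rat_btwn hq
  have hc0 : 0 < c := by exact_mod_cast hq0.trans hc1
  have hc : (c.num.toNat : ℝ) / c.den = c := by
    have h2 : (c.num.toNat : ℤ) = c.num := Int.toNat_of_nonneg (Rat.num_pos.2 hc0).le
    have h3 : (c.num.toNat : ℝ) = (c.num : ℝ) := by exact_mod_cast congrArg (Int.cast (R := ℝ)) h2
    rw [h3]
    exact (Rat.cast_def c).symm
  refine ⟨min (min (1 / 2 - c) (c - ε * (1 - ε / 2))) (min ((1 - ε) ^ 2 / 2) (1 / 2 - ε / 2)),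
    c.den, c.num.toNat, ?_, ?_, c.den_pos, ?_, ?_, ?_, ?_⟩
  · refine lt_min (lt_min (by linarith) (by linarith)) (lt_min ?_ (by linarith))
    have : 0 < 1 - ε := by linarith
    positivity
  · refine ((min_le_right _ _).trans (min_le_right _ _)).trans ?_
    linarith
  · rw [hc]
    have := (min_le_left (min ((1 : ℝ) / 2 - c) (c - ε * (1 - ε / 2)))
      (min ((1 - ε) ^ 2 / 2) (1 / 2 - ε / 2))).trans (min_le_left _ _)
    linarith
  · rw [hc]
    have := (min_le_left (min ((1 : ℝ) / 2 - c) (c - ε * (1 - ε / 2)))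
      (min ((1 - ε) ^ 2 / 2) (1 / 2 - ε / 2))).trans (min_le_right _ _)
    linarith
  · exact (min_le_right _ _).trans (min_le_left _ _)
  · have := (min_le_right (min ((1 : ℝ) / 2 - c) (c - ε * (1 - ε / 2)))
      (min ((1 - ε) ^ 2 / 2) (1 / 2 - ε / 2))).trans (min_le_right _ _)
    linarith

/-- The number of groups exceeds K * n for every fixed K, since n ^ (3 / 2) outgrows n. With K such
that r ^ K < 1 / 32, the bound 4 ≤ 4 ^ n and 4 * 4 / 32 = 1 / 2 give the claim. -/
theorem eventually_failure_le {r : ℝ} (h0 : 0 ≤ r) (h1 : r < 1) : ∀ᶠ n : ℕ in Filter.atTop,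
    4 * 4 ^ n * r ^ (⌊2 * (n : ℝ) ^ (1 + 1 / 2 : ℝ)⌋₊ / 3) ≤ (2 : ℝ) ^ (-(1 * n : ℝ)) := by
  obtain ⟨K, hK⟩ := exists_pow_lt_of_lt_one (show (0 : ℝ) < 1 / 32 by norm_num) h1
  filter_upwards [Filter.eventually_ge_atTop 1, Filter.eventually_ge_atTop ((3 * K) ^ 2)]
    with n hn1 hnK
  have hn0 : (0 : ℝ) < n := by exact_mod_cast hn1
  have hM : K * n ≤ ⌊2 * (n : ℝ) ^ (1 + 1 / 2 : ℝ)⌋₊ / 3 := by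
    rw [Nat.le_div_iff_mul_le (by norm_num)]
    refine Nat.le_floor ?_
    rw [Real.rpow_add hn0, Real.rpow_one, ← Real.sqrt_eq_rpow]
    have : ((3 * K : ℕ) : ℝ) ≤ Real.sqrt n := Real.le_sqrt_of_sq_le (by exact_mod_cast hnK)
    push_cast at this ⊢
    nlinarith [Real.sqrt_nonneg n]
  have h2 : r ^ (⌊2 * (n : ℝ) ^ (1 + 1 / 2 : ℝ)⌋₊ / 3) ≤ (1 / 32) ^ n := by
    refine (pow_le_pow_of_le_one h0 h1.le hM).trans ?_
    rw [pow_mul]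
    exact pow_le_pow_left₀ (pow_nonneg h0 _) hK.le n
  refine (mul_le_mul_of_nonneg_left h2 (by positivity)).trans ?_
  rw [one_mul, Real.rpow_neg (by norm_num), Real.rpow_natCast, mul_assoc, ← mul_pow, ← inv_pow]
  have h3 : (4 : ℝ) ≤ 4 ^ n := le_self_pow₀ (by norm_num) (by omega)
  calc (4 : ℝ) * (4 * (1 / 32)) ^ n ≤ 4 ^ n * (4 * (1 / 32)) ^ n := by gcongr
    _ = (2⁻¹) ^ n := by rw [← mul_pow]; norm_num

/-- After taking logarithms, 300 * log n * log (log n) ≤ 300 * (log n)², which is eventually at most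
n * log 2. -/
theorem eventually_pow_le : ∀ᶠ n : ℕ in Filter.atTop,
    (n : ℝ) ^ 300 ≤ (2 : ℝ) ^ (1 * n / Real.log (Real.log n)) := by
  have h1 := (Real.isLittleO_pow_log_id_atTop (n := 2)).bound (c := Real.log 2 / 300)
    (div_pos (Real.log_pos (by norm_num)) (by norm_num))
  have h2 : ∀ᶠ x : ℝ in Filter.atTop, 1 < Real.log (Real.log x) :=
    (Real.tendsto_log_atTop.comp Real.tendsto_log_atTop).eventually_gt_atTop 1
  filter_upwards [tendsto_natCast_atTop_atTop.eventually h1,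
    tendsto_natCast_atTop_atTop.eventually h2,
    tendsto_natCast_atTop_atTop.eventually (Real.tendsto_log_atTop.eventually_gt_atTop 1),
    Filter.eventually_gt_atTop 0] with n e1 e2 e3 e4
  have hn0 : (0 : ℝ) < n := by exact_mod_cast e4
  have hl : Real.log (Real.log n) ≤ Real.log n := by
    have := Real.log_le_sub_one_of_pos (show 0 < Real.log n by linarith)
    linarith
  have hlog2 : 0 < Real.log 2 := Real.log_pos (by norm_num)
  rw [id, Real.norm_of_nonneg (by positivity), Real.norm_of_nonneg hn0.le] at e1
  rw [one_mul, Real.rpow_def_of_pos (by norm_num), ← Real.exp_log (pow_pos hn0 300), Real.log_pow]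
  refine Real.exp_le_exp.2 ?_
  rw [← mul_div_assoc, le_div_iff₀ (by linarith)]
  push_cast
  nlinarith

/-- The number of copies is at most 2 * n ^ 2, so the base of the time bound is at most n ^ 3, and
its hundredth power is n ^ 300. -/
theorem eventually_time_le : ∀ᶠ n : ℕ in Filter.atTop,
    (2 * n + ⌊2 * (n : ℝ) ^ (1 + 1 / 2 : ℝ)⌋₊ + 3) ^ 100 ≤
      ⌊(n : ℝ) * (2 : ℝ) ^ (1 * n / Real.log (Real.log n))⌋₊ := by
  filter_upwards [eventually_pow_le, Filter.eventually_ge_atTop 7] with n h1 hn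
  have hn1 : (1 : ℝ) ≤ n := by exact_mod_cast (by omega : 1 ≤ n)
  have hM : ⌊2 * (n : ℝ) ^ (1 + 1 / 2 : ℝ)⌋₊ ≤ 2 * n ^ 2 := by
    refine Nat.floor_le_of_le ?_
    push_cast
    have : (n : ℝ) ^ (1 + 1 / 2 : ℝ) ≤ (n : ℝ) ^ (2 : ℝ) :=
      Real.rpow_le_rpow_of_exponent_le hn1 (by norm_num)
    rw [Real.rpow_two] at this
    linarith
  refine Nat.le_floor ?_
  have h2 : 2 * n + ⌊2 * (n : ℝ) ^ (1 + 1 / 2 : ℝ)⌋₊ + 3 ≤ n ^ 3 := by nlinarith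
  have h3 : (2 * n + ⌊2 * (n : ℝ) ^ (1 + 1 / 2 : ℝ)⌋₊ + 3) ^ 100 ≤ n ^ 300 :=
    (Nat.pow_le_pow_left h2 100).trans_eq (pow_mul n 3 100).symm
  calc (((2 * n + ⌊2 * (n : ℝ) ^ (1 + 1 / 2 : ℝ)⌋₊ + 3) ^ 100 : ℕ) : ℝ) ≤ (n : ℝ) ^ 300 := by
        exact_mod_cast h3
    _ ≤ _ := h1
    _ ≤ _ := le_mul_of_one_le_left (by positivity) hn1

end
end PhaseLearning

theorem mainTheorem7 (ε : ℝ) (hε0 : 0 < ε) (hε1 : ε < 1) :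
    ∃ δ : ℝ, 0 < δ ∧ δ < 1 ∧ ∃ C κ : ℝ, 0 < κ ∧ ∃ P : PhaseLearning.Prog,
      ∀ᶠ n : ℕ in Filter.atTop,
        ∀ A : Matrix (Fin n) (Fin n) (ZMod 2), (∀ i j, j < i → A i j = 0) →
          1 - (2 : ℝ) ^ (-(κ * n)) ≤
            PhaseLearning.learnProb P ε A
              ⌊2 * (n : ℝ) ^ (1 + δ)⌋₊
              ⌊(n : ℝ) * (2 : ℝ) ^ (C * n / Real.log (Real.log n))⌋₊ := by
  obtain ⟨η, α, β, hs⟩ := PhaseLearning.exists_slack hε0 hε1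
  -- The choice δ = 1 / 2 makes the number of groups per dimension grow like √n, which beats any
  -- constant in the union bound.
  refine ⟨1 / 2, by norm_num, by norm_num, 1, 1, one_pos, PhaseLearning.learner α β, ?_⟩
  have h0 := hs.pos
  have h1 := hs.le_one
  filter_upwards [PhaseLearning.eventually_failure_le (r := 1 - η ^ 2 / 4) (by nlinarith)
    (by nlinarith), PhaseLearning.eventually_time_le] with n hf ht A hA
  refine le_trans ?_ (PhaseLearning.le_learnProb hε0.le hε1.le hs hA (Nat.le_add_right _ _)
    (Nat.le_add_left _ _) ht)
  linarith
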